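/- **Setting.** Let $M$ be a finite MDP with state set $S$, action set $A$, nonempty sets $E(s)\subseteq A$ of enabled actions (every action being enabled in at most one state), transition distributions $\Delta(s,a)$ for $a\in E(s)$, initial state $s_0$, and two distinct terminal states $1$ (the target) and $0$ (the sink): every enabled action of $0$, resp. $1$, stays there with probability one. The value $V(s)$ is the supremum, over all history-dependent randomised strategies, of the probability to reach $1$ from $s$; a strategy is $\eta$-optimal in $s$ if it reaches $1$ from $s$ with probability at least $V(s)-\eta$. An end component is a pair $(R,B)$ of a nonempty set $R$ of states and a set $B$ of actions enabled in states of $R$, such that each state of $R$ has an enabled action in $B$, the actions of $B$ never leave $R$, and any two states of $R$ are connected by a path that uses only actions of $B$. Assume that every state $s\ne 0$ that lies in an end component has $V(s)=1$. **Parameters.** Let $\varepsilon,\delta>0$, let $p_{\min}>0$ be a lower bound on the positive transition probabilities of $M$, put $c=p_{\min}/\max_s|E(s)|$ and $$\varepsilon_1=\frac{\varepsilon\, c^{|S|}}{12|S|},\quad \varepsilon_2=\frac{\varepsilon}{8},\quad m=\left\lceil \frac{\ln\bigl(6|S||A|(1+|S||A|/\varepsilon_1)/\delta\bigr)}{2\varepsilon_1^2}\right\rceil,\quad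 \zeta=(2m+1)\frac{|S||A|}{\varepsilon_1}$$ (with $m=0$ if the quotient is negative), and let $T\geq 1$ be an integer with $T\ge |S|\ln(2/\varepsilon_2)/c^{|S|}$. **Algorithm (delayed Q-learning).** Write $U(s)=\max_{a\in E(s)}U(s,a)$ and $L(s)=\max_{a\in E(s)}L(s,a)$. Initially $U(s,a)=1$ except $U(0,a)=0$, and $L(s,a)=0$ except $L(1,a)=1$. For each of the two bounds $X\in\{U,L\}$ and each pair $(s,a)$ there are an accumulator $\mathrm{acc}^X(s,a)=0$, a counter $c^X(s,a)=0$, a time $t^X(s,a)=0$ and a flag $\mathrm{Learn}^X(s,a)=\mathrm{true}$; for each $X$ there is a time $t^X_*=0$. The current state is $s=s_0$. In iteration $t=1,2,3,\dots$, choose $a$ uniformly at random from the actions of $E(s)$ that maximise $U(s,\cdot)$, draw $s'$ from $\Delta(s,a)$, and do the following, first for $X=U$, then for $X=L$. * If $\mathrm{Learn}^X(s,a)$ is true, add $X(s')$ to $\mathrm{acc}^X(s,a)$ and $1$ to $c^X(s,a)$. If now $c^X(s,a)=m$, an update is attempted with $x=\mathrm{acc}^X(s,a)/m$. For $X=U$: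 if $U(s,a)-x\ge 2\varepsilon_1$, set $U(s,a)\gets x+\varepsilon_1$ and $t^U_*\gets t$. For $X=L$: if $x-L(s,a)\ge2\varepsilon_1$, set $L(s,a)\gets x-\varepsilon_1$ and $t^L_*\gets t$. If the attempt fails and $t^X(s,a)\ge t^X_*$, set $\mathrm{Learn}^X(s,a)\gets\mathrm{false}$. After any attempt set $t^X(s,a)\gets t$, $\mathrm{acc}^X(s,a)\gets 0$, $c^X(s,a)\gets0$. * If $\mathrm{Learn}^X(s,a)$ was false, set it to true if $t^U(s,a)<t^U_*$ (for $X=U$), resp. if $t^L(s,a)<\max(t^L_*,t^U_*)$ (for $X=L$). Finally the current state becomes $s_0$ if $s'\in\{0,1\}$, and $s'$ otherwise. The strategy followed at step $t$ is the strategy of $M$ that the algorithm executes from its variables at step $t$ on: it keeps choosing greedily as above and keeps updating the variables along the path. **Theorem.** With probability at least $1-\delta$, both of the following hold: 1. on all but $O\!\left(\frac{\zeta T}{\varepsilon_2}\ln\frac1\delta\right)$ steps $t$, the strategy followed at step $t$ is $\varepsilon/2$-optimal in the state occupied at step $t$; 2. from some step on, $U(s_0)-L(s_0)\le\varepsilon$.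 The constant in $O(\cdot)$ is absolute, and for $\delta$ close to or above $1$ the factor $\ln(1/\delta)$ is to be read as $\max\{1,\ln(1/\delta)\}$. -/

import Mathlib

open MeasureTheory ProbabilityTheory

/-! ### Markov decision processes with a reachability objective -/

/-- A finite Markov decision process with state set `S`, action set `A`, an initial state, and two
distinguished terminal states: the target `target` (the state `1`) and the losing sink `sink` (the
state `0`). Every state has a nonempty set of enabled actions, and every action is enabled in at
most one state. `trans s a` is relevant only if `a` is enabled in `s`. -/
structure MDP (S A : Type*) where
  init : S
  enabled : S → Finset A
  enabled_nonempty : ∀ s, (enabled s).Nonempty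
  enabled_disjoint : ∀ s s' a, a ∈ enabled s → a ∈ enabled s' → s = s'
  trans : S → A → PMF S
  sink : S
  target : S
  sink_ne_target : sink ≠ target
  sink_terminal : ∀ a ∈ enabled sink, trans sink a sink = 1
  target_terminal : ∀ a ∈ enabled target, trans target a target = 1

/-- One step of a path or of a run: the action played and the state that is reached. -/
structure Move (S A : Type*) where
  act : A
  dest : S

instance Move.instMeasurableSpace (S A : Type*) : MeasurableSpace (Move S A) := ⊤

instance Move.instDiscrete (S A : Type*) : DiscreteMeasurableSpace (Move S A) :=
  ⟨fun _ => trivial⟩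

instance Move.instCountable (S A : Type*) [Countable S] [Countable A] : Countable (Move S A) :=
  Function.Injective.countable (f := fun x : Move S A => (x.act, x.dest)) (by
    rintro ⟨a, s⟩ ⟨b, t⟩ h
    simp only [Prod.mk.injEq] at h
    rw [h.1, h.2])

/-- The list `ω 0, …, ω (n - 1)` of the first `n` entries of a sequence. -/
def firstMoves {X : Type*} (ω : ℕ → X) (n : ℕ) : List X :=
  List.ofFn fun i : Fin n => ω i

/-- The transition kernel, from the first `n + 1` entries of a sequence to its next entry, that is
given by `next`. -/
noncomputable def moveKernel {X : Type*} [MeasurableSpace X] [DiscreteMeasurableSpace X]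
    [Countable X] (next : List X → PMF X) (n : ℕ) :
    Kernel (∀ _ : Finset.Iic n, X) X :=
  Kernel.ofFunOfCountable fun h =>
    (next (List.ofFn fun i : Fin (n + 1) =>
      h ⟨i, Finset.mem_Iic.mpr (Nat.lt_succ_iff.mp i.2)⟩)).toMeasure

instance moveKernel.instIsMarkovKernel {X : Type*} [MeasurableSpace X]
    [DiscreteMeasurableSpace X] [Countable X] (next : List X → PMF X) (n : ℕ) :
    IsMarkovKernel (moveKernel next n) :=
  ⟨fun h => by
    change IsProbabilityMeasure (PMF.toMeasure _)
    infer_instance⟩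

/-- The law of the random sequence in which, given the entries `h` so far (oldest first), the next
entry is drawn from `next h`. -/
noncomputable def processLaw {X : Type*} [MeasurableSpace X] [DiscreteMeasurableSpace X]
    [Countable X] (next : List X → PMF X) : Measure (ℕ → X) :=
  Kernel.trajMeasure (X := fun _ => X) (next []).toMeasure (moveKernel next)

namespace MDP

variable {S A : Type*}

/-- The last state of the finite path that starts in `s` and continues with the moves `h`. -/
def lastState (s : S) (h : List (Move S A)) : S :=
  (h.getLast?.map Move.dest).getD s

/-- A strategy assigns to every finite path `s₀ a₀ s₁ a₁ … sₙ`, given by its first state and the list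
of moves `(a₀, s₁), (a₁, s₂), …`, a distribution on the actions enabled in its last state. -/
structure Strategy (M : MDP S A) where
  choice : S → List (Move S A) → PMF A
  choice_enabled : ∀ s h a, a ∈ (choice s h).support → a ∈ M.enabled (lastState s h)

/-- The probability measure that a strategy induces on the infinite paths that start in `s`. -/
noncomputable def Strategy.pathLaw [Countable S] [Countable A] {M : MDP S A} (σ : M.Strategy)
    (s : S) : Measure (ℕ → Move S A) :=
  processLaw fun h => (σ.choice s h).bind fun a =>
    (M.trans (lastState s h) a).map fun s' => ⟨a, s'⟩

/-- The infinite paths from `s` that reach the target. -/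
def reachTarget (M : MDP S A) (s : S) : Set (ℕ → Move S A) :=
  {ω | s = M.target ∨ ∃ n, (ω n).dest = M.target}

/-- The probability to reach the target from `s` under a strategy. -/
noncomputable def Strategy.reachProb [Countable S] [Countable A] {M : MDP S A} (σ : M.Strategy)
    (s : S) : ℝ :=
  (σ.pathLaw s).real (M.reachTarget s)

/-- The value of a state: the supremum over all strategies of the probability to reach the
target. -/
noncomputable def value [Countable S] [Countable A] (M : MDP S A) (s : S) : ℝ :=
  ⨆ σ : M.Strategy, σ.reachProb s

/-- A strategy is `ε`-optimal in `s`. -/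
def Strategy.IsOptimalUpTo [Countable S] [Countable A] {M : MDP S A} (σ : M.Strategy) (ε : ℝ)
    (s : S) : Prop :=
  M.value s ≤ σ.reachProb s + ε

/-- `(R, B)` is an end component: `R` is a nonempty set of states in each of which some action of `B`
is enabled, the actions of `B` never leave `R`, and any two states of `R` are connected by a path
that uses actions of `B` only. -/
structure IsEndComponent (M : MDP S A) (R : Set S) (B : Set A) : Prop where
  nonempty : R.Nonempty
  subset_enabled : ∀ a ∈ B, ∃ s ∈ R, a ∈ M.enabled s
  exists_action : ∀ s ∈ R, ∃ a ∈ B, a ∈ M.enabled s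
  closed : ∀ s ∈ R, ∀ a ∈ B, a ∈ M.enabled s → ∀ s', M.trans s a s' ≠ 0 → s' ∈ R
  connected : ∀ s ∈ R, ∀ s' ∈ R,
    Relation.ReflTransGen (fun x y => ∃ a ∈ B, a ∈ M.enabled x ∧ M.trans x a y ≠ 0) s s'

/-- Every state other than the sink that lies in an end component has value `1`. -/
def EndComponentsHaveValueOne [Countable S] [Countable A] (M : MDP S A) : Prop :=
  ∀ R B, M.IsEndComponent R B → ∀ s ∈ R, s ≠ M.sink → M.value s = 1

/-- `p` is a positive lower bound on the positive transition probabilities. -/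
def IsMinProb (M : MDP S A) (p : ℝ) : Prop :=
  0 < p ∧ ∀ s, ∀ a ∈ M.enabled s, ∀ s', M.trans s a s' ≠ 0 → p ≤ (M.trans s a s').toReal

/-- The maximal number of enabled actions in a state. -/
def maxEnabled [Fintype S] (M : MDP S A) : ℕ :=
  Finset.univ.sup fun s => (M.enabled s).card

end MDP

/-! ### Delayed Q-learning -/

/-- The variables that delayed Q-learning keeps for one of the two bounds: the estimates (`val`), the
accumulators, the counters, the times of the last attempted updates and the learning flags of all
state-action pairs, and the time `lastSuccess` of the last successful update of this bound. -/
structure Estimator (S A : Type*) where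
  val : S × A → ℝ
  accum : S × A → ℝ
  count : S × A → ℕ
  time : S × A → ℕ
  learn : S × A → Prop
  lastSuccess : ℕ

/-- All the variables of delayed Q-learning except the current state of the simulation; `clock` is
the number of iterations that have been completed. -/
structure Tables (S A : Type*) where
  upper : Estimator S A
  lower : Estimator S A
  clock : ℕ

namespace Estimator

variable {S A : Type*}

/-- The initial variables, with initial estimates `v`. -/
def start (v : S × A → ℝ) : Estimator S A where
  val := v
  accum := fun _ => 0
  count := fun _ => 0
  time := fun _ => 0
  learn := fun _ => True
  lastSuccess := 0

/-- The estimate of a state: the maximum of the estimates of its enabled actions. -/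
noncomputable def stateVal (M : MDP S A) (e : Estimator S A) (s : S) : ℝ :=
  (M.enabled s).sup' (M.enabled_nonempty s) fun a => e.val (s, a)

open scoped Classical in
/-- The processing in iteration `t` of the observation that playing the pair `p` has led to a state
with estimate `v`. An attempted update takes place when `m` samples have been collected; with the
average `x` of the samples it succeeds if `success (val p) x` holds, and then the new estimate is
`newVal x`; after an unsuccessful attempt the flag is switched off unless there has been a success
since the previous attempt for `p`. A pair whose flag is off is reconsidered if its last attempted
update was before the time `wake`. -/
noncomputable def process (e : Estimator S A) (m t : ℕ) (success : ℝ → ℝ → Prop) (newVal : ℝ → ℝ)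
    (wake : ℕ) (p : S × A) (v : ℝ) : Estimator S A :=
  if e.learn p then
    if e.count p + 1 = m then
      { val := if success (e.val p) ((e.accum p + v) / m) then
            Function.update e.val p (newVal ((e.accum p + v) / m)) else e.val
        lastSuccess := if success (e.val p) ((e.accum p + v) / m) then t else e.lastSuccess
        learn := if ¬ success (e.val p) ((e.accum p + v) / m) ∧ e.lastSuccess ≤ e.time p then
            Function.update e.learn p False else e.learn
        time := Function.update e.time p t
        accum := Function.update e.accum p 0
        count := Function.update e.count p 0 }
    else
      { e with
        accum := Function.update e.accum p (e.accum p + v)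
        count := Function.update e.count p (e.count p + 1) }
  else if e.time p < wake then
    { e with learn := Function.update e.learn p True }
  else e

end Estimator

namespace Tables

variable {S A : Type*}

open scoped Classical in
/-- The initial values of the variables. -/
noncomputable def start (M : MDP S A) : Tables S A where
  upper := Estimator.start fun p => if p.1 = M.sink then 0 else 1
  lower := Estimator.start fun p => if p.1 = M.target then 1 else 0
  clock := 0

/-- The update of the variables in one iteration, in which action `a` is played in state `s` and
state `s'` is reached. -/
noncomputable def observe (M : MDP S A) (m : ℕ) (ε₁ : ℝ) (c : Tables S A) (s : S) (a : A) (s' : S) :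
    Tables S A :=
  let t := c.clock + 1
  let u := c.upper.process m t (fun q x => 2 * ε₁ ≤ q - x) (fun x => x + ε₁)
    c.upper.lastSuccess (s, a) (c.upper.stateVal M s')
  let l := c.lower.process m t (fun q x => 2 * ε₁ ≤ x - q) (fun x => x - ε₁)
    (max c.lower.lastSuccess u.lastSuccess) (s, a) (c.lower.stateVal M s')
  { upper := u, lower := l, clock := t }

/-- The variables after the moves `h` have been made one after the other, from state `s` on, without
any restart. -/
noncomputable def observePath (M : MDP S A) (m : ℕ) (ε₁ : ℝ) :
    Tables S A → S → List (Move S A) → Tables S A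
  | c, _, [] => c
  | c, s, x :: h => observePath M m ε₁ (c.observe M m ε₁ s x.act x.dest) x.dest h

open scoped Classical in
/-- The enabled actions of `s` with maximal upper bound. -/
noncomputable def greedyActions (M : MDP S A) (c : Tables S A) (s : S) : Finset A :=
  (M.enabled s).filter fun a => c.upper.val (s, a) = c.upper.stateVal M s

theorem greedyActions_nonempty (M : MDP S A) (c : Tables S A) (s : S) :
    (c.greedyActions M s).Nonempty := by
  obtain ⟨a, ha, h⟩ := Finset.exists_mem_eq_sup' (M.enabled_nonempty s)
    (fun a => c.upper.val (s, a))
  exact ⟨a, by classical exact Finset.mem_filter.mpr ⟨ha, h.symm⟩⟩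

/-- The uniform distribution on the enabled actions of `s` with maximal upper bound. -/
noncomputable def greedy (M : MDP S A) (c : Tables S A) (s : S) : PMF A :=
  PMF.uniformOfFinset (c.greedyActions M s) (c.greedyActions_nonempty M s)

theorem mem_enabled_of_mem_support_greedy (M : MDP S A) (c : Tables S A) (s : S) (a : A)
    (h : a ∈ (c.greedy M s).support) : a ∈ M.enabled s := by
  classical
  rw [greedy, PMF.mem_support_uniformOfFinset_iff] at h
  exact (Finset.mem_filter.mp h).1

/-- The strategy that delayed Q-learning executes from a point on where its variables are `c`: it
plays uniformly among the enabled actions whose current upper bound is maximal and keeps updating its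
variables along the path. -/
noncomputable def executed (M : MDP S A) (m : ℕ) (ε₁ : ℝ) (c : Tables S A) : M.Strategy where
  choice := fun s h => (c.observePath M m ε₁ s h).greedy M (MDP.lastState s h)
  choice_enabled := fun _ _ a ha => mem_enabled_of_mem_support_greedy M _ _ a ha

end Tables

namespace DQL

variable {S A : Type*}

open scoped Classical in
/-- The variables and the current state of delayed Q-learning after the iterations in which the
moves `h` were made. A simulation that has reached a terminal state is restarted in the initial
state. -/
noncomputable def run (M : MDP S A) (m : ℕ) (ε₁ : ℝ) (h : List (Move S A)) : Tables S A × S :=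
  h.foldl
    (fun c x => (c.1.observe M m ε₁ c.2 x.act x.dest,
      if x.dest = M.sink ∨ x.dest = M.target then M.init else x.dest))
    (Tables.start M, M.init)

/-- The law of the sequence of moves of delayed Q-learning, the outer loop being iterated ad
infinitum. -/
noncomputable def law [Countable S] [Countable A] (M : MDP S A) (m : ℕ) (ε₁ : ℝ) :
    Measure (ℕ → Move S A) :=
  processLaw fun h => ((run M m ε₁ h).1.greedy M (run M m ε₁ h).2).bind fun a =>
    (M.trans (run M m ε₁ h).2 a).map fun s' => ⟨a, s'⟩

/-- The variables before the iteration with number `t` (counted from `0`). -/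
noncomputable def tables (M : MDP S A) (m : ℕ) (ε₁ : ℝ) (ω : ℕ → Move S A) (t : ℕ) : Tables S A :=
  (run M m ε₁ (firstMoves ω t)).1

/-- The state in which the action of the iteration with number `t` is played. -/
noncomputable def state (M : MDP S A) (m : ℕ) (ε₁ : ℝ) (ω : ℕ → Move S A) (t : ℕ) : S :=
  (run M m ε₁ (firstMoves ω t)).2

/-- The steps in which the strategy executed from then on is not `η`-optimal in the current state. -/
def badSteps [Countable S] [Countable A] (M : MDP S A) (m : ℕ) (ε₁ η : ℝ) (ω : ℕ → Move S A) :
    Set ℕ :=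
  {t | ¬ ((tables M m ε₁ ω t).executed M m ε₁).IsOptimalUpTo η (state M m ε₁ ω t)}

variable [Fintype S] [Fintype A]

/-- The number `ε₁ = ε (p / maxₛ |E(s)|) ^ |S| / (12 |S|)`. -/
noncomputable def eps₁ (M : MDP S A) (p ε : ℝ) : ℝ :=
  ε * (p / M.maxEnabled) ^ Fintype.card S / (12 * Fintype.card S)

/-- The number `ε₂ = ε / 8`. -/
noncomputable def eps₂ (ε : ℝ) : ℝ := ε / 8

/-- The number `m = ⌈ln (6 |S| |A| (1 + |S| |A| / ε₁) / δ) / (2 ε₁²)⌉` of samples that are used for an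
attempted update. -/
noncomputable def samples (M : MDP S A) (p ε δ : ℝ) : ℕ :=
  ⌈Real.log (6 * (Fintype.card S * Fintype.card A) *
      (1 + Fintype.card S * Fintype.card A / eps₁ M p ε) / δ) / (2 * eps₁ M p ε ^ 2)⌉₊

/-- The number `ζ = (2 m + 1) |S| |A| / ε₁`. -/
noncomputable def zeta (M : MDP S A) (p ε δ : ℝ) : ℝ :=
  (2 * samples M p ε δ + 1) * (Fintype.card S * Fintype.card A / eps₁ M p ε)

end DQL

/-! The proof combines a comparison of the two bounds with the executed strategy, a concentration
argument for the batches of samples, and a count of the steps at which the comparison is of no use.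
Optimal values enter through `optLim`, the limit of the step-bounded optimal values, which dominates
the value.

Comparison. Suppose that every upper bound is at least the mean of `optLim` over the successors
(`UpperCorrect`). A nonempty set of non-terminal states closed under greedy actions would contain an
end component, whose states all have value 1; but there every non-greedy action has mean value below
1, by a uniform margin, so step-bounded values could never approach 1 (`eq_empty_of_closed`). Hence
the memoryless greedy chain terminates within |S| steps with probability at least c^|S|
(`survive_card_le`), so that its survival probability after T steps and its expected duration are
under control. A move escapes if a bound of the pair played is inconsistent with its successors by
3ε₁ or if the move changes an estimate. Up to the first escape the executed strategy is the
memoryless greedy one, and telescoping near-consistency along it sandwiches the probability of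
success between U and L, up to survival, 3ε₁ times duration, and the escape probability
(`upper_stateVal_le_reachWithin`, `reachWithin_le_lower_stateVal`). An escape probability of at most
ε₂/2 within T steps thus gives both ε/2-optimality and U - L ≤ ε.

Concentration. The estimates change while a batch is being collected, but monotonically; so the
samples are compared with a test function frozen at the start of the batch (for consistency) or with
the optimal values (for correctness of U). Each success moves an estimate by at least ε₁, which
bounds the number of successes, and amortisation bounds the number of attempts. An exponential
supermartingale then bounds the expected number of batches with a large deviation (`expect_bad_le`).
Without such a batch, U is correct (`correctInv`), and an inconsistent pair is visited at most 2m +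
1 times per unit of progress, up to a final 2m (`GapInv.step_self`). So the total number of escapes
is at most a multiple of ζ (`escapeCount_le`).

Counting. Few escapes imply few steps with a large escape probability. To handle overlapping
horizons without losing a factor, the horizon T is replaced by geometric killing at rate 1/(T + 1).
The resulting probability u satisfies an exact one-step recursion, and for the number N of escapes
the process exp((1 - γ)/4 · Σ u - N) · (1 - u/2) is a supermartingale (`avg_exp_prefixSum_le`).
Hence Σ u is of order T(ζ + ln(1/δ)) with high probability, and every bad step has u > ε₂/6.

For the second claim, simulations almost surely end infinitely often once the upper bounds are
correct and escapes have ceased. So the run is in the initial state at some step after the last one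
with a large u, where U - L ≤ ε; this persists by monotonicity. -/

/-! ### Averages over finite types -/

/-- The expectation of `f` under a distribution on a finite type. -/
noncomputable def PMF.avg {X : Type*} [Fintype X] (p : PMF X) (f : X → ℝ) : ℝ :=
  ∑ x, (p x).toReal * f x

namespace PMF

variable {X Y : Type*} [Fintype X] [Fintype Y]

theorem sum_toReal (p : PMF X) : ∑ x, (p x).toReal = 1 := by
  rw [← ENNReal.toReal_sum fun x _ => p.apply_ne_top x, ← tsum_fintype (L := .unconditional X),
    p.tsum_coe, ENNReal.toReal_one]

theorem avg_const (p : PMF X) (c : ℝ) : p.avg (fun _ => c) = c := by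
  rw [avg, ← Finset.sum_mul, sum_toReal, one_mul]

theorem avg_mono (p : PMF X) {f g : X → ℝ} (h : ∀ x ∈ p.support, f x ≤ g x) :
    p.avg f ≤ p.avg g := by
  refine Finset.sum_le_sum fun x _ => ?_
  by_cases hx : x ∈ p.support
  · exact mul_le_mul_of_nonneg_left (h x hx) ENNReal.toReal_nonneg
  · rw [mem_support_iff, not_not] at hx
    simp [hx]

theorem avg_congr (p : PMF X) {f g : X → ℝ} (h : ∀ x ∈ p.support, f x = g x) :
    p.avg f = p.avg g :=
  le_antisymm (p.avg_mono fun x hx => (h x hx).le) (p.avg_mono fun x hx => (h x hx).ge)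

theorem avg_nonneg (p : PMF X) {f : X → ℝ} (h : ∀ x ∈ p.support, 0 ≤ f x) : 0 ≤ p.avg f := by
  simpa [avg_const] using p.avg_mono (f := fun _ => 0) h

theorem avg_le (p : PMF X) {f : X → ℝ} {c : ℝ} (h : ∀ x ∈ p.support, f x ≤ c) : p.avg f ≤ c := by
  simpa [avg_const] using p.avg_mono (g := fun _ => c) h

theorem le_avg (p : PMF X) {f : X → ℝ} {c : ℝ} (h : ∀ x ∈ p.support, c ≤ f x) : c ≤ p.avg f := by
  simpa [avg_const] using p.avg_mono (f := fun _ => c) h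

theorem avg_add (p : PMF X) (f g : X → ℝ) : p.avg (fun x => f x + g x) = p.avg f + p.avg g := by
  simp only [avg, mul_add, Finset.sum_add_distrib]

theorem avg_sub (p : PMF X) (f g : X → ℝ) : p.avg (fun x => f x - g x) = p.avg f - p.avg g := by
  simp only [avg, mul_sub, Finset.sum_sub_distrib]

theorem avg_neg (p : PMF X) (f : X → ℝ) : p.avg (fun x => -f x) = -p.avg f := by
  simp only [avg, mul_neg, Finset.sum_neg_distrib]

theorem avg_const_mul (p : PMF X) (c : ℝ) (f : X → ℝ) :
    p.avg (fun x => c * f x) = c * p.avg f := by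
  simp only [avg, Finset.mul_sum]
  exact Finset.sum_congr rfl fun x _ => by ring

theorem avg_sum {ι : Type*} (p : PMF X) (s : Finset ι) (f : ι → X → ℝ) :
    p.avg (fun x => ∑ i ∈ s, f i x) = ∑ i ∈ s, p.avg (f i) := by
  simp only [avg, Finset.mul_sum]
  exact Finset.sum_comm

theorem avg_pure (x : X) (f : X → ℝ) : (PMF.pure x).avg f = f x := by
  classical
  rw [avg, Finset.sum_eq_single x]
  · simp
  · intro y _ hy
    simp [hy]
  · simp

theorem avg_bind (p : PMF X) (k : X → PMF Y) (f : Y → ℝ) :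
    (p.bind k).avg f = p.avg fun x => (k x).avg f := by
  simp only [avg, bind_apply, tsum_fintype]
  simp_rw [ENNReal.toReal_sum fun x _ => ENNReal.mul_ne_top (p.apply_ne_top x)
    ((k x).apply_ne_top _), ENNReal.toReal_mul, Finset.sum_mul, Finset.mul_sum]
  rw [Finset.sum_comm]
  exact Finset.sum_congr rfl fun x _ => Finset.sum_congr rfl fun y _ => by ring

theorem avg_map (p : PMF X) (k : X → Y) (f : Y → ℝ) :
    (p.map k).avg f = p.avg fun x => f (k x) := by
  rw [← PMF.bind_pure_comp, avg_bind]
  simp only [Function.comp, avg_pure]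

theorem mul_le_avg (p : PMF X) {f : X → ℝ} (h : ∀ x ∈ p.support, 0 ≤ f x) (x : X) :
    (p x).toReal * f x ≤ p.avg f := by
  refine Finset.single_le_sum (f := fun x => (p x).toReal * f x) (fun y _ => ?_)
    (Finset.mem_univ x)
  by_cases hy : y ∈ p.support
  · exact mul_nonneg ENNReal.toReal_nonneg (h y hy)
  · rw [mem_support_iff, not_not] at hy
    simp [hy]

theorem avg_eq_integral [MeasurableSpace X] [MeasurableSingletonClass X] (p : PMF X) (f : X → ℝ) :
    p.avg f = ∫ x, f x ∂p.toMeasure := by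
  rw [PMF.integral_eq_sum]
  rfl

theorem tendsto_avg (p : PMF X) {f : ℕ → X → ℝ} {g : X → ℝ}
    (h : ∀ x, Filter.Tendsto (fun k => f k x) Filter.atTop (nhds (g x))) :
    Filter.Tendsto (fun k => p.avg (f k)) Filter.atTop (nhds (p.avg g)) :=
  tendsto_finsetSum _ fun x _ => (h x).const_mul _

/-- Hoeffding's lemma for a function whose values lie in an interval of length one. -/
theorem avg_exp_le (p : PMF X) {f : X → ℝ} {a : ℝ} (h : ∀ x, a ≤ f x ∧ f x ≤ a + 1) (l : ℝ) :
    p.avg (fun x => Real.exp (l * (f x - p.avg f))) ≤ Real.exp (l ^ 2 / 8) := by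
  let _ : MeasurableSpace X := ⊤
  have hs := (hasSubgaussianMGF_of_mem_Icc (μ := p.toMeasure) (X := f) (a := a) (b := a + 1)
    (measurable_from_top.aemeasurable) (Filter.Eventually.of_forall h)).mgf_le l
  rw [mgf, ← avg_eq_integral, ← avg_eq_integral] at hs
  refine hs.trans (Real.exp_le_exp.mpr (le_of_eq ?_))
  simp
  ring

end PMF

/-! ### Finite histories of a random sequence -/

section History

variable {X : Type*}

/-- The conditional expectation, given the history `h`, of a function of the history that is
`n` steps longer. -/
noncomputable def expect [Fintype X] (next : List X → PMF X) : ℕ → (List X → ℝ) → List X → ℝ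
  | 0, f, h => f h
  | n + 1, f, h => (next h).avg fun x => expect next n f (h ++ [x])

/-- The histories all of whose entries have a positive probability. -/
inductive Reachable (next : List X → PMF X) : List X → Prop
  | nil : Reachable next []
  | snoc {h : List X} {x : X} : Reachable next h → x ∈ (next h).support → Reachable next (h ++ [x])

/-- The state that is reached from `i` when the entries of a history are processed one after the
other, where the update may depend on the history so far. -/
def histFold {σ : Type*} (F : List X → σ → X → σ) (i : σ) (h : List X) : σ :=
  (h.foldl (fun c x => (c.1 ++ [x], F c.1 c.2 x)) (([] : List X), i)).2

theorem histFold_snoc {σ : Type*} (F : List X → σ → X → σ) (i : σ) (h : List X) (x : X) :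
    histFold F i (h ++ [x]) = F h (histFold F i h) x := by
  have hfst : ∀ (l : List X) (c : List X × σ),
      (l.foldl (fun c x => (c.1 ++ [x], F c.1 c.2 x)) c).1 = c.1 ++ l := by
    intro l
    induction l with
    | nil => simp
    | cons y l ih =>
      intro c
      rw [List.foldl_cons, ih]
      simp
  simp only [histFold, List.foldl_append, List.foldl_cons, List.foldl_nil]
  rw [hfst]
  rfl

theorem firstMoves_zero (ω : ℕ → X) : firstMoves ω 0 = [] := rfl

theorem firstMoves_succ (ω : ℕ → X) (n : ℕ) : firstMoves ω (n + 1) = firstMoves ω n ++ [ω n] := by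
  rw [firstMoves, List.ofFn_succ']
  simp [firstMoves]

variable [Fintype X]

section expect

variable (next : List X → PMF X)

theorem expect_mono {f g : List X → ℝ} (hfg : ∀ h, f h ≤ g h) (n : ℕ) (h : List X) :
    expect next n f h ≤ expect next n g h := by
  induction n generalizing h with
  | zero => exact hfg h
  | succ n ih => exact PMF.avg_mono _ fun x _ => ih _

theorem expect_mono_of_reachable {f g : List X → ℝ} (hfg : ∀ h, Reachable next h → f h ≤ g h)
    (n : ℕ) {h : List X} (hh : Reachable next h) : expect next n f h ≤ expect next n g h := by
  induction n generalizing h with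
  | zero => exact hfg h hh
  | succ n ih => exact PMF.avg_mono _ fun x hx => ih (hh.snoc hx)

theorem expect_const (c : ℝ) (n : ℕ) (h : List X) : expect next n (fun _ => c) h = c := by
  induction n generalizing h with
  | zero => rfl
  | succ n ih => simp only [expect, ih, PMF.avg_const]

theorem expect_sub (f g : List X → ℝ) (n : ℕ) (h : List X) :
    expect next n (fun h => f h - g h) h = expect next n f h - expect next n g h := by
  induction n generalizing h with
  | zero => rfl
  | succ n ih => simp only [expect, ih, PMF.avg_sub]

theorem expect_const_mul (c : ℝ) (f : List X → ℝ) (n : ℕ) (h : List X) :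
    expect next n (fun h => c * f h) h = c * expect next n f h := by
  induction n generalizing h with
  | zero => rfl
  | succ n ih => simp only [expect, ih, PMF.avg_const_mul]

/-- The expectation of a supermartingale does not increase. -/
theorem expect_le_of_supermartingale {F : List X → ℝ}
    (hF : ∀ h, (next h).avg (fun x => F (h ++ [x])) ≤ F h) (n : ℕ) (h : List X) :
    expect next n F h ≤ F h := by
  induction n generalizing h with
  | zero => exact le_rfl
  | succ n ih => exact (PMF.avg_mono _ fun x _ => ih _).trans (hF h)

end expect

section law

variable [MeasurableSpace X] [DiscreteMeasurableSpace X] (next : List X → PMF X)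

instance : IsProbabilityMeasure (processLaw next) := by
  unfold processLaw
  infer_instance

theorem measurable_firstMoves_comp {β : Type*} [MeasurableSpace β] (f : List X → β) (n : ℕ) :
    Measurable fun ω : ℕ → X => f (firstMoves ω n) := by
  have : (fun ω : ℕ → X => f (firstMoves ω n))
      = (fun g : Fin n → X => f (List.ofFn g)) ∘ fun ω i => ω i := rfl
  rw [this]
  exact (measurable_of_finite _).comp (measurable_pi_lambda _ fun i => measurable_pi_apply _)

theorem measurableSet_firstMoves (P : List X → Prop) (n : ℕ) :
    MeasurableSet {ω : ℕ → X | P (firstMoves ω n)} :=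
  measurable_firstMoves_comp P n (MeasurableSet.of_discrete (s := {p : Prop | p}))

theorem map_eval_zero_processLaw :
    (processLaw next).map (fun ω => ω 0) = (next []).toMeasure := by
  have h₁ : (fun ω : ℕ → X => ω 0)
      = (fun z : ∀ _ : Finset.Iic 0, X => z ⟨0, by simp⟩) ∘ Preorder.frestrictLe 0 := rfl
  unfold processLaw Kernel.trajMeasure
  rw [h₁, ← Measure.map_map (by fun_prop) (by fun_prop), Measure.map_comp _ _ (by fun_prop),
    Kernel.traj_map_frestrictLe, Kernel.partialTraj_self, Measure.id_comp,
    Measure.map_map (by fun_prop) (by fun_prop)]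
  exact Measure.map_id

/-- Disintegration of the trajectory measure over its first entries. The kernels only describe
entries that have a predecessor, so the first entry is treated apart through the initial
distribution. -/
theorem integral_firstMoves_succ (f : List X → ℝ) (n : ℕ) :
    ∫ ω, f (firstMoves ω (n + 1)) ∂processLaw next
      = ∫ ω, (next (firstMoves ω n)).avg (fun x => f (firstMoves ω n ++ [x]))
          ∂processLaw next := by
  cases n with
  | zero =>
    simp only [firstMoves_succ, firstMoves_zero, List.nil_append, integral_const, probReal_univ,
      one_smul]
    have h := map_eval_zero_processLaw next
    rw [← integral_map (φ := fun ω : ℕ → X => ω 0) (f := fun x => f [x])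
      (measurable_pi_apply 0).aemeasurable (Measurable.of_discrete).aestronglyMeasurable, h,
      PMF.avg_eq_integral]
  | succ n =>
    have hκ := Kernel.map_frestrictLe_trajMeasure_compProd_eq_map_trajMeasure
      (X := fun _ => X) (μ₀ := (next []).toMeasure) (κ := moveKernel next) (a := n)
    let toList : (∀ _ : Finset.Iic n, X) → List X := fun h => List.ofFn fun i : Fin (n + 1) =>
      h ⟨i, Finset.mem_Iic.mpr (Nat.lt_succ_iff.mp i.2)⟩
    have e : ∀ ω : ℕ → X, firstMoves ω (n + 1) = toList (Preorder.frestrictLe n ω) :=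
      fun ω => rfl
    have h₁ : ∫ ω, f (firstMoves ω (n + 1 + 1)) ∂processLaw next
        = ∫ z, f (toList z.1 ++ [z.2]) ∂(processLaw next).map
          (fun ω => (Preorder.frestrictLe n ω, ω (n + 1))) := by
      rw [integral_map (by fun_prop) (Measurable.of_discrete).aestronglyMeasurable]
      simp only [firstMoves_succ _ (n + 1), e]
    have h₂ : ∫ ω, (next (firstMoves ω (n + 1))).avg (fun x => f (firstMoves ω (n + 1) ++ [x]))
          ∂processLaw next
        = ∫ z, (next (toList z)).avg (fun x => f (toList z ++ [x])) ∂(processLaw next).map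
          (Preorder.frestrictLe n) := by
      rw [integral_map (by fun_prop) (Measurable.of_discrete).aestronglyMeasurable]
      simp only [e]
    rw [h₁, h₂]
    unfold processLaw
    rw [← hκ, Measure.integral_compProd .of_finite]
    refine integral_congr_ae (Filter.Eventually.of_forall fun z => ?_)
    exact (PMF.avg_eq_integral _ _).symm

theorem integral_firstMoves_add (f : List X → ℝ) (n k : ℕ) :
    ∫ ω, f (firstMoves ω (n + k)) ∂processLaw next
      = ∫ ω, expect next k f (firstMoves ω n) ∂processLaw next := by
  induction k generalizing n with
  | zero => rfl
  | succ k ih =>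
    rw [show n + (k + 1) = n + 1 + k by ring, ih, integral_firstMoves_succ]
    rfl

theorem integral_firstMoves (f : List X → ℝ) (n : ℕ) :
    ∫ ω, f (firstMoves ω n) ∂processLaw next = expect next n f [] := by
  have := integral_firstMoves_add next f 0 n
  rw [zero_add] at this
  rw [this]
  simp [firstMoves_zero]

open scoped Classical in
theorem real_firstMoves (P : List X → Prop) (n : ℕ) :
    (processLaw next).real {ω | P (firstMoves ω n)}
      = expect next n (fun h => if P h then 1 else 0) [] := by
  rw [← integral_firstMoves, ← integral_indicator_one (measurableSet_firstMoves P n)]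
  rfl

/-- Allows pathwise bounds to assume that only enabled actions have been played. -/
theorem ae_reachable : ∀ᵐ ω ∂processLaw next, ∀ n, Reachable next (firstMoves ω n) := by
  classical
  rw [ae_all_iff]
  intro n
  have h : (processLaw next).real {ω | ¬ Reachable next (firstMoves ω n)} = 0 := by
    rw [real_firstMoves next fun h => ¬ Reachable next h]
    refine le_antisymm ?_ ?_
    · exact (expect_mono_of_reachable next (g := fun _ => 0) (fun h hh => by simp [hh]) n
        .nil).trans_eq (expect_const next 0 n [])
    · exact (expect_const next 0 n []).ge.trans
        (expect_mono next (fun h => by split_ifs <;> norm_num) n [])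
  rw [measureReal_eq_zero_iff] at h
  exact h

end law

end History

/-! ### Bounds for reachability probabilities -/

noncomputable instance Move.instFintype (S A : Type*) [Fintype S] [Fintype A] :
    Fintype (Move S A) :=
  Fintype.ofEquiv (A × S) ⟨fun x => ⟨x.1, x.2⟩, fun x => (x.act, x.dest), fun _ => rfl,
    fun _ => rfl⟩

namespace MDP

variable {S A : Type*} (M : MDP S A)

/-- The distribution of the move that is made in state `s` if the action is drawn from `q`. -/
noncomputable def stepLaw (s : S) (q : PMF A) : PMF (Move S A) :=
  q.bind fun a => (M.trans s a).map fun s' => ⟨a, s'⟩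

theorem avg_stepLaw [Fintype S] [Fintype A] (s : S) (q : PMF A) (f : Move S A → ℝ) :
    (M.stepLaw s q).avg f = q.avg fun a => (M.trans s a).avg fun s' => f ⟨a, s'⟩ := by
  simp only [stepLaw, PMF.avg_bind, PMF.avg_map]

theorem lastState_snoc (s : S) (h : List (Move S A)) (x : Move S A) :
    lastState s (h ++ [x]) = x.dest := by
  simp [lastState]

/-- The finite path from `s` with moves `h` visits the target. -/
def Visits (s : S) (h : List (Move S A)) : Prop :=
  s = M.target ∨ ∃ x ∈ h, x.dest = M.target

theorem visits_snoc (s : S) (h : List (Move S A)) (x : Move S A) :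
    M.Visits s (h ++ [x]) ↔ M.Visits s h ∨ x.dest = M.target := by
  simp only [Visits, List.mem_append, List.mem_singleton, or_and_right, exists_or, exists_eq_left,
    or_assoc]

theorem visits_of_lastState {s : S} {h : List (Move S A)} (hs : lastState s h = M.target) :
    M.Visits s h := by
  rcases List.eq_nil_or_concat h with rfl | ⟨l, x, rfl⟩
  · exact Or.inl hs
  · rw [List.concat_eq_append, lastState_snoc] at hs
    rw [List.concat_eq_append]
    exact (M.visits_snoc s l x).mpr (Or.inr hs)

theorem visits_firstMoves {s : S} {ω : ℕ → Move S A} {n : ℕ} :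
    M.Visits s (firstMoves ω n) ↔ s = M.target ∨ ∃ i < n, (ω i).dest = M.target := by
  simp only [Visits, firstMoves, List.mem_ofFn, exists_exists_eq_and]
  exact or_congr_right ⟨fun ⟨i, hi⟩ => ⟨i, i.2, hi⟩, fun ⟨i, hi, h⟩ => ⟨⟨i, hi⟩, h⟩⟩

variable [Fintype S]

open scoped Classical in
/-- The maximal probability to reach the target within a given number of steps. -/
noncomputable def optVal : ℕ → S → ℝ
  | 0, s => if s = M.target then 1 else 0
  | k + 1, s => if s = M.target then 1 else
      (M.enabled s).sup' (M.enabled_nonempty s) fun a => (M.trans s a).avg (optVal k)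

/-- The limit of the maximal probabilities to reach the target within `k` steps. -/
noncomputable def optLim (s : S) : ℝ := ⨆ k, M.optVal k s

theorem optVal_target (k : ℕ) : M.optVal k M.target = 1 := by
  cases k <;> simp [optVal]

theorem optVal_mem (k : ℕ) (s : S) : 0 ≤ M.optVal k s ∧ M.optVal k s ≤ 1 := by
  induction k generalizing s with
  | zero => unfold optVal; split_ifs <;> norm_num
  | succ k ih =>
    unfold optVal
    split_ifs
    · norm_num
    · obtain ⟨a, ha⟩ := M.enabled_nonempty s
      exact ⟨(PMF.avg_nonneg _ fun x _ => (ih x).1).trans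
        (Finset.le_sup' (fun a => (M.trans s a).avg (M.optVal k)) ha),
        Finset.sup'_le _ _ fun a _ => PMF.avg_le _ fun x _ => (ih x).2⟩

theorem optVal_le_succ (k : ℕ) (s : S) : M.optVal k s ≤ M.optVal (k + 1) s := by
  induction k generalizing s with
  | zero =>
    by_cases hs : s = M.target
    · subst hs
      rw [optVal_target, optVal_target]
    · rw [optVal, if_neg hs]
      exact (M.optVal_mem 1 s).1
  | succ k ih =>
    rw [optVal, optVal]
    split_ifs
    · exact le_rfl
    · exact Finset.sup'_mono_fun fun a _ => PMF.avg_mono _ fun x _ => ih x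

theorem bddAbove_optVal (s : S) : BddAbove (Set.range fun k => M.optVal k s) :=
  ⟨1, by rintro _ ⟨k, rfl⟩; exact (M.optVal_mem k s).2⟩

theorem optVal_le_optLim (k : ℕ) (s : S) : M.optVal k s ≤ M.optLim s :=
  le_ciSup (M.bddAbove_optVal s) k

theorem optLim_nonneg (s : S) : 0 ≤ M.optLim s :=
  (M.optVal_mem 0 s).1.trans (M.optVal_le_optLim 0 s)

theorem optLim_le_one (s : S) : M.optLim s ≤ 1 :=
  ciSup_le fun k => (M.optVal_mem k s).2

theorem optLim_target : M.optLim M.target = 1 := by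
  simp [optLim, optVal_target]

/-- Half of the Bellman equation, obtained by passing to the limit inside the averages. The target
has no recursion in `optVal`, but it is terminal. -/
theorem optLim_le_sup' (s : S) :
    M.optLim s ≤ (M.enabled s).sup' (M.enabled_nonempty s) fun a => (M.trans s a).avg M.optLim := by
  by_cases hs : s = M.target
  · subst hs
    obtain ⟨a, ha⟩ := M.enabled_nonempty M.target
    refine le_trans ?_ (Finset.le_sup' (fun a => (M.trans M.target a).avg M.optLim) ha)
    have := PMF.mul_le_avg (M.trans M.target a) (f := M.optLim) (fun x _ => M.optLim_nonneg x)
      M.target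
    rwa [M.target_terminal a ha, ENNReal.toReal_one, one_mul] at this
  · refine ciSup_le fun k => (M.optVal_le_succ k s).trans ?_
    rw [optVal, if_neg hs]
    exact Finset.sup'_mono_fun fun a _ => PMF.avg_mono _ fun x _ => M.optVal_le_optLim k x

theorem avg_trans_sink {a : A} (ha : a ∈ M.enabled M.sink) (f : S → ℝ) :
    (M.trans M.sink a).avg f = f M.sink := by
  rw [PMF.avg_congr (g := fun _ => f M.sink), PMF.avg_const]
  intro x hx
  rw [(PMF.apply_eq_one_iff _ _).mp (M.sink_terminal a ha)] at hx
  rw [Set.mem_singleton_iff.mp hx]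

theorem optLim_sink : M.optLim M.sink = 0 := by
  have h : ∀ k, M.optVal k M.sink = 0 := by
    intro k
    induction k with
    | zero => rw [optVal, if_neg M.sink_ne_target]
    | succ k ih =>
      rw [optVal, if_neg M.sink_ne_target]
      refine (Finset.sup'_congr _ rfl fun a ha => ?_).trans (Finset.sup'_const _ 0)
      rw [M.avg_trans_sink ha, ih]
  simp [optLim, h]

variable [Fintype A]

namespace Strategy

variable {M} (σ : M.Strategy)

/-- The conditional distribution of the next move under a strategy. -/
noncomputable def next (s : S) (h : List (Move S A)) : PMF (Move S A) :=
  M.stepLaw (lastState s h) (σ.choice s h)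

theorem pathLaw_eq (s : S) : σ.pathLaw s = processLaw (σ.next s) := rfl

open scoped Classical in
theorem tendsto_reachProb (s : S) :
    Filter.Tendsto (fun n => expect (σ.next s) n (fun h => if M.Visits s h then 1 else 0) [])
      Filter.atTop (nhds (σ.reachProb s)) := by
  have hU : M.reachTarget s = ⋃ n, {ω | M.Visits s (firstMoves ω n)} := by
    ext ω
    simp only [reachTarget, Set.mem_ofPred_eq, Set.mem_iUnion, visits_firstMoves]
    constructor
    · rintro (h | ⟨n, hn⟩)
      · exact ⟨0, Or.inl h⟩
      · exact ⟨n + 1, Or.inr ⟨n, n.lt_succ_self, hn⟩⟩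
    · rintro ⟨n, h | ⟨i, -, hi⟩⟩
      · exact Or.inl h
      · exact Or.inr ⟨i, hi⟩
  have hm : Monotone fun n => {ω : ℕ → Move S A | M.Visits s (firstMoves ω n)} := by
    intro n k hnk ω h
    simp only [Set.mem_ofPred_eq, visits_firstMoves] at h ⊢
    exact h.imp_right fun ⟨i, hi, h⟩ => ⟨i, hi.trans_le hnk, h⟩
  simp_rw [← real_firstMoves]
  rw [reachProb, hU, pathLaw_eq]
  exact (ENNReal.tendsto_toReal (measure_ne_top _ _)).comp (tendsto_measure_iUnion_atTop hm)

-- Dynamic programming: whatever the history, the remaining moves do no better than the best choice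
-- of the next action followed by `optVal`.
open scoped Classical in
theorem expect_visits_le (s : S) (n : ℕ) (h : List (Move S A)) :
    expect (σ.next s) n (fun h => if M.Visits s h then 1 else 0) h
      ≤ if M.Visits s h then 1 else M.optVal n (lastState s h) := by
  induction n generalizing h with
  | zero =>
    rw [expect]
    split_ifs
    · exact le_rfl
    · exact (M.optVal_mem 0 _).1
  | succ n ih =>
    split_ifs with hv
    · refine PMF.avg_le _ fun x _ => (ih _).trans ?_
      rw [if_pos ((M.visits_snoc s h x).mpr (Or.inl hv))]
    · rw [expect, next, avg_stepLaw, optVal,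
        if_neg (fun hl => hv (M.visits_of_lastState hl))]
      refine PMF.avg_le _ fun a ha => le_trans (PMF.avg_mono _ fun s' _ => ?_)
        (Finset.le_sup' (fun a => (M.trans (lastState s h) a).avg (M.optVal n))
          (σ.choice_enabled s h a ha))
      refine (ih _).trans ?_
      rw [lastState_snoc]
      split_ifs with hx
      · rw [M.visits_snoc] at hx
        rw [show s' = M.target from hx.resolve_left hv, M.optVal_target]
      · exact le_rfl

theorem reachProb_le_optLim (s : S) : σ.reachProb s ≤ M.optLim s := by
  classical
  refine le_of_tendsto' (σ.tendsto_reachProb s) fun n => (σ.expect_visits_le s n []).trans ?_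
  split_ifs with h
  · have : s = M.target := by simpa [Visits] using h
    rw [this, M.optLim_target]
  · exact M.optVal_le_optLim n s

theorem reachProb_nonneg (s : S) : 0 ≤ σ.reachProb s := measureReal_nonneg

end Strategy

/-- Only this inequality is needed: optimality is tested against the larger quantity `optLim`, and a
state of value 1 has `optLim` equal to 1. -/
theorem value_le_optLim (s : S) : M.value s ≤ M.optLim s :=
  Real.iSup_le (fun σ => σ.reachProb_le_optLim s) (M.optLim_nonneg s)

end MDP

namespace Tables

variable {S A : Type*} (M : MDP S A) (m : ℕ) (ε₁ : ℝ)

theorem observePath_snoc (c : Tables S A) (s : S) (h : List (Move S A)) (x : Move S A) :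
    c.observePath M m ε₁ s (h ++ [x])
      = (c.observePath M m ε₁ s h).observe M m ε₁ (MDP.lastState s h) x.act x.dest := by
  induction h generalizing c s with
  | nil => rfl
  | cons y h ih =>
    rw [List.cons_append, observePath, ih, observePath]
    congr 1
    cases h with
    | nil => rfl
    | cons z h => simp [MDP.lastState, List.getLast?_cons]

variable [Fintype S] [Fintype A]

open scoped Classical in
/-- The probability that the strategy executed from the variables `c` on reaches the target from `s`
within `k` steps. -/
noncomputable def reachWithin : ℕ → Tables S A → S → ℝ
  | 0, _, s => if s = M.target then 1 else 0
  | k + 1, c, s => if s = M.target then 1 else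
      (c.greedy M s).avg fun a => (M.trans s a).avg fun s' =>
        reachWithin k (c.observe M m ε₁ s a s') s'

theorem reachWithin_mem (k : ℕ) (c : Tables S A) (s : S) :
    0 ≤ reachWithin M m ε₁ k c s ∧ reachWithin M m ε₁ k c s ≤ 1 := by
  induction k generalizing c s with
  | zero => unfold reachWithin; split_ifs <;> norm_num
  | succ k ih =>
    unfold reachWithin
    split_ifs
    · norm_num
    · exact ⟨PMF.avg_nonneg _ fun _ _ => PMF.avg_nonneg _ fun _ _ => (ih _ _).1,
        PMF.avg_le _ fun _ _ => PMF.avg_le _ fun _ _ => (ih _ _).2⟩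

theorem reachWithin_target (k : ℕ) (c : Tables S A) : reachWithin M m ε₁ k c M.target = 1 := by
  cases k <;> simp [reachWithin]

theorem reachWithin_le_succ (k : ℕ) (c : Tables S A) (s : S) :
    reachWithin M m ε₁ k c s ≤ reachWithin M m ε₁ (k + 1) c s := by
  induction k generalizing c s with
  | zero =>
    by_cases hs : s = M.target
    · subst hs
      rw [reachWithin_target, reachWithin_target]
    · rw [reachWithin, if_neg hs]
      exact (reachWithin_mem M m ε₁ 1 c s).1
  | succ k ih =>
    rw [reachWithin, reachWithin]
    split_ifs
    · exact le_rfl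
    · exact PMF.avg_mono _ fun _ _ => PMF.avg_mono _ fun _ _ => ih _ _

open scoped Classical in
theorem le_expect_visits (c : Tables S A) (s : S) (n : ℕ) (h : List (Move S A)) :
    (if M.Visits s h then 1 else
        reachWithin M m ε₁ n (c.observePath M m ε₁ s h) (MDP.lastState s h))
      ≤ expect ((c.executed M m ε₁).next s) n (fun h => if M.Visits s h then 1 else 0) h := by
  induction n generalizing h with
  | zero =>
    rw [expect]
    split_ifs with hv
    · exact le_rfl
    · rw [reachWithin, if_neg fun hl => hv (M.visits_of_lastState hl)]
  | succ n ih =>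
    split_ifs with hv
    · refine PMF.le_avg _ fun x _ => le_trans ?_ (ih _)
      rw [if_pos ((M.visits_snoc s h x).mpr (Or.inl hv))]
    · rw [expect, MDP.Strategy.next, MDP.avg_stepLaw, reachWithin,
        if_neg (fun hl => hv (M.visits_of_lastState hl))]
      refine PMF.avg_mono _ fun a _ => PMF.avg_mono _ fun s' _ => ?_
      refine le_trans ?_ (ih _)
      split_ifs
      · exact (reachWithin_mem M m ε₁ _ _ _).2
      · rw [MDP.lastState_snoc, observePath_snoc]

theorem reachWithin_le_reachProb (c : Tables S A) (s : S) (n : ℕ) :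
    reachWithin M m ε₁ n c s ≤ (c.executed M m ε₁).reachProb s := by
  classical
  have h : ∀ k ≥ n, reachWithin M m ε₁ n c s ≤ expect ((c.executed M m ε₁).next s) k
      (fun h => if M.Visits s h then 1 else 0) [] := by
    intro k hk
    refine le_trans ?_ (le_expect_visits M m ε₁ c s k [])
    split_ifs
    · exact (reachWithin_mem M m ε₁ n c s).2
    · exact monotone_nat_of_le_succ (fun k => reachWithin_le_succ M m ε₁ k c s) hk
  exact ge_of_tendsto ((c.executed M m ε₁).tendsto_reachProb s)
    (Filter.eventually_atTop.mpr ⟨n, h⟩)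

end Tables

/-! ### The memoryless greedy strategy -/

namespace MDP

variable {S A : Type*} (M : MDP S A)

/-- The sink and the target. -/
def Terminal (s : S) : Prop := s = M.sink ∨ s = M.target

theorem IsMinProb.le_one {M : MDP S A} {p : ℝ} (hp : M.IsMinProb p) : p ≤ 1 := by
  obtain ⟨a, ha⟩ := M.enabled_nonempty M.init
  obtain ⟨x, hx⟩ := (M.trans M.init a).support_nonempty
  exact (hp.2 _ a ha x hx).trans
    (ENNReal.toReal_le_of_le_ofReal zero_le_one (by simpa using PMF.coe_le_one _ x))

variable [Fintype S]

theorem card_enabled_le (s : S) : (M.enabled s).card ≤ M.maxEnabled :=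
  Finset.le_sup (f := fun s => (M.enabled s).card) (Finset.mem_univ s)

theorem maxEnabled_pos : 0 < M.maxEnabled :=
  (M.enabled_nonempty M.init).card_pos.trans_le (M.card_enabled_le _)

theorem IsMinProb.div_maxEnabled_mem {M : MDP S A} {p : ℝ} (hp : M.IsMinProb p) :
    0 < p / M.maxEnabled ∧ p / M.maxEnabled ≤ 1 := by
  have h : (1 : ℝ) ≤ M.maxEnabled := by exact_mod_cast M.maxEnabled_pos
  exact ⟨div_pos hp.1 (by linarith), (div_le_one (by linarith)).mpr (hp.le_one.trans h)⟩

end MDP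

namespace Tables

variable {S A : Type*} {M : MDP S A}

theorem mem_greedyActions {c : Tables S A} {s : S} {a : A} :
    a ∈ c.greedyActions M s ↔ a ∈ M.enabled s ∧ c.upper.val (s, a) = c.upper.stateVal M s := by
  simp [greedyActions]

theorem mem_support_greedy {c : Tables S A} {s : S} {a : A} :
    a ∈ (c.greedy M s).support ↔ a ∈ c.greedyActions M s :=
  PMF.mem_support_uniformOfFinset_iff _ _

theorem greedy_congr {c c' : Tables S A} (h : c.upper.val = c'.upper.val) (s : S) :
    c.greedy M s = c'.greedy M s := by
  have : c.greedyActions M s = c'.greedyActions M s := by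
    ext a
    simp only [mem_greedyActions, Estimator.stateVal, h]
  simp only [greedy, this]

theorem avg_greedy_val [Fintype A] (c : Tables S A) (s : S) :
    (c.greedy M s).avg (fun a => c.upper.val (s, a)) = c.upper.stateVal M s := by
  rw [PMF.avg_congr (g := fun _ => c.upper.stateVal M s), PMF.avg_const]
  exact fun a ha => (mem_greedyActions.mp (mem_support_greedy.mp ha)).2

variable [Fintype S] [Fintype A]

variable (M) in
/-- One step of the Markov chain that is induced by playing greedily for fixed variables. -/
noncomputable def frozenStep (c : Tables S A) (f : S → ℝ) (s : S) : ℝ :=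
  (c.greedy M s).avg fun a => (M.trans s a).avg f

theorem frozenStep_mono (c : Tables S A) {f g : S → ℝ} (h : ∀ s, f s ≤ g s) (s : S) :
    frozenStep M c f s ≤ frozenStep M c g s :=
  PMF.avg_mono _ fun _ _ => PMF.avg_mono _ fun x _ => h x

theorem frozenStep_const (c : Tables S A) (r : ℝ) (s : S) :
    frozenStep M c (fun _ => r) s = r := by
  simp only [frozenStep, PMF.avg_const]

theorem frozenStep_const_mul (c : Tables S A) (r : ℝ) (f : S → ℝ) (s : S) :
    frozenStep M c (fun s => r * f s) s = r * frozenStep M c f s := by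
  simp only [frozenStep, PMF.avg_const_mul]

/-- A given greedy action is chosen with probability at least one over `maxEnabled`, and a given
successor of it then has probability at least `p`. The deficit `1 - f` at that successor is
inherited with the product of these factors. -/
theorem frozenStep_le {p : ℝ} (hp : M.IsMinProb p) (c : Tables S A) {f : S → ℝ}
    (hf : ∀ s, f s ≤ 1) {s s' : S} {a : A} (ha : a ∈ c.greedyActions M s)
    (hs' : M.trans s a s' ≠ 0) :
    frozenStep M c f s ≤ 1 - p / M.maxEnabled * (1 - f s') := by
  have h₁ : frozenStep M c (fun s => 1 - f s) s = 1 - frozenStep M c f s := by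
    simp only [frozenStep, PMF.avg_sub, PMF.avg_const]
  have h₂ : p * (1 - f s') ≤ (M.trans s a).avg fun s => 1 - f s :=
    (mul_le_mul_of_nonneg_right (hp.2 s a (mem_greedyActions.mp ha).1 s' hs')
      (sub_nonneg.mpr (hf s'))).trans
      (PMF.mul_le_avg _ (f := fun s => 1 - f s) (fun x _ => sub_nonneg.mpr (hf x)) s')
  have h₃ : (c.greedy M s a).toReal * (M.trans s a).avg (fun s => 1 - f s)
      ≤ frozenStep M c (fun s => 1 - f s) s :=
    PMF.mul_le_avg _ (f := fun a => (M.trans s a).avg fun s => 1 - f s)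
      (fun a _ => PMF.avg_nonneg _ fun x _ => sub_nonneg.mpr (hf x)) a
  have hc : 0 < (c.greedyActions M s).card := (c.greedyActions_nonempty M s).card_pos
  have h₄ : (1 : ℝ) / M.maxEnabled ≤ (c.greedy M s a).toReal := by
    rw [greedy, PMF.uniformOfFinset_apply_of_mem _ ha, ENNReal.toReal_inv, ENNReal.toReal_natCast,
      ← one_div]
    refine one_div_le_one_div_of_le (by exact_mod_cast hc) ?_
    exact_mod_cast (Finset.card_le_card fun a ha => (mem_greedyActions.mp ha).1).trans
      (M.card_enabled_le s)
  have h₅ := mul_le_mul h₄ h₂ (mul_nonneg hp.1.le (sub_nonneg.mpr (hf s'))) ENNReal.toReal_nonneg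
  have h₆ : p / M.maxEnabled * (1 - f s') = 1 / M.maxEnabled * (p * (1 - f s')) := by ring
  linarith

variable (M) in
open scoped Classical in
/-- The probability that the memoryless greedy strategy does not reach a terminal state within
`k` steps. -/
noncomputable def survive (c : Tables S A) : ℕ → S → ℝ
  | 0, s => if M.Terminal s then 0 else 1
  | k + 1, s => if M.Terminal s then 0 else frozenStep M c (survive c k) s

theorem survive_terminal (c : Tables S A) (k : ℕ) {s : S} (hs : M.Terminal s) :
    survive M c k s = 0 := by
  cases k <;> simp [survive, hs]

theorem survive_mem (c : Tables S A) (k : ℕ) (s : S) :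
    0 ≤ survive M c k s ∧ survive M c k s ≤ 1 := by
  induction k generalizing s with
  | zero => unfold survive; split_ifs <;> norm_num
  | succ k ih =>
    unfold survive
    split_ifs
    · norm_num
    · exact ⟨(frozenStep_const c 0 s).ge.trans (frozenStep_mono c (fun s => (ih s).1) s),
        (frozenStep_mono c (fun s => (ih s).2) s).trans (frozenStep_const c 1 s).le⟩

theorem survive_congr {c c' : Tables S A} (h : c.upper.val = c'.upper.val) (k : ℕ) (s : S) :
    survive M c k s = survive M c' k s := by
  induction k generalizing s with
  | zero => rfl
  | succ k ih =>
    have : survive M c k = survive M c' k := funext ih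
    simp only [survive, frozenStep, greedy_congr h, this]

theorem survive_succ_le (c : Tables S A) (k : ℕ) (s : S) :
    survive M c (k + 1) s ≤ survive M c k s := by
  induction k generalizing s with
  | zero =>
    by_cases hs : M.Terminal s
    · rw [survive_terminal c _ hs, survive_terminal c _ hs]
    · rw [survive.eq_1, if_neg hs]
      exact (survive_mem c 1 s).2
  | succ k ih =>
    rw [survive, survive]
    split_ifs
    · exact le_rfl
    · exact frozenStep_mono c ih s

theorem survive_antitone (c : Tables S A) (s : S) : Antitone fun k => survive M c k s :=
  antitone_nat_of_succ_le fun k => survive_succ_le c k s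

/-- The Markov property after `k` steps, combined with a bound that is uniform in the state. -/
theorem survive_add_le (c : Tables S A) {N : ℕ} {θ : ℝ} (h : ∀ s, survive M c N s ≤ θ)
    (k : ℕ) (s : S) : survive M c (k + N) s ≤ θ * survive M c k s := by
  induction k generalizing s with
  | zero =>
    by_cases hs : M.Terminal s
    · rw [survive_terminal c _ hs, survive_terminal c _ hs, mul_zero]
    · rw [zero_add, survive.eq_1, if_neg hs, mul_one]
      exact h s
  | succ k ih =>
    rw [Nat.add_right_comm, survive, survive]
    split_ifs
    · simp
    · rw [← frozenStep_const_mul]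
      exact frozenStep_mono c ih s

theorem survive_mul_le (c : Tables S A) {N : ℕ} {θ : ℝ} (hθ : 0 ≤ θ)
    (h : ∀ s, survive M c N s ≤ θ) (j : ℕ) (s : S) : survive M c (j * N) s ≤ θ ^ j := by
  induction j with
  | zero => simpa using (survive_mem c 0 s).2
  | succ j ih =>
    rw [Nat.succ_mul, pow_succ']
    exact (survive_add_le c h _ s).trans (mul_le_mul_of_nonneg_left ih hθ)

/-- Renewal: the first `N` terms contribute at most `N`, and the remaining ones at most `1 - q`
times a shorter sum of the same kind. The fixed point of `x = N + (1 - q) x` is `N / q`. -/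
theorem sum_survive_le (c : Tables S A) {N : ℕ} (hN : 0 < N) {q : ℝ} (hq : 0 < q) (hq1 : q ≤ 1)
    (h : ∀ s, survive M c N s ≤ 1 - q) (k : ℕ) (s : S) :
    ∑ j ∈ Finset.range k, survive M c j s ≤ N / q := by
  have hsum : ∀ k, ∑ j ∈ Finset.range k, survive M c j s ≤ k := fun k =>
    (Finset.sum_le_sum fun j _ => (survive_mem c j s).2).trans (by simp)
  induction k using Nat.strong_induction_on with
  | _ k ih =>
    rcases le_total k N with hk | hk
    · have h1 : (k : ℝ) ≤ N := by exact_mod_cast hk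
      exact (hsum k).trans (h1.trans (le_div_self (by positivity) hq hq1))
    · obtain ⟨l, rfl⟩ := Nat.exists_eq_add_of_le hk
      have h1 : ∑ j ∈ Finset.range l, survive M c (N + j) s
          ≤ (1 - q) * ∑ j ∈ Finset.range l, survive M c j s := by
        rw [Finset.mul_sum]
        exact Finset.sum_le_sum fun j _ => by
          rw [add_comm]; exact survive_add_le c h j s
      have h2 := mul_le_mul_of_nonneg_left (ih l (by omega)) (sub_nonneg.mpr hq1)
      have h3 : (N : ℝ) + (1 - q) * (N / q) = N / q := by field_simp; ring
      rw [Finset.sum_range_add]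
      linarith [hsum N]

/-- The summand `q` in the exponent is the price of rounding `k / N` down to complete blocks of
length `N`. -/
theorem survive_le_exp (c : Tables S A) {N : ℕ} (hN : 0 < N) {q : ℝ} (hq : 0 < q)
    (hq1 : q ≤ 1) (h : ∀ s, survive M c N s ≤ 1 - q) (k : ℕ) (s : S) :
    survive M c k s ≤ Real.exp (q - q * (k / N)) := by
  have h0 := survive_mul_le c (sub_nonneg.mpr hq1) h (k / N) s
  refine (survive_antitone c s (Nat.div_mul_le_self k N)).trans (h0.trans ?_)
  have h1 : 1 - q ≤ Real.exp (-q) := by linarith [Real.add_one_le_exp (-q)]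
  refine (pow_le_pow_left₀ (sub_nonneg.mpr hq1) h1 _).trans ?_
  rw [← Real.exp_nat_mul, Real.exp_le_exp]
  have h2 : (k : ℝ) / N < (k / N : ℕ) + 1 := by
    rw [div_lt_iff₀ (by exact_mod_cast hN)]
    exact_mod_cast Nat.lt_mul_of_div_lt (Nat.lt_succ_self (k / N)) hN
  nlinarith

/-! ### Reaching a terminal state -/

variable (M) in
/-- The states from which greedy actions can lead to a terminal state within `k` steps. -/
def level (c : Tables S A) : ℕ → Set S
  | 0 => {s | M.Terminal s}
  | k + 1 => {s | s ∈ level c k ∨ ∃ a ∈ c.greedyActions M s, ∃ s' ∈ level c k, M.trans s a s' ≠ 0}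

/-- Each level costs one factor, by `frozenStep_le` applied to a greedy move into the previous
level. -/
theorem survive_le_of_mem_level {p : ℝ} (hp : M.IsMinProb p) (c : Tables S A) (k : ℕ) {s : S}
    (hs : s ∈ level M c k) : survive M c k s ≤ 1 - (p / M.maxEnabled) ^ k := by
  obtain ⟨h0, h1⟩ := hp.div_maxEnabled_mem
  induction k generalizing s with
  | zero => rw [survive_terminal c _ hs]; simp
  | succ k ih =>
    rcases hs with hs | ⟨a, ha, s', hs', h⟩
    · refine (survive_succ_le c k s).trans ((ih hs).trans ?_)
      have : (p / M.maxEnabled) ^ (k + 1) ≤ (p / M.maxEnabled) ^ k :=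
        pow_le_pow_of_le_one h0.le h1 k.le_succ
      linarith
    · rw [survive]
      split_ifs
      · have := pow_le_one₀ (n := k + 1) h0.le h1
        linarith
      · have := frozenStep_le hp c (f := survive M c k) (fun s => (survive_mem c k s).2) ha h
        rw [pow_succ']
        nlinarith [ih hs']

/-- A nonempty set of non-terminal states cannot be closed under greedy actions, if the upper bounds
are correct. -/
theorem eq_empty_of_closed (hM : M.EndComponentsHaveValueOne) (c : Tables S A)
    (hle : ∀ q, c.upper.val q ≤ 1)
    (hv : ∀ s, ∀ a ∈ M.enabled s, (M.trans s a).avg M.optLim ≤ c.upper.val (s, a))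
    {D : Set S} (hD : ∀ s ∈ D, ¬ M.Terminal s)
    (hcl : ∀ s ∈ D, ∀ a ∈ c.greedyActions M s, ∀ s', M.trans s a s' ≠ 0 → s' ∈ D) : D = ∅ := by
  by_contra hne
  -- A minimal closed subset is taken because minimality forces connectedness.
  let C : Set (Set S) := {R | R.Nonempty ∧ R ⊆ D ∧
    ∀ s ∈ R, ∀ a ∈ c.greedyActions M s, ∀ s', M.trans s a s' ≠ 0 → s' ∈ R}
  obtain ⟨R, ⟨hR, hRD, hRc⟩, hmin⟩ := (wellFounded_lt (α := Set S)).has_min C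
    ⟨D, Set.nonempty_iff_ne_empty.mpr hne, subset_rfl, hcl⟩
  have hEC : M.IsEndComponent R {a | ∃ s ∈ R, a ∈ c.greedyActions M s} := by
    refine ⟨hR, ?_, ?_, ?_, ?_⟩
    · rintro a ⟨s, hs, ha⟩
      exact ⟨s, hs, (mem_greedyActions.mp ha).1⟩
    · intro s hs
      obtain ⟨a, ha⟩ := c.greedyActions_nonempty M s
      exact ⟨a, ⟨s, hs, ha⟩, (mem_greedyActions.mp ha).1⟩
    · rintro s hs a ⟨s₁, -, ha⟩ has s' hs'
      rw [M.enabled_disjoint s₁ s a (mem_greedyActions.mp ha).1 has] at ha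
      exact hRc s hs a ha s' hs'
    · intro s hs s' hs'
      -- The states of `R` reachable from `s` by greedy actions form a closed set; if it missed
      -- `s'`, it would be a smaller closed subset.
      by_contra hns
      refine hmin {y ∈ R | Relation.ReflTransGen (fun x y => ∃ a ∈ {a | ∃ s ∈ R,
        a ∈ c.greedyActions M s}, a ∈ M.enabled x ∧ M.trans x a y ≠ 0) s y}
        ⟨⟨s, hs, .refl⟩, fun y hy => hRD hy.1, ?_⟩ ?_
      · rintro y ⟨hy, hsy⟩ a ha y' hy'
        exact ⟨hRc y hy a ha y' hy', hsy.tail ⟨a, ⟨y, hy, ha⟩, (mem_greedyActions.mp ha).1, hy'⟩⟩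
      · exact ⟨fun y hy => hy.1, fun h => hns (h hs').2⟩
  have h1 : ∀ s ∈ R, M.optLim s = 1 := fun s hs => le_antisymm (M.optLim_le_one s)
    ((hM R _ hEC s hs fun h => hD s (hRD hs) (Or.inl h)).ge.trans (M.value_le_optLim s))
  -- A mean value of 1 would force the upper bound to be 1, the largest possible estimate, and the
  -- action would be greedy.
  have hlt : ∀ s ∈ R, ∀ a ∈ M.enabled s, a ∉ c.greedyActions M s →
      (M.trans s a).avg M.optLim < 1 := by
    intro s hs a ha hna
    by_contra hge
    rw [not_lt] at hge
    have h2 : c.upper.val (s, a) = 1 := le_antisymm (hle _) (hge.trans (hv s a ha))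
    refine hna (mem_greedyActions.mpr ⟨ha, le_antisymm ?_ ?_⟩)
    · exact Finset.le_sup' (fun a => c.upper.val (s, a)) ha
    · rw [h2]
      exact Finset.sup'_le _ _ fun b _ => hle _
  classical
  -- The deficits of the non-greedy actions in `R`, with default value 1 elsewhere. Their minimum
  -- over the finite set of pairs is a positive margin by which all step-bounded values in `R` stay
  -- below 1: greedy actions remain in `R`, and the others lose the margin at once.
  let F : S × A → ℝ := fun x => if x.1 ∈ R ∧ x.2 ∈ M.enabled x.1 ∧ x.2 ∉ c.greedyActions M x.1 then
    1 - (M.trans x.1 x.2).avg M.optLim else 1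
  have hF : ∀ x, 0 < F x ∧ F x ≤ 1 := by
    intro x
    simp only [F]
    split_ifs with hx
    · exact ⟨sub_pos.mpr (hlt _ hx.1 _ hx.2.1 hx.2.2),
        sub_le_self _ (PMF.avg_nonneg _ fun x _ => M.optLim_nonneg x)⟩
    · norm_num
  have : Nonempty (S × A) := ⟨M.init, (M.enabled_nonempty M.init).choose⟩
  obtain ⟨x₀, hx₀⟩ := Finite.exists_min F
  have hk : ∀ k, ∀ s ∈ R, M.optVal k s ≤ 1 - F x₀ := by
    intro k
    induction k with
    | zero =>
      intro s hs
      rw [MDP.optVal, if_neg fun h => hD s (hRD hs) (Or.inr h)]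
      linarith [(hF x₀).2]
    | succ k ih =>
      intro s hs
      rw [MDP.optVal, if_neg fun h => hD s (hRD hs) (Or.inr h)]
      refine Finset.sup'_le _ _ fun a ha => ?_
      by_cases hg : a ∈ c.greedyActions M s
      · exact PMF.avg_le _ fun s' hs' => ih s' (hRc s hs a hg s' hs')
      · have h3 := hx₀ (s, a)
        have h4 : F (s, a) = 1 - (M.trans s a).avg M.optLim := if_pos ⟨hs, ha, hg⟩
        have h5 : (M.trans s a).avg (M.optVal k) ≤ (M.trans s a).avg M.optLim :=
          PMF.avg_mono _ fun x _ => M.optVal_le_optLim k x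
        linarith
  obtain ⟨s, hs⟩ := hR
  have h6 : M.optLim s ≤ 1 - F x₀ := ciSup_le fun k => hk k s hs
  linarith [h1 s hs, (hF x₀).1]

/-- An increasing chain of subsets of S, each determined by its predecessor, is stationary after |S|
steps. The complement of the stationary level is closed under greedy actions and contains no
terminal state, hence it is empty. -/
theorem level_eq_univ (hM : M.EndComponentsHaveValueOne) (c : Tables S A)
    (hle : ∀ q, c.upper.val q ≤ 1)
    (hv : ∀ s, ∀ a ∈ M.enabled s, (M.trans s a).avg M.optLim ≤ c.upper.val (s, a)) :
    level M c (Fintype.card S) = Set.univ := by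
  have hmono : ∀ k, level M c k ⊆ level M c (k + 1) := fun k s hs => Or.inl hs
  have hstab := Nat.stabilises_of_monotone (f := fun k => (level M c k).ncard)
    (b := Fintype.card S) (n := Fintype.card S + 1)
    (monotone_nat_of_le_succ fun k => Set.ncard_le_ncard (hmono k) (Set.toFinite _))
    (fun k => by simpa [Nat.card_eq_fintype_card] using Set.ncard_le_card (level M c k))
    (fun k hk => by
      have h : level M c k = level M c (k + 1) :=
        Set.eq_of_subset_of_ncard_le (hmono k) hk.ge (Set.toFinite _)
      have hG : ∀ j, level M c (j + 1) = (fun X : Set S => {s | s ∈ X ∨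
        ∃ a ∈ c.greedyActions M s, ∃ s' ∈ X, M.trans s a s' ≠ 0}) (level M c j) := fun _ => rfl
      rw [hG (k + 1), ← h, ← hG k, ← h])
    (Nat.le_succ _)
  have heq : level M c (Fintype.card S) = level M c (Fintype.card S + 1) :=
    Set.eq_of_subset_of_ncard_le (hmono _) hstab.le (Set.toFinite _)
  have hsub : level M c 0 ⊆ level M c (Fintype.card S) :=
    monotone_nat_of_le_succ (f := level M c) hmono (Nat.zero_le _)
  refine Set.compl_empty_iff.mp (eq_empty_of_closed hM c hle hv (fun s hs ht => hs (hsub ht))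
    fun s hs a ha s' hs' hmem => hs ?_)
  rw [heq]
  exact Or.inr ⟨a, ha, s', hmem, hs'⟩

theorem survive_card_le (hM : M.EndComponentsHaveValueOne) {p : ℝ} (hp : M.IsMinProb p)
    (c : Tables S A) (hle : ∀ q, c.upper.val q ≤ 1)
    (hv : ∀ s, ∀ a ∈ M.enabled s, (M.trans s a).avg M.optLim ≤ c.upper.val (s, a)) (s : S) :
    survive M c (Fintype.card S) s ≤ 1 - (p / M.maxEnabled) ^ Fintype.card S :=
  survive_le_of_mem_level hp c _ (by rw [level_eq_univ hM c hle hv]; trivial)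

end Tables

/-! ### Comparing the bounds with the executed strategy -/

namespace Estimator

variable {S A : Type*}

/-- The amount, in the direction given by the sign `σ`, by which an estimate exceeds the average of
the estimates of the successor states. -/
noncomputable def gap [Fintype S] (M : MDP S A) (σ : ℝ) (e : Estimator S A) (p : S × A) : ℝ :=
  σ * (e.val p - (M.trans p.1 p.2).avg (e.stateVal M))

theorem val_le_stateVal (M : MDP S A) (e : Estimator S A) {s : S} {a : A}
    (ha : a ∈ M.enabled s) : e.val (s, a) ≤ e.stateVal M s :=
  Finset.le_sup' (fun a => e.val (s, a)) ha

theorem stateVal_le {M : MDP S A} {e : Estimator S A} {s : S} {r : ℝ}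
    (h : ∀ a ∈ M.enabled s, e.val (s, a) ≤ r) : e.stateVal M s ≤ r :=
  Finset.sup'_le _ _ h

theorem le_stateVal {M : MDP S A} {e : Estimator S A} {s : S} {r : ℝ}
    (h : ∀ a ∈ M.enabled s, r ≤ e.val (s, a)) : r ≤ e.stateVal M s := by
  obtain ⟨a, ha⟩ := M.enabled_nonempty s
  exact (h a ha).trans (e.val_le_stateVal M ha)

theorem stateVal_congr {M : MDP S A} {e e' : Estimator S A} (h : e.val = e'.val) :
    e.stateVal M = e'.stateVal M := by
  funext s
  simp only [stateVal, h]

end Estimator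

namespace Tables

variable {S A : Type*} {M : MDP S A}

variable (M) in
/-- The estimates are probabilities, and they have the correct values in the terminal states. -/
structure ValBounds (c : Tables S A) : Prop where
  upper_mem : ∀ q, 0 ≤ c.upper.val q ∧ c.upper.val q ≤ 1
  lower_mem : ∀ q, 0 ≤ c.lower.val q ∧ c.lower.val q ≤ 1
  upper_sink : ∀ a, c.upper.val (M.sink, a) = 0
  lower_target : ∀ a, c.lower.val (M.target, a) = 1

theorem ValBounds.congr {c c' : Tables S A} (h : ValBounds M c) (hu : c'.upper.val = c.upper.val)
    (hl : c'.lower.val = c.lower.val) : ValBounds M c' := by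
  obtain ⟨h1, h2, h3, h4⟩ := h
  exact ⟨by rwa [hu], by rwa [hl], by rwa [hu], by rwa [hl]⟩

theorem ValBounds.upper_stateVal_le {c : Tables S A} (h : ValBounds M c) (s : S) :
    c.upper.stateVal M s ≤ 1 :=
  Estimator.stateVal_le fun a _ => (h.upper_mem (s, a)).2

theorem ValBounds.lower_stateVal_nonneg {c : Tables S A} (h : ValBounds M c) (s : S) :
    0 ≤ c.lower.stateVal M s :=
  Estimator.le_stateVal fun a _ => (h.lower_mem (s, a)).1

variable [Fintype S]

variable (M) in
/-- The move from `s` with action `a` to `s'` escapes if one of the two bounds of the pair `(s, a)`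
is inconsistent with those of the successors, or if the move changes one of the bounds. -/
def Escapes (m : ℕ) (ε₁ : ℝ) (c : Tables S A) (s : S) (a : A) (s' : S) : Prop :=
  3 * ε₁ ≤ c.upper.gap M 1 (s, a) ∨ 3 * ε₁ ≤ c.lower.gap M (-1) (s, a) ∨
    (c.observe M m ε₁ s a s').upper.val ≠ c.upper.val ∨
    (c.observe M m ε₁ s a s').lower.val ≠ c.lower.val

variable [Fintype A]

variable (M) in
open scoped Classical in
/-- The probability that the strategy executed from the variables `c` on escapes within `k` steps,
before it reaches a terminal state. -/
noncomputable def escape (m : ℕ) (ε₁ : ℝ) : ℕ → Tables S A → S → ℝ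
  | 0, _, _ => 0
  | k + 1, c, s => if M.Terminal s then 0 else
      (c.greedy M s).avg fun a => (M.trans s a).avg fun s' =>
        if Escapes M m ε₁ c s a s' then 1 else escape m ε₁ k (c.observe M m ε₁ s a s') s'

variable {m : ℕ} {ε₁ : ℝ}

theorem escape_mem (k : ℕ) (c : Tables S A) (s : S) :
    0 ≤ escape M m ε₁ k c s ∧ escape M m ε₁ k c s ≤ 1 := by
  induction k generalizing c s with
  | zero => unfold escape; norm_num
  | succ k ih =>
    unfold escape
    split_ifs
    · norm_num
    · refine ⟨PMF.avg_nonneg _ fun _ _ => PMF.avg_nonneg _ fun _ _ => ?_,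
        PMF.avg_le _ fun _ _ => PMF.avg_le _ fun _ _ => ?_⟩
      all_goals split_ifs
      exacts [zero_le_one, (ih _ _).1, le_rfl, (ih _ _).2]

variable (M) in
/-- The expected number of steps, at most `k`, before the memoryless greedy strategy reaches a
terminal state. -/
noncomputable def duration (c : Tables S A) (k : ℕ) (s : S) : ℝ :=
  ∑ j ∈ Finset.range k, survive M c j s

theorem duration_nonneg (c : Tables S A) (k : ℕ) (s : S) : 0 ≤ duration M c k s :=
  Finset.sum_nonneg fun j _ => (survive_mem c j s).1

theorem duration_congr {c c' : Tables S A} (h : c.upper.val = c'.upper.val) (k : ℕ) (s : S) :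
    duration M c k s = duration M c' k s :=
  Finset.sum_congr rfl fun j _ => survive_congr h j s

theorem duration_succ (c : Tables S A) (k : ℕ) {s : S} (hs : ¬ M.Terminal s) :
    duration M c (k + 1) s = 1 + frozenStep M c (duration M c k) s := by
  have h : frozenStep M c (duration M c k) s
      = ∑ j ∈ Finset.range k, frozenStep M c (survive M c j) s := by
    simp only [frozenStep, ← PMF.avg_sum]
    rfl
  rw [duration, Finset.sum_range_succ', h, survive.eq_1, if_neg hs, add_comm]
  simp only [survive, if_neg hs]

theorem frozenStep_eq (c : Tables S A) (f : S → ℝ) (s : S) :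
    frozenStep M c f s = (M.stepLaw s (c.greedy M s)).avg fun x => f x.dest := by
  rw [MDP.avg_stepLaw]
  rfl

theorem escape_succ (k : ℕ) (c : Tables S A) {s : S} (hs : ¬ M.Terminal s) [∀ x : Move S A,
    Decidable (Escapes M m ε₁ c s x.act x.dest)] :
    escape M m ε₁ (k + 1) c s = (M.stepLaw s (c.greedy M s)).avg fun x =>
      if Escapes M m ε₁ c s x.act x.dest then 1 else
        escape M m ε₁ k (c.observe M m ε₁ s x.act x.dest) x.dest := by
  rw [MDP.avg_stepLaw, escape, if_neg hs]
  congr! 6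

theorem reachWithin_succ (k : ℕ) (c : Tables S A) {s : S} (hs : ¬ M.Terminal s) :
    reachWithin M m ε₁ (k + 1) c s = (M.stepLaw s (c.greedy M s)).avg fun x =>
        reachWithin M m ε₁ k (c.observe M m ε₁ s x.act x.dest) x.dest := by
  rw [MDP.avg_stepLaw, reachWithin, if_neg fun h => hs (Or.inr h)]

-- All greedy actions attain the maximum, so U(s) is the average of their upper bounds. An
-- inconsistent pair is charged the trivial bound 1, a consistent one the error 3ε₁.
open scoped Classical in
theorem upper_stateVal_le_avg (c : Tables S A) (hc : ValBounds M c) (s : S) :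
    c.upper.stateVal M s ≤ (M.stepLaw s (c.greedy M s)).avg fun x =>
      if 3 * ε₁ ≤ c.upper.gap M 1 (s, x.act) then 1 else
        c.upper.stateVal M x.dest + 3 * ε₁ := by
  rw [MDP.avg_stepLaw, ← avg_greedy_val]
  refine PMF.avg_mono _ fun a _ => ?_
  by_cases hg : 3 * ε₁ ≤ c.upper.gap M 1 (s, a)
  · simp only [if_pos hg, PMF.avg_const]
    exact (hc.upper_mem _).2
  · simp only [if_neg hg]
    rw [PMF.avg_add, PMF.avg_const]
    simp only [Estimator.gap, one_mul] at hg
    linarith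

-- Greedy actions need not maximise L, but L(s) dominates the lower bound of each of them, which is
-- the direction needed here.
open scoped Classical in
theorem avg_le_lower_stateVal (c : Tables S A) (hc : ValBounds M c) (s : S) :
    ((M.stepLaw s (c.greedy M s)).avg fun x =>
      if 3 * ε₁ ≤ c.lower.gap M (-1) (s, x.act) then 0 else
        c.lower.stateVal M x.dest - 3 * ε₁) ≤ c.lower.stateVal M s := by
  rw [MDP.avg_stepLaw]
  refine PMF.avg_le _ fun a ha => ?_
  by_cases hg : 3 * ε₁ ≤ c.lower.gap M (-1) (s, a)
  · simp only [if_pos hg, PMF.avg_const]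
    exact hc.lower_stateVal_nonneg s
  · simp only [if_neg hg]
    rw [PMF.avg_sub, PMF.avg_const]
    simp only [Estimator.gap] at hg
    have := c.lower.val_le_stateVal M (mem_greedyActions.mp (mem_support_greedy.mp ha)).1
    linarith

/-- Consistency is unrolled along the first `k` moves. A path pays 1 if it escapes or is still alive
at the end, and 3ε₁ for each step; otherwise it ends in a terminal state, where U is at most the
indicator of the target. -/
theorem upper_stateVal_le_reachWithin (hε : 0 ≤ ε₁) (k : ℕ) (c : Tables S A) (s : S)
    (hc : ValBounds M c) :
    c.upper.stateVal M s ≤ reachWithin M m ε₁ k c s + survive M c k s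
      + 3 * ε₁ * duration M c k s + escape M m ε₁ k c s := by
  classical
  have hpos : ∀ (k : ℕ) (c : Tables S A) (s : S), 0 ≤ reachWithin M m ε₁ k c s ∧
      0 ≤ survive M c k s ∧ 0 ≤ 3 * ε₁ * duration M c k s ∧ 0 ≤ escape M m ε₁ k c s :=
    fun k c s => ⟨(reachWithin_mem M m ε₁ k c s).1, (survive_mem c k s).1,
      mul_nonneg (by positivity) (duration_nonneg c k s), (escape_mem k c s).1⟩
  induction k generalizing c s with
  | zero =>
    by_cases hs : M.Terminal s
    · rcases hs with rfl | rfl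
      · have : c.upper.stateVal M M.sink ≤ 0 :=
          Estimator.stateVal_le fun a _ => (hc.upper_sink a).le
        linarith [hpos 0 c M.sink]
      · have := reachWithin_target M m ε₁ 0 c
        linarith [hpos 0 c M.target, hc.upper_stateVal_le M.target]
    · have h : survive M c 0 s = 1 := by rw [survive, if_neg hs]
      linarith [hpos 0 c s, hc.upper_stateVal_le s]
  | succ k ih =>
    by_cases hs : M.Terminal s
    · rcases hs with rfl | rfl
      · have : c.upper.stateVal M M.sink ≤ 0 :=
          Estimator.stateVal_le fun a _ => (hc.upper_sink a).le
        linarith [hpos (k + 1) c M.sink]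
      · have := reachWithin_target M m ε₁ (k + 1) c
        linarith [hpos (k + 1) c M.target, hc.upper_stateVal_le M.target]
    · rw [reachWithin_succ k c hs, survive, if_neg hs, duration_succ c k hs, escape_succ k c hs,
        frozenStep_eq, frozenStep_eq, mul_add, mul_one]
      refine (upper_stateVal_le_avg (ε₁ := ε₁) c hc s).trans ?_
      rw [← PMF.avg_const_mul, ← PMF.avg_const (M.stepLaw s (c.greedy M s)) (3 * ε₁)]
      simp only [← PMF.avg_add]
      refine PMF.avg_mono _ fun x _ => ?_
      rw [PMF.avg_const]
      have h1 := hpos k (c.observe M m ε₁ s x.act x.dest) x.dest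
      have h2 := hpos k c x.dest
      by_cases he : Escapes M m ε₁ c s x.act x.dest
      · rw [if_pos he]
        have h3 := hc.upper_stateVal_le x.dest
        split_ifs <;> linarith
      -- Without an escape the estimates are unchanged, so the survival and duration terms of the
      -- induction hypothesis belong to the same frozen chain.
      · rw [if_neg he]
        simp only [Escapes, not_or, not_not] at he
        rw [if_neg he.1]
        have h3 := ih (c.observe M m ε₁ s x.act x.dest) x.dest (hc.congr he.2.2.1 he.2.2.2)
        rw [Estimator.stateVal_congr he.2.2.1, survive_congr he.2.2.1,
          duration_congr he.2.2.1] at h3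
        linarith

/-- The mirror image of the preceding bound. There is no survival term, because paths that have not
ended count as failures and L is nonnegative. -/
theorem reachWithin_le_lower_stateVal (hε : 0 ≤ ε₁) (k : ℕ) (c : Tables S A) (s : S)
    (hc : ValBounds M c) :
    reachWithin M m ε₁ k c s ≤ c.lower.stateVal M s + 3 * ε₁ * duration M c k s
      + escape M m ε₁ k c s := by
  classical
  have hpos : ∀ (k : ℕ) (c : Tables S A) (s : S),
      0 ≤ 3 * ε₁ * duration M c k s ∧ 0 ≤ escape M m ε₁ k c s :=
    fun k c s => ⟨mul_nonneg (by positivity) (duration_nonneg c k s), (escape_mem k c s).1⟩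
  have htarget : 1 ≤ c.lower.stateVal M M.target :=
    Estimator.le_stateVal fun a _ => (hc.lower_target a).ge
  induction k generalizing c s with
  | zero =>
    by_cases hs : s = M.target
    · subst hs
      linarith [hpos 0 c M.target, (reachWithin_mem M m ε₁ 0 c M.target).2]
    · rw [reachWithin, if_neg hs]
      linarith [hpos 0 c s, hc.lower_stateVal_nonneg s]
  | succ k ih =>
    by_cases hs : M.Terminal s
    · rcases hs with rfl | rfl
      · have h : reachWithin M m ε₁ (k + 1) c M.sink ≤ 0 := by
          refine (reachWithin_le_reachProb M m ε₁ c M.sink _).trans ?_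
          exact (MDP.Strategy.reachProb_le_optLim _ _).trans_eq M.optLim_sink
        linarith [hpos (k + 1) c M.sink, hc.lower_stateVal_nonneg M.sink]
      · linarith [hpos (k + 1) c M.target, (reachWithin_mem M m ε₁ (k + 1) c M.target).2]
    · rw [reachWithin_succ k c hs, duration_succ c k hs, escape_succ k c hs,
        frozenStep_eq, mul_add, mul_one]
      have h0 := avg_le_lower_stateVal (ε₁ := ε₁) c hc s
      suffices h : (M.stepLaw s (c.greedy M s)).avg (fun x =>
            reachWithin M m ε₁ k (c.observe M m ε₁ s x.act x.dest) x.dest)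
          ≤ (M.stepLaw s (c.greedy M s)).avg (fun x =>
              if 3 * ε₁ ≤ c.lower.gap M (-1) (s, x.act) then 0 else
                c.lower.stateVal M x.dest - 3 * ε₁)
            + (3 * ε₁ + 3 * ε₁ * (M.stepLaw s (c.greedy M s)).avg fun x =>
              duration M c k x.dest)
            + (M.stepLaw s (c.greedy M s)).avg fun x =>
              if Escapes M m ε₁ c s x.act x.dest then 1 else
                escape M m ε₁ k (c.observe M m ε₁ s x.act x.dest) x.dest by linarith
      rw [← PMF.avg_const_mul, ← PMF.avg_const (M.stepLaw s (c.greedy M s)) (3 * ε₁)]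
      simp only [← PMF.avg_add]
      refine PMF.avg_mono _ fun x _ => ?_
      rw [PMF.avg_const]
      have h1 := hpos k (c.observe M m ε₁ s x.act x.dest) x.dest
      have h2 := hpos k c x.dest
      by_cases he : Escapes M m ε₁ c s x.act x.dest
      · rw [if_pos he]
        have h3 := hc.lower_stateVal_nonneg x.dest
        have h4 := (reachWithin_mem M m ε₁ k (c.observe M m ε₁ s x.act x.dest) x.dest).2
        split_ifs <;> linarith
      · rw [if_neg he]
        simp only [Escapes, not_or, not_not] at he
        rw [if_neg he.2.1]
        have hc' := hc.congr he.2.2.1 he.2.2.2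
        have h3 := ih (c.observe M m ε₁ s x.act x.dest) x.dest hc'
          (Estimator.le_stateVal fun a _ => (hc'.lower_target a).ge)
        rw [Estimator.stateVal_congr he.2.2.2, duration_congr he.2.2.1] at h3
        linarith

/-! ### Optimality of the executed strategy -/

variable (M) in
/-- The upper bounds are consistent with the optimal reachability probabilities. -/
def UpperCorrect (c : Tables S A) : Prop :=
  ∀ s, ∀ a ∈ M.enabled s, (M.trans s a).avg M.optLim ≤ c.upper.val (s, a)

omit [Fintype A] in
theorem UpperCorrect.optLim_le {c : Tables S A} (h : UpperCorrect M c) (s : S) :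
    M.optLim s ≤ c.upper.stateVal M s :=
  (M.optLim_le_sup' s).trans (Finset.sup'_mono_fun fun a ha => h s a ha)

section parameters

variable {p ε : ℝ} {T : ℕ}

theorem survive_le_eps₂ (hM : M.EndComponentsHaveValueOne) (hp : M.IsMinProb p) (hε : 0 < ε)
    (hT : Fintype.card S * Real.log (2 / DQL.eps₂ ε) / (p / M.maxEnabled) ^ Fintype.card S ≤ T)
    {c : Tables S A} (hc : ValBounds M c) (hv : UpperCorrect M c) (s : S) :
    survive M c T s ≤ 1.4 * DQL.eps₂ ε := by
  have : Nonempty S := ⟨s⟩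
  obtain ⟨h0, h1⟩ := hp.div_maxEnabled_mem
  have hq0 := pow_pos h0 (Fintype.card S)
  have hq1 := pow_le_one₀ (n := Fintype.card S) h0.le h1
  refine (survive_le_exp c Fintype.card_pos hq0 hq1
    (survive_card_le hM hp c (fun q => (hc.upper_mem q).2) hv) T s).trans ?_
  set q := (p / M.maxEnabled) ^ Fintype.card S with hq
  have hN : (0 : ℝ) < Fintype.card S := by exact_mod_cast Fintype.card_pos
  have he : 0 < DQL.eps₂ ε := by unfold DQL.eps₂; linarith
  have h2 : Real.log (2 / DQL.eps₂ ε) ≤ q * (T / Fintype.card S) := by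
    rw [div_le_iff₀ hq0] at hT
    rw [mul_div_assoc', le_div_iff₀ hN]
    linarith
  -- Estimating the rounding loss `q` by 1 costs a factor e, and e/2 is below 1.4.
  calc Real.exp (q - q * (T / Fintype.card S))
      ≤ Real.exp (1 - Real.log (2 / DQL.eps₂ ε)) := Real.exp_le_exp.mpr (by linarith)
    _ = Real.exp 1 * (DQL.eps₂ ε / 2) := by
        rw [Real.exp_sub, Real.exp_log (by positivity)]
        field_simp
    _ ≤ 1.4 * DQL.eps₂ ε := by nlinarith [Real.exp_one_lt_d9]

theorem duration_le (hM : M.EndComponentsHaveValueOne) (hp : M.IsMinProb p) (hε : 0 < ε)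
    {c : Tables S A} (hc : ValBounds M c) (hv : UpperCorrect M c) (s : S) :
    3 * DQL.eps₁ M p ε * duration M c T s ≤ 2 * DQL.eps₂ ε := by
  have : Nonempty S := ⟨s⟩
  obtain ⟨h0, h1⟩ := hp.div_maxEnabled_mem
  have hq0 := pow_pos h0 (Fintype.card S)
  have hq1 := pow_le_one₀ (n := Fintype.card S) h0.le h1
  have h2 := sum_survive_le c Fintype.card_pos hq0 hq1
    (survive_card_le hM hp c (fun q => (hc.upper_mem q).2) hv) T s
  have hN : (0 : ℝ) < Fintype.card S := by exact_mod_cast Fintype.card_pos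
  unfold DQL.eps₁ DQL.eps₂ duration
  set q := (p / M.maxEnabled) ^ Fintype.card S with hq
  -- The definition of ε₁ cancels the expected duration |S|/q exactly, which leaves 3ε/12 = 2ε₂.
  refine (mul_le_mul_of_nonneg_left h2 (by positivity)).trans (le_of_eq ?_)
  field_simp
  norm_num

omit [Fintype A] in
theorem _root_.DQL.eps₁_pos (hp : M.IsMinProb p) (hε : 0 < ε) : 0 < DQL.eps₁ M p ε := by
  have : Nonempty S := ⟨M.init⟩
  have hN : (0 : ℝ) < Fintype.card S := by exact_mod_cast Fintype.card_pos
  have hq0 := pow_pos hp.div_maxEnabled_mem.1 (Fintype.card S)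
  unfold DQL.eps₁
  positivity

/-- Survival, duration and escape contribute 1.4ε₂ + 2ε₂ + 0.5ε₂, which is below 4ε₂ = ε/2. -/
theorem isOptimalUpTo_executed (hM : M.EndComponentsHaveValueOne) (hp : M.IsMinProb p)
    (hε : 0 < ε)
    (hT : Fintype.card S * Real.log (2 / DQL.eps₂ ε) / (p / M.maxEnabled) ^ Fintype.card S ≤ T)
    {c : Tables S A} (hc : ValBounds M c) (hv : UpperCorrect M c) {s : S}
    (he : escape M m (DQL.eps₁ M p ε) T c s ≤ DQL.eps₂ ε / 2) :
    (c.executed M m (DQL.eps₁ M p ε)).IsOptimalUpTo (ε / 2) s := by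
  have h1 := upper_stateVal_le_reachWithin (m := m) (DQL.eps₁_pos hp hε).le T c s hc
  have h2 := reachWithin_le_reachProb M m (DQL.eps₁ M p ε) c s T
  have h3 := survive_le_eps₂ hM hp hε hT hc hv s
  have h4 := duration_le (T := T) hM hp hε hc hv s
  have h5 := (M.value_le_optLim s).trans (hv.optLim_le s)
  have h6 : DQL.eps₂ ε = ε / 8 := rfl
  unfold MDP.Strategy.IsOptimalUpTo
  linarith

/-- The error 3.9ε₂ of the upper comparison and the error 2.5ε₂ of the lower one add up to less than
8ε₂ = ε. -/
theorem upper_sub_lower_le (hM : M.EndComponentsHaveValueOne) (hp : M.IsMinProb p) (hε : 0 < ε)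
    (hT : Fintype.card S * Real.log (2 / DQL.eps₂ ε) / (p / M.maxEnabled) ^ Fintype.card S ≤ T)
    {c : Tables S A} (hc : ValBounds M c) (hv : UpperCorrect M c) {s : S}
    (he : escape M m (DQL.eps₁ M p ε) T c s ≤ DQL.eps₂ ε / 2) :
    c.upper.stateVal M s - c.lower.stateVal M s ≤ ε := by
  have h1 := upper_stateVal_le_reachWithin (m := m) (DQL.eps₁_pos hp hε).le T c s hc
  have h2 := reachWithin_le_lower_stateVal (m := m) (DQL.eps₁_pos hp hε).le T c s hc
  have h3 := survive_le_eps₂ hM hp hε hT hc hv s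
  have h4 := duration_le (T := T) hM hp hε hc hv s
  have h6 : DQL.eps₂ ε = ε / 8 := rfl
  linarith

end parameters

end Tables

/-! ### One step of an estimator -/

namespace Estimator

variable {S A : Type*}

/-- The processing of an observation by the upper (`σ = 1`) or the lower (`σ = -1`) bound. -/
noncomputable def signedStep (σ : ℝ) (m : ℕ) (ε₁ : ℝ) (t wake : ℕ) (e : Estimator S A)
    (p : S × A) (v : ℝ) : Estimator S A :=
  e.process m t (fun q x => 2 * ε₁ ≤ σ * (q - x)) (fun x => x + σ * ε₁) wake p v

/-- The possible effects of the processing of an observation on the variables of the observed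
pair. -/
inductive Outcome (σ : ℝ) (m : ℕ) (ε₁ : ℝ) (t wake : ℕ) (e : Estimator S A) (p : S × A) (v : ℝ)
    (e' : Estimator S A) : Prop
  | idle (learn : ¬ e.learn p) (val' : e'.val = e.val) (success' : e'.lastSuccess = e.lastSuccess)
      (learn' : e'.learn p ↔ e.time p < wake) (count' : e'.count p = e.count p)
      (accum' : e'.accum p = e.accum p) (time' : e'.time p = e.time p)
  | collect (learn : e.learn p) (count : e.count p + 1 ≠ m) (val' : e'.val = e.val)
      (success' : e'.lastSuccess = e.lastSuccess) (learn' : e'.learn p)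
      (count' : e'.count p = e.count p + 1) (accum' : e'.accum p = e.accum p + v)
      (time' : e'.time p = e.time p)
  | succeed (learn : e.learn p) (count : e.count p + 1 = m)
      (success : 2 * ε₁ ≤ σ * (e.val p - (e.accum p + v) / m))
      (val' : e'.val p = (e.accum p + v) / m + σ * ε₁) (success' : e'.lastSuccess = t)
      (learn' : e'.learn p) (count' : e'.count p = 0) (accum' : e'.accum p = 0)
      (time' : e'.time p = t)
  | fail (learn : e.learn p) (count : e.count p + 1 = m)
      (success : ¬ 2 * ε₁ ≤ σ * (e.val p - (e.accum p + v) / m)) (val' : e'.val = e.val)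
      (success' : e'.lastSuccess = e.lastSuccess)
      (learn' : e'.learn p ↔ e.time p < e.lastSuccess) (count' : e'.count p = 0)
      (accum' : e'.accum p = 0) (time' : e'.time p = t)

theorem outcome (σ : ℝ) (m : ℕ) (ε₁ : ℝ) (t wake : ℕ) (e : Estimator S A) (p : S × A) (v : ℝ) :
    Outcome σ m ε₁ t wake e p v (e.signedStep σ m ε₁ t wake p v) := by
  unfold signedStep process
  by_cases hl : e.learn p
  · rw [if_pos hl]
    by_cases hc : e.count p + 1 = m
    · rw [if_pos hc]
      by_cases hs : 2 * ε₁ ≤ σ * (e.val p - (e.accum p + v) / m)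
      · exact .succeed hl hc hs (by simp [hs]) (by simp [hs]) (by simp [hs, hl]) (by simp)
          (by simp) (by simp)
      · refine .fail hl hc hs (by simp [hs]) (by simp [hs]) ?_ (by simp) (by simp) (by simp)
        by_cases ht : e.lastSuccess ≤ e.time p
        · simp [hs, ht]
        · simp [hs, ht, hl, not_le.mp ht]
    · rw [if_neg hc]
      exact .collect hl hc rfl rfl hl (by simp) (by simp) rfl
  · rw [if_neg hl]
    by_cases hw : e.time p < wake
    · rw [if_pos hw]
      exact .idle hl rfl rfl (by simp [hw]) rfl rfl rfl
    · rw [if_neg hw]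
      exact .idle hl rfl rfl (by simp [hw, hl]) rfl rfl rfl

section ne

variable (σ : ℝ) (m : ℕ) (ε₁ : ℝ) (t wake : ℕ) (e : Estimator S A) {p r : S × A} (v : ℝ)

theorem signedStep_of_ne (h : r ≠ p) :
    (e.signedStep σ m ε₁ t wake p v).val r = e.val r ∧
    (e.signedStep σ m ε₁ t wake p v).accum r = e.accum r ∧
    (e.signedStep σ m ε₁ t wake p v).count r = e.count r ∧
    (e.signedStep σ m ε₁ t wake p v).time r = e.time r ∧
    ((e.signedStep σ m ε₁ t wake p v).learn r ↔ e.learn r) := by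
  classical
  unfold signedStep process
  refine ⟨?_, ?_, ?_, ?_, ?_⟩ <;> split_ifs <;> simp [Function.update_of_ne h]

end ne

/-- The elementary invariants of an estimator at time `t`. -/
structure Sound (m t : ℕ) (e : Estimator S A) : Prop where
  val_mem : ∀ r, 0 ≤ e.val r ∧ e.val r ≤ 1
  accum_mem : ∀ r, 0 ≤ e.accum r ∧ e.accum r ≤ e.count r
  count_lt : ∀ r, e.count r < m
  learn_of_count : ∀ r, e.count r ≠ 0 → e.learn r
  time_le : ∀ r, e.time r ≤ t
  lastSuccess_le : e.lastSuccess ≤ t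

theorem Sound.start {m : ℕ} (hm : 0 < m) {v : S × A → ℝ} (hv : ∀ r, 0 ≤ v r ∧ v r ≤ 1) :
    Sound m 0 (Estimator.start v) :=
  ⟨hv, fun _ => by simp [Estimator.start], fun _ => hm, fun _ _ => trivial, fun _ => le_rfl, le_rfl⟩

theorem Sound.average_mem {m t : ℕ} {e : Estimator S A} (h : e.Sound m t) {p : S × A} {v : ℝ}
    (hv : 0 ≤ v ∧ v ≤ 1) (hc : e.count p + 1 = m) :
    0 ≤ (e.accum p + v) / m ∧ (e.accum p + v) / m ≤ 1 := by
  have hc' : (e.count p : ℝ) + 1 = m := by exact_mod_cast hc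
  obtain ⟨h0, h1⟩ := h.accum_mem p
  exact ⟨div_nonneg (by linarith [hv.1]) m.cast_nonneg,
    div_le_one_of_le₀ (by linarith [hv.2]) m.cast_nonneg⟩

theorem Sound.signedStep {σ : ℝ} (hσ : σ = 1 ∨ σ = -1) {m t : ℕ} (hm : 0 < m) {ε₁ : ℝ}
    (hε : 0 < ε₁) (wake : ℕ) {e : Estimator S A} (h : e.Sound m t) (p : S × A) {v : ℝ}
    (hv : 0 ≤ v ∧ v ≤ 1) : (e.signedStep σ m ε₁ (t + 1) wake p v).Sound m (t + 1) := by
  have ho := e.outcome σ m ε₁ (t + 1) wake p v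
  have hne := fun r (hr : r ≠ p) => e.signedStep_of_ne σ m ε₁ (t + 1) wake v hr
  set e' := e.signedStep σ m ε₁ (t + 1) wake p v
  have hP : (0 ≤ e'.val p ∧ e'.val p ≤ 1) ∧ (0 ≤ e'.accum p ∧ e'.accum p ≤ e'.count p) ∧
      e'.count p < m ∧ (e'.count p ≠ 0 → e'.learn p) ∧ e'.time p ≤ t + 1 ∧
      e'.lastSuccess ≤ t + 1 := by
    have h1 := h.val_mem p
    have h2 := h.accum_mem p
    have h3 := h.count_lt p
    have h4 := h.learn_of_count p
    have h5 := h.time_le p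
    have h6 := h.lastSuccess_le
    rcases ho with ⟨hl, hv', hs', hl', hc', ha', ht'⟩ | ⟨hl, hc, hv', hs', hl', hc', ha', ht'⟩ |
      ⟨hl, hc, hs, hv', hs', hl', hc', ha', ht'⟩ | ⟨hl, hc, hs, hv', hs', hl', hc', ha', ht'⟩ <;>
      rw [hv', hs', hc', ha', ht']
    · exact ⟨h1, h2, h3, fun hc => (hl (h4 hc)).elim, by omega, by omega⟩
    · refine ⟨h1, ⟨by linarith, by push_cast; linarith⟩, by omega, fun _ => hl', by omega, by omega⟩
    · refine ⟨?_, by simp, hm, fun h => (h rfl).elim, le_rfl, le_rfl⟩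
      have h7 := h.average_mem hv hc
      rcases hσ with rfl | rfl <;> constructor <;> linarith
    · exact ⟨h1, by simp, hm, fun h => (h rfl).elim, le_rfl, by omega⟩
  have hcases : ∀ r, r = p ∨ r ≠ p := fun r => eq_or_ne r p
  refine ⟨fun r => ?_, fun r => ?_, fun r => ?_, fun r => ?_, fun r => ?_, hP.2.2.2.2.2⟩ <;>
    rcases hcases r with rfl | hr
  · exact hP.1
  · rw [(hne r hr).1]; exact h.val_mem r
  · exact hP.2.1
  · rw [(hne r hr).2.1, (hne r hr).2.2.1]; exact h.accum_mem r
  · exact hP.2.2.1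
  · rw [(hne r hr).2.2.1]; exact h.count_lt r
  · exact hP.2.2.2.1
  · rw [(hne r hr).2.2.1, (hne r hr).2.2.2.2]; exact h.learn_of_count r
  · exact hP.2.2.2.2.1
  · rw [(hne r hr).2.2.2.1]; exact (h.time_le r).trans t.le_succ

/-- A value changes at most in the direction opposite to the sign, at least by `ε₁`, and only at
successful attempts. -/
theorem signedStep_val {σ : ℝ} (hσ : σ = 1 ∨ σ = -1) (m : ℕ) (ε₁ : ℝ) (t wake : ℕ)
    (e : Estimator S A) (p : S × A) (v : ℝ) :
    ((e.signedStep σ m ε₁ t wake p v).val = e.val ∧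
      (e.signedStep σ m ε₁ t wake p v).lastSuccess = e.lastSuccess) ∨
    (σ * (e.signedStep σ m ε₁ t wake p v).val p ≤ σ * e.val p - ε₁ ∧
      (e.signedStep σ m ε₁ t wake p v).lastSuccess = t) := by
  rcases e.outcome σ m ε₁ t wake p v with ⟨hl, hv', hs', hl', hc', ha', ht'⟩ |
    ⟨hl, hc, hv', hs', hl', hc', ha', ht'⟩ | ⟨hl, hc, hs, hv', hs', hl', hc', ha', ht'⟩ |
    ⟨hl, hc, hs, hv', hs', hl', hc', ha', ht'⟩
  · exact Or.inl ⟨hv', hs'⟩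
  · exact Or.inl ⟨hv', hs'⟩
  · refine Or.inr ⟨?_, hs'⟩
    rw [hv']
    rcases hσ with rfl | rfl <;> linarith
  · exact Or.inl ⟨hv', hs'⟩

theorem signedStep_val_le {σ : ℝ} (hσ : σ = 1 ∨ σ = -1) (m : ℕ) {ε₁ : ℝ} (hε : 0 < ε₁)
    (t wake : ℕ) (e : Estimator S A) (p : S × A) (v : ℝ) (r : S × A) :
    σ * (e.signedStep σ m ε₁ t wake p v).val r ≤ σ * e.val r := by
  rcases e.signedStep_val hσ m ε₁ t wake p v with ⟨h, -⟩ | ⟨h, -⟩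
  · rw [h]
  · rcases eq_or_ne r p with rfl | hr
    · linarith
    · rw [(e.signedStep_of_ne σ m ε₁ t wake v hr).1]

theorem mul_stateVal_le {M : MDP S A} {σ : ℝ} (hσ : σ = 1 ∨ σ = -1) {e e' : Estimator S A}
    (h : ∀ r, σ * e'.val r ≤ σ * e.val r) (s : S) :
    σ * e'.stateVal M s ≤ σ * e.stateVal M s := by
  rcases hσ with rfl | rfl
  · simp only [one_mul] at h ⊢
    exact Finset.sup'_mono_fun fun a _ => h (s, a)
  · simp only [neg_mul, one_mul, neg_le_neg_iff] at h ⊢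
    exact Finset.sup'_mono_fun fun a _ => h (s, a)

theorem Sound.stateVal_mem {M : MDP S A} {m t : ℕ} {e : Estimator S A} (h : e.Sound m t) (s : S) :
    0 ≤ e.stateVal M s ∧ e.stateVal M s ≤ 1 :=
  ⟨le_stateVal fun _ _ => (h.val_mem _).1, stateVal_le fun _ _ => (h.val_mem _).2⟩

/-- The total decrease of the signed estimates of the pairs in `E`, in multiples of `ε₁`. -/
noncomputable def progress (σ ε₁ : ℝ) (E : Finset (S × A)) (v₀ : S × A → ℝ) (e : Estimator S A) :
    ℝ :=
  ∑ r ∈ E, σ * (v₀ r - e.val r) / ε₁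

/-- A success needs a difference of 2ε₁, of which the new value gives back ε₁. So each success is
worth at least one unit of progress, and bounded progress bounds the number of successes. -/
theorem progress_signedStep {σ : ℝ} (hσ : σ = 1 ∨ σ = -1) (m : ℕ) {ε₁ : ℝ} (hε : 0 < ε₁)
    (t wake : ℕ) (E : Finset (S × A)) (v₀ : S × A → ℝ) (e : Estimator S A) {p : S × A}
    (hp : p ∈ E) (v : ℝ) :
    ((e.signedStep σ m ε₁ t wake p v).val = e.val ∧
      (e.signedStep σ m ε₁ t wake p v).lastSuccess = e.lastSuccess ∧
      progress σ ε₁ E v₀ (e.signedStep σ m ε₁ t wake p v) = progress σ ε₁ E v₀ e) ∨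
    ((e.signedStep σ m ε₁ t wake p v).lastSuccess = t ∧
      progress σ ε₁ E v₀ e + 1 ≤ progress σ ε₁ E v₀ (e.signedStep σ m ε₁ t wake p v)) := by
  classical
  rcases e.signedStep_val hσ m ε₁ t wake p v with ⟨h, h'⟩ | ⟨h, h'⟩
  · exact Or.inl ⟨h, h', by simp only [progress, h]⟩
  · refine Or.inr ⟨h', ?_⟩
    unfold progress
    rw [← Finset.add_sum_erase E _ hp, ← Finset.add_sum_erase E _ hp]
    have h1 : ∑ r ∈ E.erase p, σ * (v₀ r - (e.signedStep σ m ε₁ t wake p v).val r) / ε₁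
        = ∑ r ∈ E.erase p, σ * (v₀ r - e.val r) / ε₁ :=
      Finset.sum_congr rfl fun r hr => by
        rw [(e.signedStep_of_ne σ m ε₁ t wake v (Finset.ne_of_mem_erase hr)).1]
    rw [h1]
    have h2 : σ * (v₀ p - e.val p) / ε₁ + 1
        ≤ σ * (v₀ p - (e.signedStep σ m ε₁ t wake p v).val p) / ε₁ := by
      rw [div_add_one hε.ne', div_le_div_iff_of_pos_right hε]
      linarith
    linarith

theorem Sound.progress_le {σ : ℝ} (hσ : σ = 1 ∨ σ = -1) {m t : ℕ} {ε₁ : ℝ} (hε : 0 < ε₁)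
    (E : Finset (S × A)) {v₀ : S × A → ℝ} (hv₀ : ∀ r, 0 ≤ v₀ r ∧ v₀ r ≤ 1) {e : Estimator S A}
    (h : e.Sound m t) : progress σ ε₁ E v₀ e ≤ E.card / ε₁ := by
  unfold progress
  refine (Finset.sum_le_card_nsmul _ _ (1 / ε₁) fun r _ => ?_).trans_eq (by
    rw [nsmul_eq_mul]; ring)
  rw [div_le_div_iff_of_pos_right hε]
  have h1 := h.val_mem r
  have h2 := hv₀ r
  rcases hσ with rfl | rfl <;> linarith

/-! ### The number of attempted updates -/

open scoped Classical in
/-- The number of further attempted updates of a pair, in the absence of further successes. -/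
noncomputable def credit (e : Estimator S A) (wake : ℕ) (r : S × A) : ℝ :=
  if e.time r < e.lastSuccess then 2 else if e.learn r ∨ e.time r < wake then 1 else 0

theorem credit_nonneg (e : Estimator S A) (wake : ℕ) (r : S × A) : 0 ≤ e.credit wake r := by
  unfold credit
  split_ifs <;> norm_num

theorem credit_le_add_one (e : Estimator S A) (wake wake' : ℕ) (r : S × A) :
    e.credit wake' r ≤ e.credit wake r + 1 := by
  unfold credit
  split_ifs <;> norm_num

-- Amortisation. An attempt uses up one unit of credit; a success may restore the credit of every
-- pair to its maximum 2, and is charged to the progress it makes. Two attempts may be needed after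
-- a success: the batch in progress may contain old samples, and its failure does not switch the
-- flag off.
open scoped Classical in
theorem credit_signedStep {σ : ℝ} (hσ : σ = 1 ∨ σ = -1) {m t : ℕ} {ε₁ : ℝ} (hε : 0 < ε₁)
    {wake : ℕ} {e : Estimator S A} (he : e.Sound m t) (hw : e.lastSuccess ≤ wake)
    (hw' : wake ≤ t + 1) (E : Finset (S × A)) (v₀ : S × A → ℝ) {p : S × A} (hp : p ∈ E) (v : ℝ)
    (r : S × A) :
    (if r = p ∧ e.learn p ∧ e.count p + 1 = m then 1 else 0)
        + (e.signedStep σ m ε₁ (t + 1) wake p v).credit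
          (max wake (e.signedStep σ m ε₁ (t + 1) wake p v).lastSuccess) r
      ≤ e.credit wake r + 2 * (progress σ ε₁ E v₀ (e.signedStep σ m ε₁ (t + 1) wake p v)
          - progress σ ε₁ E v₀ e) := by
  have hne := fun (hr : r ≠ p) => e.signedStep_of_ne σ m ε₁ (t + 1) wake v hr
  have hpr := progress_signedStep hσ m hε (t + 1) wake E v₀ e hp v
  have ho := e.outcome σ m ε₁ (t + 1) wake p v
  set e' := e.signedStep σ m ε₁ (t + 1) wake p v
  have h5 := he.time_le r
  have h6 := he.lastSuccess_le
  rcases eq_or_ne r p with rfl | hr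
  · rcases ho with ⟨hl, hv', hs', hl', hc', ha', ht'⟩ | ⟨hl, hc, hv', hs', hl', hc', ha', ht'⟩ |
      ⟨hl, hc, hs, hv', hs', hl', hc', ha', ht'⟩ | ⟨hl, hc, hs, hv', hs', hl', hc', ha', ht'⟩
    · have : progress σ ε₁ E v₀ e' = progress σ ε₁ E v₀ e := by simp only [progress, hv']
      simp only [credit, hs', hl', ht', max_eq_left hw, hl, this]
      simp
    · have : progress σ ε₁ E v₀ e' = progress σ ε₁ E v₀ e := by simp only [progress, hv']
      simp only [credit, hs', hl', ht', max_eq_left hw, hl, this, hc]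
      simp
    · rcases hpr with ⟨-, h, -⟩ | ⟨-, h⟩
      · omega
      · have h1 : e'.credit (max wake e'.lastSuccess) r ≤ 1 := by
          unfold credit
          rw [hs', ht', if_neg (lt_irrefl _)]
          split_ifs <;> norm_num
        have h2 : 1 ≤ e.credit wake r := by
          unfold credit
          rw [if_pos (Or.inl hl)]
          split_ifs <;> norm_num
        rw [if_pos ⟨rfl, hl, hc⟩]
        linarith
    · have : progress σ ε₁ E v₀ e' = progress σ ε₁ E v₀ e := by simp only [progress, hv']
      have h1 : ¬ t + 1 < e.lastSuccess := by omega
      have h2 : ¬ t + 1 < wake := by omega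
      simp only [credit, hs', hl', ht', max_eq_left hw, hl, this, hc, h1, h2]
      simp only [and_self, if_true, if_false, true_or, or_false]
      split_ifs <;> norm_num
  · obtain ⟨h1, h2, h3, h4, h7⟩ := hne hr
    rw [if_neg fun h => hr h.1]
    rcases hpr with ⟨h, h', h''⟩ | ⟨h, h'⟩
    · simp only [credit, h4, h', h7, h'', max_eq_left hw]
      simp
    · have h8 : e'.credit (max wake e'.lastSuccess) r ≤ 2 := by
        unfold credit
        split_ifs <;> norm_num
      linarith [e.credit_nonneg wake r]

end Estimator

/-! ### Monitoring the batches of samples -/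

/-- Bookkeeping for the batches of samples that an estimator collects, relative to a test function:
`base r` is the test function at the time of the first sample of the current batch of the pair `r`,
`dev r` is the sum of the deviations of its values at the samples from its mean, `bad` counts the
batches with a large deviation, `att r` counts the attempted updates of `r`, and `visits r` counts
the visits of `r` at which its estimate was inconsistent. -/
structure Monitor (S A : Type*) where
  base : S × A → S → ℝ
  dev : S × A → ℝ
  bad : ℕ
  att : S × A → ℕ
  visits : S × A → ℕ

namespace Monitor

variable {S A : Type*}

/-- The initial bookkeeping with test function `g`. -/
def start (g : S → ℝ) : Monitor S A where
  base := fun _ => g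
  dev := fun _ => 0
  bad := 0
  att := fun _ => 0
  visits := fun _ => 0

/-- The test function for the current batch of `r`, if the current test function is `g`. -/
noncomputable def curBase (e : Estimator S A) (g : S → ℝ) (r : S × A) (μ : Monitor S A) : S → ℝ :=
  if e.count r = 0 then g else μ.base r

/-- The deviation of the current batch of `r`. -/
noncomputable def curDev (e : Estimator S A) (r : S × A) (μ : Monitor S A) : ℝ :=
  if e.count r = 0 then 0 else μ.dev r

variable [Fintype S] (M : MDP S A)

/-- The deviation of the current batch of `p` after a further sample `s'`. -/
noncomputable def nextDev (e : Estimator S A) (g : S → ℝ) (p : S × A) (s' : S)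
    (μ : Monitor S A) : ℝ :=
  μ.curDev e p + (μ.curBase e g p s' - (M.trans p.1 p.2).avg (μ.curBase e g p))

open scoped Classical in
/-- The bookkeeping when the pair `p` is played and leads to `s'`. -/
noncomputable def step (m : ℕ) (ε₁ σ : ℝ) (e : Estimator S A) (g : S → ℝ) (p : S × A) (s' : S)
    (μ : Monitor S A) : Monitor S A where
  base := if e.learn p then Function.update μ.base p (μ.curBase e g p) else μ.base
  dev := if e.learn p then Function.update μ.dev p (μ.nextDev M e g p s') else μ.dev
  bad := if e.learn p ∧ e.count p + 1 = m ∧ m * ε₁ ≤ μ.nextDev M e g p s' then μ.bad + 1 else μ.bad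
  att := if e.learn p ∧ e.count p + 1 = m then Function.update μ.att p (μ.att p + 1) else μ.att
  visits := if 3 * ε₁ ≤ e.gap M σ p then Function.update μ.visits p (μ.visits p + 1) else μ.visits

variable {M} {m : ℕ} {ε₁ σ : ℝ} {e : Estimator S A} {g : S → ℝ} {p r : S × A} {s' : S}
  {μ : Monitor S A}

theorem step_of_ne (h : r ≠ p) :
    (μ.step M m ε₁ σ e g p s').base r = μ.base r ∧ (μ.step M m ε₁ σ e g p s').dev r = μ.dev r ∧
    (μ.step M m ε₁ σ e g p s').att r = μ.att r ∧
    (μ.step M m ε₁ σ e g p s').visits r = μ.visits r := by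
  classical
  unfold step
  refine ⟨?_, ?_, ?_, ?_⟩ <;> dsimp only <;> split_ifs <;> simp [Function.update_of_ne h]

theorem bad_le_step : μ.bad ≤ (μ.step M m ε₁ σ e g p s').bad := by
  unfold step
  dsimp only
  split_ifs <;> omega

open scoped Classical in
theorem step_att (r : S × A) : (μ.step M m ε₁ σ e g p s').att r
    = (if r = p ∧ e.learn p ∧ e.count p + 1 = m then 1 else 0) + μ.att r := by
  unfold step
  dsimp only
  by_cases h : e.learn p ∧ e.count p + 1 = m
  · rw [if_pos h]
    rcases eq_or_ne r p with rfl | hr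
    · simp [h, add_comm]
    · simp [hr]
  · rw [if_neg h, if_neg fun h' => h h'.2, zero_add]

theorem step_base_mem {a b : ℝ} (hμ : ∀ r s, a ≤ μ.base r s ∧ μ.base r s ≤ b)
    (hg : ∀ s, a ≤ g s ∧ g s ≤ b) (r : S × A) (s : S) :
    a ≤ (μ.step M m ε₁ σ e g p s').base r s ∧ (μ.step M m ε₁ σ e g p s').base r s ≤ b := by
  classical
  unfold step curBase
  dsimp only
  rcases eq_or_ne r p with rfl | hr
  · split_ifs <;> simp [hμ, hg]
  · split_ifs <;> simp [Function.update_of_ne hr, hμ]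

/-! ### The deviation of the batches -/

/-- The exponential weight of the current batch of `r`. -/
noncomputable def weight (m : ℕ) (ε₁ : ℝ) (e : Estimator S A) (r : S × A) (μ : Monitor S A) : ℝ :=
  Real.exp (-(2 * m * ε₁ ^ 2) + (4 * ε₁ * μ.curDev e r - e.count r * (2 * ε₁ ^ 2)))

/-- The potential whose expectation does not increase. -/
noncomputable def potential (m : ℕ) (ε₁ : ℝ) (E : Finset (S × A)) (e : Estimator S A)
    (μ : Monitor S A) : ℝ :=
  μ.bad + ∑ r ∈ E, (μ.weight m ε₁ e r - Real.exp (-(2 * m * ε₁ ^ 2)) * μ.att r)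

/-- Hoeffding's lemma at parameter 4ε₁, where l²/8 = 2ε₁² is exactly the compensation per sample in
the weight. -/
theorem avg_exp_nextDev_le {a : ℝ} (hμ : ∀ r s, a ≤ μ.base r s ∧ μ.base r s ≤ a + 1)
    (hg : ∀ s, a ≤ g s ∧ g s ≤ a + 1) (p : S × A) :
    (M.trans p.1 p.2).avg (fun s' => Real.exp (-(2 * m * ε₁ ^ 2)
        + (4 * ε₁ * μ.nextDev M e g p s' - (e.count p + 1) * (2 * ε₁ ^ 2))))
      ≤ μ.weight m ε₁ e p := by
  have hb : ∀ s, a ≤ μ.curBase e g p s ∧ μ.curBase e g p s ≤ a + 1 := by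
    intro s
    unfold curBase
    split_ifs
    · exact hg s
    · exact hμ p s
  have h1 := (M.trans p.1 p.2).avg_exp_le hb (4 * ε₁)
  have h2 : ∀ s', Real.exp (-(2 * m * ε₁ ^ 2)
        + (4 * ε₁ * μ.nextDev M e g p s' - (e.count p + 1) * (2 * ε₁ ^ 2)))
      = μ.weight m ε₁ e p * Real.exp (-(2 * ε₁ ^ 2)) * Real.exp (4 * ε₁ *
        (μ.curBase e g p s' - (M.trans p.1 p.2).avg (μ.curBase e g p))) := by
    intro s'
    rw [weight, ← Real.exp_add, ← Real.exp_add, nextDev]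
    ring_nf
  simp only [h2, PMF.avg_const_mul]
  have h3 : 0 < μ.weight m ε₁ e p := Real.exp_pos _
  calc _ ≤ μ.weight m ε₁ e p * Real.exp (-(2 * ε₁ ^ 2)) * Real.exp ((4 * ε₁) ^ 2 / 8) :=
        mul_le_mul_of_nonneg_left h1 (by positivity)
    _ = μ.weight m ε₁ e p := by
        rw [mul_assoc, ← Real.exp_add]
        ring_nf
        simp

/-- An empty batch has weight q = exp(-2mε₁²). The weight is a supermartingale within a batch and
has grown to at least 1 if the batch turns out bad, so it pays for the increase of `bad`. The weight
q of the next batch is paid for by the term in `att`. -/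
theorem avg_potential_step_le {a : ℝ} (hε : 0 < ε₁)
    (hμ : ∀ r s, a ≤ μ.base r s ∧ μ.base r s ≤ a + 1) (hg : ∀ s, a ≤ g s ∧ g s ≤ a + 1)
    {E : Finset (S × A)} {p : S × A} (hp : p ∈ E) (e' : S → Estimator S A)
    (he' : ∀ s', ∃ τ t wake v, e' s' = e.signedStep τ m ε₁ t wake p v) :
    (M.trans p.1 p.2).avg (fun s' => (μ.step M m ε₁ σ e g p s').potential m ε₁ E (e' s'))
      ≤ μ.potential m ε₁ E e := by
  classical
  set q := Real.exp (-(2 * m * ε₁ ^ 2)) with hq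
  have hw0 : 0 < μ.weight m ε₁ e p := Real.exp_pos _
  have hne : ∀ s', ∀ r ∈ E.erase p,
      (μ.step M m ε₁ σ e g p s').weight m ε₁ (e' s') r - q * (μ.step M m ε₁ σ e g p s').att r
        = μ.weight m ε₁ e r - q * μ.att r := by
    intro s' r hr
    have hr := Finset.ne_of_mem_erase hr
    obtain ⟨τ, t, wake, v, h⟩ := he' s'
    obtain ⟨-, -, h1, -⟩ := e.signedStep_of_ne τ m ε₁ t wake v hr
    obtain ⟨-, h2, h3, -⟩ := step_of_ne (M := M) (m := m) (ε₁ := ε₁) (σ := σ) (e := e) (g := g)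
      (s' := s') (μ := μ) hr
    rw [h]
    simp only [weight, curDev, h1, h2, h3]
  have hpot : ∀ s', (μ.step M m ε₁ σ e g p s').potential m ε₁ E (e' s')
      = μ.potential m ε₁ E e + (((μ.step M m ε₁ σ e g p s').bad - μ.bad
        + (μ.step M m ε₁ σ e g p s').weight m ε₁ (e' s') p
        - q * ((μ.step M m ε₁ σ e g p s').att p - μ.att p)) - μ.weight m ε₁ e p) := by
    intro s'
    unfold potential
    rw [← Finset.add_sum_erase E _ hp, ← Finset.add_sum_erase E _ hp,
      Finset.sum_congr rfl (hne s')]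
    ring
  simp only [hpot]
  rw [PMF.avg_add, PMF.avg_const, PMF.avg_sub, PMF.avg_const]
  suffices h : (M.trans p.1 p.2).avg (fun s' => ((μ.step M m ε₁ σ e g p s').bad - μ.bad
      + (μ.step M m ε₁ σ e g p s').weight m ε₁ (e' s') p
      - q * ((μ.step M m ε₁ σ e g p s').att p - μ.att p))) ≤ μ.weight m ε₁ e p by linarith
  by_cases hl : e.learn p
  · refine le_trans (PMF.avg_mono _ fun s' _ => ?_)
      (avg_exp_nextDev_le (M := M) (m := m) (ε₁ := ε₁) hμ hg p)
    obtain ⟨τ, t, wake, v, h⟩ := he' s'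
    have ho := e.outcome τ m ε₁ t wake p v
    rw [← h] at ho
    by_cases hc : e.count p + 1 = m
    · have hc0 : (e' s').count p = 0 := by
        rcases ho with ⟨hl', -⟩ | ⟨-, hc', -⟩ | ⟨-, -, -, -, -, -, hc', -⟩ |
          ⟨-, -, -, -, -, -, hc', -⟩
        · exact (hl' hl).elim
        · exact (hc' hc).elim
        · exact hc'
        · exact hc'
      have hcR : (e.count p : ℝ) + 1 = m := by exact_mod_cast hc
      have h1 : (μ.step M m ε₁ σ e g p s').weight m ε₁ (e' s') p = q := by
        simp [weight, curDev, hc0, hq]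
      have h2 : ((μ.step M m ε₁ σ e g p s').att p : ℝ) - μ.att p = 1 := by
        rw [step_att, if_pos ⟨rfl, hl, hc⟩]
        push_cast
        ring
      rw [h1, h2, hcR]
      by_cases hd : m * ε₁ ≤ μ.nextDev M e g p s'
      · have h3 : ((μ.step M m ε₁ σ e g p s').bad : ℝ) = μ.bad + 1 := by
          have : (μ.step M m ε₁ σ e g p s').bad = μ.bad + 1 := by
            unfold step
            exact if_pos ⟨hl, hc, hd⟩
          rw [this]
          push_cast
          rfl
        rw [h3]
        -- At the threshold deviation mε₁ the three terms of the exponent cancel.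
        have h4 : 0 ≤ -(2 * m * ε₁ ^ 2)
            + (4 * ε₁ * μ.nextDev M e g p s' - m * (2 * ε₁ ^ 2)) := by
          nlinarith
        linarith [Real.one_le_exp h4]
      · have h3 : (μ.step M m ε₁ σ e g p s').bad = μ.bad := by
          unfold step
          exact if_neg fun h => hd h.2.2
        rw [h3]
        have := Real.exp_pos (-(2 * m * ε₁ ^ 2)
            + (4 * ε₁ * μ.nextDev M e g p s' - m * (2 * ε₁ ^ 2)))
        linarith
    · have hc1 : (e' s').count p = e.count p + 1 := by
        rcases ho with ⟨hl', -⟩ | ⟨-, -, -, -, -, hc', -⟩ | ⟨-, hc', -⟩ | ⟨-, hc', -⟩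
        · exact (hl' hl).elim
        · exact hc'
        · exact (hc hc').elim
        · exact (hc hc').elim
      have h1 : (μ.step M m ε₁ σ e g p s').bad = μ.bad := by
        unfold step
        exact if_neg fun h => hc h.2.1
      have h2 : (μ.step M m ε₁ σ e g p s').att = μ.att := by
        unfold step
        exact if_neg fun h => hc h.2
      have h3 : (μ.step M m ε₁ σ e g p s').dev p = μ.nextDev M e g p s' := by
        simp [step, hl]
      rw [h1, h2, weight, curDev, hc1, if_neg (Nat.succ_ne_zero _), h3]
      push_cast
      linarith
  · refine PMF.avg_le _ fun s' _ => ?_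
    obtain ⟨τ, t, wake, v, h⟩ := he' s'
    have ho := e.outcome τ m ε₁ t wake p v
    rw [← h] at ho
    have hc1 : (e' s').count p = e.count p := by
      rcases ho with ⟨-, -, -, -, hc', -⟩ | ⟨hl', -⟩ | ⟨hl', -⟩ | ⟨hl', -⟩
      · exact hc'
      all_goals exact (hl hl').elim
    have h1 : (μ.step M m ε₁ σ e g p s').bad = μ.bad := by
      unfold step
      exact if_neg fun h => hl h.1
    have h2 : (μ.step M m ε₁ σ e g p s').att = μ.att := by
      unfold step
      exact if_neg fun h => hl h.1
    have h3 : (μ.step M m ε₁ σ e g p s').dev p = μ.dev p := by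
      simp [step, hl]
    rw [h1, h2, weight, curDev, hc1, h3]
    simp [weight, curDev]

omit [Fintype S] in
theorem potential_start (g : S → ℝ) (E : Finset (S × A)) (v : S × A → ℝ) :
    (Monitor.start g).potential m ε₁ E (Estimator.start v)
      = E.card * Real.exp (-(2 * m * ε₁ ^ 2)) := by
  simp [potential, weight, curDev, Monitor.start, Estimator.start]

end Monitor

/-! ### The invariants of an estimator without bad batches -/

namespace Monitor

variable {S A : Type*} [Fintype S]

/-- The signed estimates of the states. -/
noncomputable def signedVal (M : MDP S A) (σ : ℝ) (e : Estimator S A) (s : S) : ℝ :=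
  σ * e.stateVal M s

theorem gap_eq (M : MDP S A) (σ : ℝ) (e : Estimator S A) (r : S × A) :
    e.gap M σ r = σ * e.val r - (M.trans r.1 r.2).avg (signedVal M σ e) := by
  unfold Estimator.gap signedVal
  rw [PMF.avg_const_mul, mul_sub]

open scoped Classical in
/-- The number of visits of `r` with an inconsistent estimate that have not yet been accounted for by
successful updates. -/
noncomputable def pending (M : MDP S A) (m : ℕ) (ε₁ σ : ℝ) (e : Estimator S A) (μ : Monitor S A)
    (r : S × A) : ℝ :=
  if 3 * ε₁ ≤ e.gap M σ r ∧ e.learn r then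
    if e.count r = 0 then m else
      (if 3 * ε₁ ≤ σ * e.val r - (M.trans r.1 r.2).avg (μ.base r) then (m : ℝ) else 0)
        + e.count r
  else 0

/-- The relation between the samples of the current batch of `r`, the flag, and the visits of `r`
with an inconsistent estimate. -/
structure GapInv (M : MDP S A) (m : ℕ) (ε₁ σ : ℝ) (v₀ : S × A → ℝ) (e : Estimator S A)
    (μ : Monitor S A) (r : S × A) : Prop where
  le_base : e.count r ≠ 0 → ∀ s, signedVal M σ e s ≤ μ.base r s
  accum_le : e.count r ≠ 0 →
    σ * e.accum r ≤ μ.dev r + e.count r * (M.trans r.1 r.2).avg (μ.base r)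
  base_eq : e.count r ≠ 0 → e.lastSuccess ≤ e.time r → μ.base r = signedVal M σ e
  gap_lt : ¬ e.learn r → e.lastSuccess ≤ e.time r → e.gap M σ r < 3 * ε₁
  visits_le : (μ.visits r : ℝ) ≤ (2 * m + 1) * (σ * (v₀ r - e.val r) / ε₁)
    + μ.pending M m ε₁ σ e r

variable {M : MDP S A} {m : ℕ} {ε₁ σ : ℝ} {v₀ : S × A → ℝ} {e e' : Estimator S A} {g : S → ℝ}
  {p r : S × A} {s' : S} {μ μ' : Monitor S A}

theorem pending_nonneg : 0 ≤ μ.pending M m ε₁ σ e r := by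
  unfold pending
  split_ifs <;> positivity

theorem pending_le (hc : e.count r < m) : μ.pending M m ε₁ σ e r ≤ 2 * m := by
  have h : (e.count r : ℝ) ≤ m := by exact_mod_cast hc.le
  have h0 : (0 : ℝ) ≤ m := m.cast_nonneg
  unfold pending
  split_ifs <;> linarith

theorem GapInv.start {v : S × A → ℝ} (g : S → ℝ) :
    GapInv M m ε₁ σ v (Estimator.start v) (Monitor.start g) r := by
  refine ⟨fun h => (h rfl).elim, fun h => (h rfl).elim, fun h => (h rfl).elim,
    fun h => (h trivial).elim, ?_⟩
  have : (0 : ℝ) ≤ (Monitor.start g : Monitor S A).pending M m ε₁ σ (Estimator.start v) r :=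
    pending_nonneg
  simpa [Monitor.start, Estimator.start] using this

/-- The invariant is preserved when a different pair is played. -/
theorem GapInv.of_ne (h : GapInv M m ε₁ σ v₀ e μ r) {t : ℕ} (he : e.Sound m t)
    (hval : e'.val r = e.val r) (haccum : e'.accum r = e.accum r)
    (hcount : e'.count r = e.count r) (htime : e'.time r = e.time r)
    (hlearn : e'.learn r ↔ e.learn r) (hbase : μ'.base r = μ.base r) (hdev : μ'.dev r = μ.dev r)
    (hvisits : μ'.visits r = μ.visits r)
    (hsucc : (e'.val = e.val ∧ e'.lastSuccess = e.lastSuccess) ∨ e'.lastSuccess = t + 1)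
    (hmono : ∀ s, signedVal M σ e' s ≤ signedVal M σ e s) :
    GapInv M m ε₁ σ v₀ e' μ' r := by
  -- The signed estimates of the successors only decrease, so an inconsistent pair remains
  -- inconsistent until its own estimate changes.
  have hgap : e.gap M σ r ≤ e'.gap M σ r := by
    rw [gap_eq, gap_eq, hval]
    have : (M.trans r.1 r.2).avg (signedVal M σ e') ≤ (M.trans r.1 r.2).avg (signedVal M σ e) :=
      PMF.avg_mono _ fun s _ => hmono s
    linarith
  have hp : μ.pending M m ε₁ σ e r ≤ μ'.pending M m ε₁ σ e' r := by
    by_cases hg : 3 * ε₁ ≤ e.gap M σ r ∧ e.learn r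
    · have hg' : 3 * ε₁ ≤ e'.gap M σ r ∧ e'.learn r := ⟨hg.1.trans hgap, hlearn.mpr hg.2⟩
      simp only [pending, hg, hg', hcount, hval, hbase]
      exact le_rfl
    · rw [pending, if_neg hg]
      exact pending_nonneg
  have ht := he.time_le r
  refine ⟨fun hc s => ?_, fun hc => ?_, fun hc hl => ?_, fun hl hs => ?_, ?_⟩
  · rw [hbase]
    exact (hmono s).trans (h.le_base (hcount ▸ hc) s)
  · rw [hbase, hdev, haccum, hcount]
    exact h.accum_le (hcount ▸ hc)
  · rcases hsucc with ⟨h1, h2⟩ | h1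
    · rw [hbase, h.base_eq (hcount ▸ hc) (by rwa [← h2, ← htime])]
      funext s
      simp only [signedVal, Estimator.stateVal_congr h1]
    · omega
  · rcases hsucc with ⟨h1, h2⟩ | h1
    · have := h.gap_lt (fun h => hl (hlearn.mpr h)) (by rwa [← h2, ← htime])
      rw [Estimator.gap] at this ⊢
      rwa [h1, Estimator.stateVal_congr h1]
    · omega
  · rw [hvisits, hval]
    linarith [h.visits_le]

/-- At a failed attempt, the estimate was consistent with the test function of the batch. -/
theorem GapInv.lt_of_fail (h : GapInv M m ε₁ σ v₀ e μ r) {t : ℕ}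
    (hm : 0 < m) (he : e.Sound m t) (hc : e.count r + 1 = m)
    (hfail : ¬ 2 * ε₁ ≤ σ * (e.val r - (e.accum r + e.stateVal M s') / m))
    (hd : ¬ m * ε₁ ≤ μ.nextDev M e (signedVal M σ e) r s') :
    σ * e.val r - (M.trans r.1 r.2).avg (μ.curBase e (signedVal M σ e) r) < 3 * ε₁ := by
  have hm' : (0 : ℝ) < m := by exact_mod_cast hm
  have hcR : (e.count r : ℝ) + 1 = m := by exact_mod_cast hc
  set b := (M.trans r.1 r.2).avg (μ.curBase e (signedVal M σ e) r) with hb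
  have h1 : σ * e.accum r ≤ μ.curDev e r + e.count r * b := by
    by_cases h0 : e.count r = 0
    · have h2 := he.accum_mem r
      rw [h0, Nat.cast_zero] at h2
      have h3 : e.accum r = 0 := le_antisymm h2.2 h2.1
      simp [curDev, h0, h3]
    · rw [hb, curBase, curDev, if_neg h0, if_neg h0]
      exact h.accum_le h0
  have h2 : σ * e.stateVal M s' ≤ μ.curBase e (signedVal M σ e) r s' := by
    unfold curBase
    split_ifs with h0
    · exact le_rfl
    · exact h.le_base h0 s'
  have h3 : σ * ((e.accum r + e.stateVal M s') / m) < ε₁ + b := by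
    rw [mul_div_assoc', div_lt_iff₀ hm']
    rw [nextDev, ← hb, not_le] at hd
    have h4 : (m : ℝ) * b = e.count r * b + b := by rw [← hcR]; ring
    linarith
  linarith

/-- Since there is no bad batch, a batch whose frozen test function was already inconsistent with
the estimate cannot fail. So after a pair has become inconsistent, at most one batch, begun before,
fails, and the next one succeeds. This is the source of the 2m pending visits. -/
theorem GapInv.step_self (h : GapInv M m ε₁ σ v₀ e μ r) (hσ : σ = 1 ∨ σ = -1) {t wake : ℕ}
    (hm : 0 < m) (hε : 0 < ε₁) (he : e.Sound m t) (hw : e.lastSuccess ≤ wake)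
    (hbad : (μ.step M m ε₁ σ e (signedVal M σ e) r s').bad = 0) :
    GapInv M m ε₁ σ v₀ (e.signedStep σ m ε₁ (t + 1) wake r (e.stateVal M s'))
      (μ.step M m ε₁ σ e (signedVal M σ e) r s') r := by
  have ho := e.outcome σ m ε₁ (t + 1) wake r (e.stateVal M s')
  set e' := e.signedStep σ m ε₁ (t + 1) wake r (e.stateVal M s')
  set μ' := μ.step M m ε₁ σ e (signedVal M σ e) r s' with hμ'
  have hv0 : 3 * ε₁ ≤ e.gap M σ r → (μ'.visits r : ℝ) = μ.visits r + 1 := by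
    intro hg
    simp [hμ', step, hg]
  have hv1 : ¬ 3 * ε₁ ≤ e.gap M σ r → (μ'.visits r : ℝ) = μ.visits r := by
    intro hg
    simp [hμ', step, hg]
  have hvis : (μ'.visits r : ℝ) ≤ μ.visits r + 1 := by
    by_cases hg : 3 * ε₁ ≤ e.gap M σ r
    · exact (hv0 hg).le
    · rw [hv1 hg]; linarith
  have hsv : e'.val = e.val → signedVal M σ e' = signedVal M σ e := fun hv => by
    funext s
    simp only [signedVal, Estimator.stateVal_congr hv]
  have hgap : e'.val = e.val → e'.gap M σ r = e.gap M σ r := fun hv => by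
    rw [gap_eq, gap_eq, hsv hv, hv]
  have hmR : (1 : ℝ) ≤ m := by exact_mod_cast hm
  have hP := h.visits_le
  rcases ho with ⟨hl, hv', hs', hl', hc', ha', ht'⟩ | ⟨hl, hc, hv', hs', hl', hc', ha', ht'⟩ |
    ⟨hl, hc, hs, hv', hs', hl', hc', ha', ht'⟩ | ⟨hl, hc, hs, hv', hs', hl', hc', ha', ht'⟩
  · have hc0 : e.count r = 0 := by
      by_contra hne
      exact hl (he.learn_of_count r hne)
    refine ⟨fun hne => (hne (hc'.trans hc0)).elim, fun hne => (hne (hc'.trans hc0)).elim,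
      fun hne => (hne (hc'.trans hc0)).elim, fun hl2 hs2 => ?_, ?_⟩
    · rw [hgap hv']
      exact h.gap_lt hl (by rwa [← hs', ← ht'])
    · rw [hv']
      have hp0 : μ.pending M m ε₁ σ e r = 0 := if_neg fun h => hl h.2
      by_cases hg : 3 * ε₁ ≤ e.gap M σ r
      -- With the flag off, an inconsistent pair must have missed a success since its last attempt.
      -- So this visit switches the flag on, and its cost 1 is covered by the allowance m of an
      -- empty batch.
      · have hlt : e.time r < wake := by
          by_contra hge
          exact absurd (h.gap_lt hl (by omega)) (not_lt.mpr hg)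
        have hp1 : μ'.pending M m ε₁ σ e' r = m := by
          rw [pending, if_pos ⟨by rwa [hgap hv'], hl'.mpr hlt⟩, if_pos (hc'.trans hc0)]
        linarith
      · rw [hv1 hg]
        linarith [pending_nonneg (M := M) (m := m) (ε₁ := ε₁) (σ := σ) (e := e') (r := r)
          (μ := μ')]
  · have hb : μ'.base r = μ.curBase e (signedVal M σ e) r := by simp [hμ', step, hl]
    have hd : μ'.dev r = μ.nextDev M e (signedVal M σ e) r s' := by simp [hμ', step, hl]
    have hle : ∀ s, signedVal M σ e s ≤ μ.curBase e (signedVal M σ e) r s := by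
      intro s
      unfold curBase
      split_ifs with h0
      · exact le_rfl
      · exact h.le_base h0 s
    refine ⟨fun _ s => ?_, fun _ => ?_, fun _ hs2 => ?_, fun hl2 => (hl2 hl').elim, ?_⟩
    · rw [hb, hsv hv']
      exact hle s
    · have h2 : σ * e.stateVal M s' ≤ μ.curBase e (signedVal M σ e) r s' := hle s'
      have h1 : σ * e.accum r ≤ μ.curDev e r
          + e.count r * (M.trans r.1 r.2).avg (μ.curBase e (signedVal M σ e) r) := by
        by_cases h0 : e.count r = 0
        · have h2 := he.accum_mem r
          rw [h0, Nat.cast_zero] at h2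
          have h3 : e.accum r = 0 := le_antisymm h2.2 h2.1
          simp [curDev, h0, h3]
        · rw [curBase, curDev, if_neg h0, if_neg h0]
          exact h.accum_le h0
      rw [hb, hd, ha', hc', nextDev]
      push_cast
      linarith
    · rw [hb, hsv hv', curBase]
      split_ifs with h0
      · rfl
      · exact h.base_eq h0 (by rwa [← hs', ← ht'])
    · rw [hv']
      by_cases hg : 3 * ε₁ ≤ e.gap M σ r
      · rw [hv0 hg]
        -- A first sample freezes a test function that is inconsistent as well, so the allowance m
        -- of the empty batch is retained and the sample is added to it.
        have hp : μ.pending M m ε₁ σ e r + 1 ≤ μ'.pending M m ε₁ σ e' r := by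
          have hg' : 3 * ε₁ ≤ e'.gap M σ r ∧ e'.learn r := ⟨by rwa [hgap hv'], hl'⟩
          have hp' : μ'.pending M m ε₁ σ e' r
              = (if 3 * ε₁ ≤ σ * e.val r - (M.trans r.1 r.2).avg (μ.curBase e (signedVal M σ e) r)
                then (m : ℝ) else 0) + (e.count r + 1 : ℕ) := by
            rw [pending, if_pos hg', hc', if_neg (Nat.succ_ne_zero _), hb, hv']
          rw [pending, if_pos ⟨hg, hl⟩, hp', curBase]
          by_cases h0 : e.count r = 0
          · rw [if_pos h0, if_pos h0, ← gap_eq, if_pos hg, h0]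
            simp
          · rw [if_neg h0, if_neg h0]
            push_cast
            linarith
        linarith
      · rw [hv1 hg]
        have hp0 : μ.pending M m ε₁ σ e r = 0 := if_neg fun h => hg h.1
        linarith [pending_nonneg (M := M) (m := m) (ε₁ := ε₁) (σ := σ) (e := e') (r := r)
          (μ := μ')]
  · refine ⟨fun hne => (hne hc').elim, fun hne => (hne hc').elim, fun hne => (hne hc').elim,
      fun hl2 => (hl2 hl').elim, ?_⟩
    -- The unit of progress pays 2m + 1 visits: at most 2m pending ones and the present one.
    have hp := pending_le (M := M) (ε₁ := ε₁) (σ := σ) (μ := μ) (he.count_lt r)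
    have hp' := pending_nonneg (M := M) (m := m) (ε₁ := ε₁) (σ := σ) (e := e') (r := r) (μ := μ')
    have h1 : σ * (v₀ r - e.val r) / ε₁ + 1 ≤ σ * (v₀ r - e'.val r) / ε₁ := by
      rw [div_add_one hε.ne', div_le_div_iff_of_pos_right hε, hv']
      rcases hσ with rfl | rfl <;> linarith
    have h2 := mul_le_mul_of_nonneg_left h1 (show (0 : ℝ) ≤ 2 * m + 1 by positivity)
    linarith
  · have hd : ¬ m * ε₁ ≤ μ.nextDev M e (signedVal M σ e) r s' := by
      intro hd
      have : μ'.bad = μ.bad + 1 := if_pos ⟨hl, hc, hd⟩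
      omega
    have hlt := h.lt_of_fail hm he hc hs hd
    have hls : e.lastSuccess ≤ e.time r → e.gap M σ r < 3 * ε₁ := by
      intro hle
      rw [gap_eq]
      convert hlt using 3
      unfold curBase
      split_ifs with h0
      · rfl
      · exact (h.base_eq h0 hle).symm
    refine ⟨fun hne => (hne hc').elim, fun hne => (hne hc').elim, fun hne => (hne hc').elim,
      fun hl2 _ => ?_, ?_⟩
    · rw [hgap hv']
      exact hls (not_lt.mp fun h => hl2 (hl'.mpr h))
    · rw [hv']
      by_cases hg : 3 * ε₁ ≤ e.gap M σ r
      -- A failure at an inconsistent pair means that the test function of the batch was outdated.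
      -- The flag stays on, and the visits of this batch, now m, become the allowance of the next
      -- one.
      · have hlt2 : e.time r < e.lastSuccess :=
          not_le.mp fun hle => absurd (hls hle) (not_lt.mpr hg)
        have hp1 : μ'.pending M m ε₁ σ e' r = m := by
          rw [pending, if_pos ⟨by rwa [hgap hv'], hl'.mpr hlt2⟩, if_pos hc']
        have h0 : e.count r ≠ 0 := by
          intro h0
          rw [curBase, if_pos h0, ← gap_eq] at hlt
          linarith
        rw [curBase, if_neg h0] at hlt
        have hp2 : μ.pending M m ε₁ σ e r = e.count r := by
          rw [pending, if_pos ⟨hg, hl⟩, if_neg h0, if_neg (not_le.mpr hlt), zero_add]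
        have hcR : (e.count r : ℝ) + 1 = m := by exact_mod_cast hc
        rw [hv0 hg]
        linarith
      · rw [hv1 hg]
        have hp0 : μ.pending M m ε₁ σ e r = 0 := if_neg fun h => hg h.1
        linarith [pending_nonneg (M := M) (m := m) (ε₁ := ε₁) (σ := σ) (e := e') (r := r)
          (μ := μ')]

theorem GapInv.step (h : GapInv M m ε₁ σ v₀ e μ r) (hσ : σ = 1 ∨ σ = -1) {t wake : ℕ}
    (hm : 0 < m) (hε : 0 < ε₁) (he : e.Sound m t) (hw : e.lastSuccess ≤ wake)
    (hbad : (μ.step M m ε₁ σ e (signedVal M σ e) p s').bad = 0) :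
    GapInv M m ε₁ σ v₀ (e.signedStep σ m ε₁ (t + 1) wake p (e.stateVal M s'))
      (μ.step M m ε₁ σ e (signedVal M σ e) p s') r := by
  rcases eq_or_ne r p with rfl | hr
  · exact h.step_self hσ hm hε he hw hbad
  · obtain ⟨h1, h2, h3, h4, h5⟩ :=
      e.signedStep_of_ne σ m ε₁ (t + 1) wake (e.stateVal M s') hr
    obtain ⟨h6, h7, -, h8⟩ := step_of_ne (M := M) (m := m) (ε₁ := ε₁) (σ := σ) (e := e)
      (g := signedVal M σ e) (s' := s') (μ := μ) hr
    refine h.of_ne he h1 h2 h3 h4 h5 h6 h7 h8 ?_ ?_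
    · exact (e.signedStep_val hσ m ε₁ (t + 1) wake p _).imp_right fun h => h.2
    · exact Estimator.mul_stateVal_le hσ (e.signedStep_val_le hσ m hε (t + 1) wake p _)

/-! ### Correctness of the upper bounds -/

/-- The upper bound of `r` and the samples of its current batch are consistent with the optimal
reachability probabilities. -/
structure CorrectInv (M : MDP S A) (e : Estimator S A) (μ : Monitor S A) (r : S × A) :
    Prop where
  le_val : (M.trans r.1 r.2).avg M.optLim ≤ e.val r
  base_eq : e.count r ≠ 0 → μ.base r = fun s => -M.optLim s
  le_accum : e.count r ≠ 0 →
    e.count r * (M.trans r.1 r.2).avg M.optLim - μ.dev r ≤ e.accum r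

/-- Each sample U(s') is at least `optLim s'`, and without a bad batch the average of the latter
over a batch is less than ε₁ below its mean. The summand ε₁ in a successful update compensates for
this. -/
theorem CorrectInv.step (h : CorrectInv M e μ r) {t wake : ℕ}
    (hm : 0 < m) (he : e.Sound m t) (hv : M.optLim s' ≤ e.stateVal M s')
    (hbad : (μ.step M m ε₁ σ e (fun s => -M.optLim s) p s').bad = 0) :
    CorrectInv M (e.signedStep 1 m ε₁ (t + 1) wake p (e.stateVal M s'))
      (μ.step M m ε₁ σ e (fun s => -M.optLim s) p s') r := by
  rcases eq_or_ne r p with rfl | hr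
  · have ho := e.outcome 1 m ε₁ (t + 1) wake r (e.stateVal M s')
    set e' := e.signedStep 1 m ε₁ (t + 1) wake r (e.stateVal M s')
    set μ' := μ.step M m ε₁ σ e (fun s => -M.optLim s) r s' with hμ'
    have hbase : μ.curBase e (fun s => -M.optLim s) r = fun s => -M.optLim s := by
      unfold curBase
      split_ifs with h0
      · rfl
      · exact h.base_eq h0
    have hnext : μ.nextDev M e (fun s => -M.optLim s) r s'
        = μ.curDev e r + (-M.optLim s' + (M.trans r.1 r.2).avg M.optLim) := by
      rw [nextDev, hbase, PMF.avg_neg, sub_neg_eq_add]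
    have h1 : e.count r * (M.trans r.1 r.2).avg M.optLim - μ.curDev e r ≤ e.accum r := by
      by_cases h0 : e.count r = 0
      · simpa [h0, curDev] using (he.accum_mem r).1
      · rw [curDev, if_neg h0]
        exact h.le_accum h0
    rcases ho with ⟨hl, hv', hs', hl', hc', ha', ht'⟩ | ⟨hl, hc, hv', hs', hl', hc', ha', ht'⟩ |
      ⟨hl, hc, hs, hv', hs', hl', hc', ha', ht'⟩ | ⟨hl, hc, hs, hv', hs', hl', hc', ha', ht'⟩
    · have hc0 : e.count r = 0 := by
        by_contra hne
        exact hl (he.learn_of_count r hne)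
      exact ⟨by rw [hv']; exact h.le_val, fun hne => (hne (hc'.trans hc0)).elim,
        fun hne => (hne (hc'.trans hc0)).elim⟩
    · refine ⟨by rw [hv']; exact h.le_val, fun _ => ?_, fun _ => ?_⟩
      · simp [hμ', Monitor.step, hl, hbase]
      · have hd : μ'.dev r = μ.nextDev M e (fun s => -M.optLim s) r s' := by
          simp [hμ', Monitor.step, hl]
        rw [hd, hnext, ha', hc']
        push_cast
        linarith
    · refine ⟨?_, fun hne => (hne hc').elim, fun hne => (hne hc').elim⟩
      have hd : ¬ m * ε₁ ≤ μ.nextDev M e (fun s => -M.optLim s) r s' := by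
        intro hd
        have : μ'.bad = μ.bad + 1 := if_pos ⟨hl, hc, hd⟩
        omega
      have hm' : (0 : ℝ) < m := by exact_mod_cast hm
      have hcR : (e.count r : ℝ) + 1 = m := by exact_mod_cast hc
      rw [hv', one_mul, ← sub_le_iff_le_add, le_div_iff₀ hm']
      rw [hnext, not_le] at hd
      have h4 : (m : ℝ) * (M.trans r.1 r.2).avg M.optLim
          = e.count r * (M.trans r.1 r.2).avg M.optLim + (M.trans r.1 r.2).avg M.optLim := by
        rw [← hcR]
        ring
      linarith
    · exact ⟨by rw [hv']; exact h.le_val, fun hne => (hne hc').elim, fun hne => (hne hc').elim⟩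
  · obtain ⟨h1, h2, h3, h4, h5⟩ :=
      e.signedStep_of_ne 1 m ε₁ (t + 1) wake (e.stateVal M s') hr
    obtain ⟨h6, h7, -, h8⟩ := step_of_ne (M := M) (m := m) (ε₁ := ε₁) (σ := σ) (e := e)
      (g := fun s => -M.optLim s) (s' := s') (μ := μ) hr
    exact ⟨by rw [h1]; exact h.le_val, fun hc => by rw [h6]; exact h.base_eq (h3 ▸ hc),
      fun hc => by rw [h3, h7, h2]; exact h.le_accum (h3 ▸ hc)⟩

end Monitor

/-! ### Histories of delayed Q-learning -/

namespace Tables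

variable {S A : Type*} (M : MDP S A) (m : ℕ) (ε₁ : ℝ) (c : Tables S A) (s : S) (a : A) (s' : S)

theorem observe_upper : (c.observe M m ε₁ s a s').upper
    = c.upper.signedStep 1 m ε₁ (c.clock + 1) c.upper.lastSuccess (s, a)
      (c.upper.stateVal M s') := by
  simp [observe, Estimator.signedStep]

theorem observe_lower : (c.observe M m ε₁ s a s').lower
    = c.lower.signedStep (-1) m ε₁ (c.clock + 1)
      (max c.lower.lastSuccess (c.observe M m ε₁ s a s').upper.lastSuccess) (s, a)
      (c.lower.stateVal M s') := by
  simp [observe, Estimator.signedStep, sub_eq_add_neg]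

end Tables

namespace MDP

variable {S A : Type*} [Fintype S] [Fintype A] (M : MDP S A)

open scoped Classical in
/-- The pairs of a state and an action that is enabled in it. -/
noncomputable def enabledPairs : Finset (S × A) :=
  Finset.univ.filter fun r => r.2 ∈ M.enabled r.1

variable {M}

theorem mem_enabledPairs {r : S × A} : r ∈ M.enabledPairs ↔ r.2 ∈ M.enabled r.1 := by
  simp [enabledPairs]

/-- Together with |S| ≥ 2 this provides a factor 2 of slack against |S||A|, which the prescribed
number of samples needs. -/
theorem card_enabledPairs_le : M.enabledPairs.card ≤ Fintype.card A := by
  refine Finset.card_le_card_of_injOn Prod.snd (fun _ _ => Finset.mem_univ _) ?_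
  rintro ⟨s, a⟩ hs ⟨s', a'⟩ hs' (rfl : a = a')
  rw [M.enabled_disjoint s s' a (mem_enabledPairs.mp hs) (mem_enabledPairs.mp hs')]

end MDP

namespace DQL

variable {S A : Type*} (M : MDP S A) (m : ℕ) (ε₁ : ℝ)

open scoped Classical in
theorem run_snoc (h : List (Move S A)) (x : Move S A) : run M m ε₁ (h ++ [x])
    = ((run M m ε₁ h).1.observe M m ε₁ (run M m ε₁ h).2 x.act x.dest,
      if x.dest = M.sink ∨ x.dest = M.target then M.init else x.dest) := by
  rw [run, List.foldl_append, List.foldl_cons, List.foldl_nil]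
  rfl

/-- The conditional distribution of the next move of delayed Q-learning. -/
noncomputable def next (h : List (Move S A)) : PMF (Move S A) :=
  M.stepLaw (run M m ε₁ h).2 ((run M m ε₁ h).1.greedy M (run M m ε₁ h).2)

theorem law_eq [Countable S] [Countable A] : law M m ε₁ = processLaw (next M m ε₁) := rfl

theorem act_mem_enabled {h : List (Move S A)} {x : Move S A}
    (hx : x ∈ (next M m ε₁ h).support) : x.act ∈ M.enabled (run M m ε₁ h).2 := by
  rw [next, MDP.stepLaw, PMF.mem_support_bind_iff] at hx
  obtain ⟨a, ha, hx⟩ := hx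
  rw [PMF.mem_support_map_iff] at hx
  obtain ⟨s', -, rfl⟩ := hx
  exact Tables.mem_enabled_of_mem_support_greedy M _ _ a ha

theorem upperStart_mem (r : S × A) :
    0 ≤ (Tables.start M).upper.val r ∧ (Tables.start M).upper.val r ≤ 1 := by
  classical
  simp only [Tables.start, Estimator.start]
  split_ifs <;> norm_num

theorem lowerStart_mem (r : S × A) :
    0 ≤ (Tables.start M).lower.val r ∧ (Tables.start M).lower.val r ≤ 1 := by
  classical
  simp only [Tables.start, Estimator.start]
  split_ifs <;> norm_num

variable {m ε₁} (hm : 0 < m) (hε : 0 < ε₁)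

include hm hε

theorem sound_run (h : List (Move S A)) :
    (run M m ε₁ h).1.upper.Sound m h.length ∧ (run M m ε₁ h).1.lower.Sound m h.length ∧
      (run M m ε₁ h).1.clock = h.length := by
  induction h using List.reverseRecOn with
  | nil => exact ⟨.start hm (upperStart_mem M), .start hm (lowerStart_mem M), rfl⟩
  | append_singleton h x ih =>
    obtain ⟨h1, h2, h3⟩ := ih
    rw [run_snoc, List.length_append, List.length_singleton]
    refine ⟨?_, ?_, congrArg (· + 1) h3⟩
    · rw [Tables.observe_upper, h3]
      exact h1.signedStep (Or.inl rfl) hm hε _ _ (h1.stateVal_mem _)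
    · rw [Tables.observe_lower, h3]
      exact h2.signedStep (Or.inr rfl) hm hε _ _ (h2.stateVal_mem _)

omit hm in
theorem upper_val_snoc_le (h : List (Move S A)) (x : Move S A) (r : S × A) :
    (run M m ε₁ (h ++ [x])).1.upper.val r ≤ (run M m ε₁ h).1.upper.val r := by
  rw [run_snoc, Tables.observe_upper]
  simpa using Estimator.signedStep_val_le (Or.inl rfl) m hε _ _ _ _ _ r

omit hm in
theorem le_lower_val_snoc (h : List (Move S A)) (x : Move S A) (r : S × A) :
    (run M m ε₁ h).1.lower.val r ≤ (run M m ε₁ (h ++ [x])).1.lower.val r := by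
  rw [run_snoc, Tables.observe_lower]
  simpa using Estimator.signedStep_val_le (Or.inr rfl) m hε _ _ _ _ _ r

theorem valBounds_run (h : List (Move S A)) : Tables.ValBounds M (run M m ε₁ h).1 := by
  obtain ⟨h1, h2, -⟩ := sound_run M hm hε h
  refine ⟨h1.val_mem, h2.val_mem, fun a => le_antisymm ?_ (h1.val_mem _).1,
    fun a => le_antisymm (h2.val_mem _).2 ?_⟩
  · clear h1 h2
    induction h using List.reverseRecOn with
    | nil => simp [run, Tables.start, Estimator.start]
    | append_singleton h x ih => exact (upper_val_snoc_le M hε h x _).trans ih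
  · clear h1 h2
    induction h using List.reverseRecOn with
    | nil => simp [run, Tables.start, Estimator.start]
    | append_singleton h x ih => exact ih.trans (le_lower_val_snoc M hε h x _)

omit hm hε

variable [Fintype S]

variable (m ε₁) in
/-- The bookkeeping for the estimator `sel` and the test function `g` along a history. -/
noncomputable def monitor (σ : ℝ) (sel : Tables S A → Estimator S A) (g : Tables S A → S → ℝ) :
    List (Move S A) → Monitor S A :=
  histFold (fun h μ x => μ.step M m ε₁ σ (sel (run M m ε₁ h).1) (g (run M m ε₁ h).1)
    ((run M m ε₁ h).2, x.act) x.dest) (Monitor.start (g (Tables.start M)))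

section monitor

variable {σ : ℝ} {sel : Tables S A → Estimator S A} {g : Tables S A → S → ℝ}

theorem monitor_nil : monitor M m ε₁ σ sel g [] = Monitor.start (g (Tables.start M)) := rfl

theorem monitor_snoc (h : List (Move S A)) (x : Move S A) :
    monitor M m ε₁ σ sel g (h ++ [x]) = (monitor M m ε₁ σ sel g h).step M m ε₁ σ
      (sel (run M m ε₁ h).1) (g (run M m ε₁ h).1) ((run M m ε₁ h).2, x.act) x.dest :=
  histFold_snoc _ _ _ _

theorem bad_le_snoc (h : List (Move S A)) (x : Move S A) :
    (monitor M m ε₁ σ sel g h).bad ≤ (monitor M m ε₁ σ sel g (h ++ [x])).bad := by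
  rw [monitor_snoc]
  exact Monitor.bad_le_step

theorem monotone_bad (ω : ℕ → Move S A) :
    Monotone fun n => (monitor M m ε₁ σ sel g (firstMoves ω n)).bad :=
  monotone_nat_of_le_succ fun n => by
    rw [firstMoves_succ]
    exact bad_le_snoc M _ _

variable [Fintype A]

/-- The union bound over all batches, in supermartingale form: one weight q for each initial batch
and one for each attempt. Test functions with values in an interval of length one are what
Hoeffding's lemma requires. -/
theorem expect_bad_le (hε : 0 < ε₁) {v : S × A → ℝ}
    (hstart : sel (Tables.start M) = Estimator.start v)
    (hsel : ∀ c s a s', ∃ τ t wake v, sel (Tables.observe M m ε₁ c s a s')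
      = (sel c).signedStep τ m ε₁ t wake (s, a) v)
    {b : ℝ} (hg : ∀ h s, b ≤ g (run M m ε₁ h).1 s ∧ g (run M m ε₁ h).1 s ≤ b + 1)
    {K : ℝ} (hK : ∀ h, Reachable (next M m ε₁) h →
      ∑ r ∈ M.enabledPairs, ((monitor M m ε₁ σ sel g h).att r : ℝ) ≤ K) (n : ℕ) :
    expect (next M m ε₁) n (fun h => ((monitor M m ε₁ σ sel g h).bad : ℝ)) []
      ≤ Real.exp (-(2 * m * ε₁ ^ 2)) * (M.enabledPairs.card + K) := by
  have hbase : ∀ h r s, b ≤ (monitor M m ε₁ σ sel g h).base r s ∧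
      (monitor M m ε₁ σ sel g h).base r s ≤ b + 1 := by
    intro h
    induction h using List.reverseRecOn with
    | nil => exact fun r s => hg [] s
    | append_singleton h x ih =>
      rw [monitor_snoc]
      exact Monitor.step_base_mem ih (hg h)
  have hsuper : ∀ h, (next M m ε₁ h).avg (fun x =>
      (monitor M m ε₁ σ sel g (h ++ [x])).potential m ε₁ M.enabledPairs
        (sel (run M m ε₁ (h ++ [x])).1))
      ≤ (monitor M m ε₁ σ sel g h).potential m ε₁ M.enabledPairs (sel (run M m ε₁ h).1) := by
    intro h
    rw [next, MDP.avg_stepLaw]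
    refine PMF.avg_le _ fun a ha => ?_
    simp only [monitor_snoc, run_snoc]
    exact Monitor.avg_potential_step_le hε (hbase h) (hg h) (p := ((run M m ε₁ h).2, a))
      (MDP.mem_enabledPairs.mpr (Tables.mem_enabled_of_mem_support_greedy M _ _ a ha)) _
      fun s' => hsel _ _ _ _
  have h1 := expect_le_of_supermartingale (next M m ε₁) (F := fun h =>
    (monitor M m ε₁ σ sel g h).potential m ε₁ M.enabledPairs (sel (run M m ε₁ h).1)) hsuper n []
  rw [monitor_nil, show (run M m ε₁ ([] : List (Move S A))).1 = Tables.start M from rfl, hstart,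
    Monitor.potential_start] at h1
  have h2 : expect (next M m ε₁) n (fun h => ((monitor M m ε₁ σ sel g h).bad : ℝ)) []
      ≤ expect (next M m ε₁) n (fun h => (monitor M m ε₁ σ sel g h).potential m ε₁ M.enabledPairs
        (sel (run M m ε₁ h).1) - -(Real.exp (-(2 * m * ε₁ ^ 2)) * K)) [] := by
    refine expect_mono_of_reachable _ (fun h hh => ?_) n .nil
    have h3 : 0 ≤ ∑ r ∈ M.enabledPairs,
        (monitor M m ε₁ σ sel g h).weight m ε₁ (sel (run M m ε₁ h).1) r :=
      Finset.sum_nonneg fun r _ => (Real.exp_pos _).le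
    have h4 := mul_le_mul_of_nonneg_left (hK h hh) (Real.exp_pos (-(2 * m * ε₁ ^ 2))).le
    rw [Monitor.potential, Finset.sum_sub_distrib, ← Finset.mul_sum]
    linarith
  rw [expect_sub, expect_const] at h2
  linarith

/-- Markov's inequality at each time; since the count never decreases, the bound passes to the union
over all times. -/
theorem real_exists_bad_le {B : ℝ} (hB : ∀ n, expect (next M m ε₁) n
      (fun h => ((monitor M m ε₁ σ sel g h).bad : ℝ)) [] ≤ B) :
    (law M m ε₁).real {ω | ∃ n, (monitor M m ε₁ σ sel g (firstMoves ω n)).bad ≠ 0} ≤ B := by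
  classical
  have hU : {ω | ∃ n, (monitor M m ε₁ σ sel g (firstMoves ω n)).bad ≠ 0}
      = ⋃ n, {ω | (monitor M m ε₁ σ sel g (firstMoves ω n)).bad ≠ 0} := by
    ext ω
    simp
  have hmono : Monotone fun n => {ω | (monitor M m ε₁ σ sel g (firstMoves ω n)).bad ≠ 0} :=
    fun n k hnk ω hω => by
      have := monotone_bad M (σ := σ) (sel := sel) (g := g) (m := m) (ε₁ := ε₁) ω hnk
      simp only [Set.mem_ofPred_eq] at hω ⊢
      dsimp only at this
      omega
  rw [law_eq, hU]
  refine le_of_tendsto' ((ENNReal.tendsto_toReal (measure_ne_top _ _)).comp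
    (tendsto_measure_iUnion_atTop hmono)) fun n => ?_
  refine le_trans (le_of_eq (real_firstMoves (next M m ε₁)
    (fun h => (monitor M m ε₁ σ sel g h).bad ≠ 0) n)) (le_trans (expect_mono _ (fun h => ?_) n [])
    (hB n))
  split_ifs with h0
  · exact_mod_cast Nat.one_le_iff_ne_zero.mpr h0
  · positivity

end monitor

end DQL

/-! ### Bounds for attempted updates and inconsistent visits -/

namespace DQL

variable {S A : Type*} [Fintype S] [Fintype A] (M : MDP S A) {m : ℕ} {ε₁ : ℝ}

/-- The total decrease of the upper bounds, in multiples of `ε₁`. -/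
noncomputable def upperProgress (m : ℕ) (ε₁ : ℝ) (h : List (Move S A)) : ℝ :=
  (run M m ε₁ h).1.upper.progress 1 ε₁ M.enabledPairs (Tables.start M).upper.val

/-- The total increase of the lower bounds, in multiples of `ε₁`. -/
noncomputable def lowerProgress (m : ℕ) (ε₁ : ℝ) (h : List (Move S A)) : ℝ :=
  (run M m ε₁ h).1.lower.progress (-1) ε₁ M.enabledPairs (Tables.start M).lower.val

theorem progress_le (hm : 0 < m) (hε : 0 < ε₁) (h : List (Move S A)) :
    upperProgress M m ε₁ h ≤ M.enabledPairs.card / ε₁ ∧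
      lowerProgress M m ε₁ h ≤ M.enabledPairs.card / ε₁ := by
  obtain ⟨h1, h2, -⟩ := sound_run M hm hε h
  exact ⟨h1.progress_le (Or.inl rfl) hε _ (upperStart_mem M),
    h2.progress_le (Or.inr rfl) hε _ (lowerStart_mem M)⟩

theorem upperProgress_snoc (hε : 0 < ε₁) {h : List (Move S A)} {x : Move S A}
    (hx : x.act ∈ M.enabled (run M m ε₁ h).2) :
    ((run M m ε₁ (h ++ [x])).1.upper.val = (run M m ε₁ h).1.upper.val ∧
      (run M m ε₁ (h ++ [x])).1.upper.lastSuccess = (run M m ε₁ h).1.upper.lastSuccess ∧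
      upperProgress M m ε₁ (h ++ [x]) = upperProgress M m ε₁ h) ∨
    ((run M m ε₁ (h ++ [x])).1.upper.lastSuccess = (run M m ε₁ h).1.clock + 1 ∧
      upperProgress M m ε₁ h + 1 ≤ upperProgress M m ε₁ (h ++ [x])) := by
  unfold upperProgress
  rw [run_snoc, Tables.observe_upper]
  exact Estimator.progress_signedStep (Or.inl rfl) m hε _ _ _ _ _
    (MDP.mem_enabledPairs.mpr hx) _

theorem lowerProgress_snoc (hε : 0 < ε₁) {h : List (Move S A)} {x : Move S A}
    (hx : x.act ∈ M.enabled (run M m ε₁ h).2) :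
    ((run M m ε₁ (h ++ [x])).1.lower.val = (run M m ε₁ h).1.lower.val ∧
      (run M m ε₁ (h ++ [x])).1.lower.lastSuccess = (run M m ε₁ h).1.lower.lastSuccess ∧
      lowerProgress M m ε₁ (h ++ [x]) = lowerProgress M m ε₁ h) ∨
    ((run M m ε₁ (h ++ [x])).1.lower.lastSuccess = (run M m ε₁ h).1.clock + 1 ∧
      lowerProgress M m ε₁ h + 1 ≤ lowerProgress M m ε₁ (h ++ [x])) := by
  unfold lowerProgress
  rw [run_snoc, Tables.observe_lower]
  exact Estimator.progress_signedStep (Or.inr rfl) m hε _ _ _ _ _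
    (MDP.mem_enabledPairs.mpr hx) _

theorem upper_att_le (hm : 0 < m) (hε : 0 < ε₁) {σ : ℝ} {g : Tables S A → S → ℝ}
    {h : List (Move S A)} (hh : Reachable (next M m ε₁) h) (r : S × A) :
    (monitor M m ε₁ σ Tables.upper g h).att r
        + (run M m ε₁ h).1.upper.credit (run M m ε₁ h).1.upper.lastSuccess r
      ≤ 1 + 2 * upperProgress M m ε₁ h := by
  classical
  induction hh with
  | nil =>
    simp [monitor_nil, Monitor.start, run, Tables.start, Estimator.start, Estimator.credit,
      upperProgress, Estimator.progress]
  | @snoc h x _ hx ih =>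
    have hx := act_mem_enabled M m ε₁ hx
    obtain ⟨h1, -, h3⟩ := sound_run M hm hε h
    have hmax : max (run M m ε₁ h).1.upper.lastSuccess
          (run M m ε₁ (h ++ [x])).1.upper.lastSuccess
        = (run M m ε₁ (h ++ [x])).1.upper.lastSuccess := by
      have := h1.lastSuccess_le
      rcases upperProgress_snoc M hε hx with ⟨-, h4, -⟩ | ⟨h4, -⟩ <;> omega
    have h5 := Estimator.credit_signedStep (Or.inl rfl) hε h1 le_rfl
      (h1.lastSuccess_le.trans (Nat.le_succ _)) M.enabledPairs (Tables.start M).upper.val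
      (MDP.mem_enabledPairs (r := ((run M m ε₁ h).2, x.act)).mpr hx)
      ((run M m ε₁ h).1.upper.stateVal M x.dest) r
    rw [← h3, ← Tables.observe_upper M m ε₁ (run M m ε₁ h).1 (run M m ε₁ h).2 x.act x.dest] at h5
    rw [run_snoc] at hmax
    rw [hmax] at h5
    rw [monitor_snoc, Monitor.step_att, upperProgress, run_snoc]
    unfold upperProgress at ih
    push_cast
    linarith

theorem lower_att_le (hm : 0 < m) (hε : 0 < ε₁) {σ : ℝ} {g : Tables S A → S → ℝ}
    {h : List (Move S A)} (hh : Reachable (next M m ε₁) h) (r : S × A) :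
    (monitor M m ε₁ σ Tables.lower g h).att r
        + (run M m ε₁ h).1.lower.credit (max (run M m ε₁ h).1.lower.lastSuccess
          (run M m ε₁ h).1.upper.lastSuccess) r
      ≤ 1 + 2 * lowerProgress M m ε₁ h + upperProgress M m ε₁ h := by
  classical
  induction hh with
  | nil =>
    simp [monitor_nil, Monitor.start, run, Tables.start, Estimator.start, Estimator.credit,
      upperProgress, lowerProgress, Estimator.progress]
  | @snoc h x _ hx ih =>
    have hx := act_mem_enabled M m ε₁ hx
    obtain ⟨h1, h2, h3⟩ := sound_run M hm hε h
    have hls : (run M m ε₁ h).1.lower.lastSuccess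
        ≤ (run M m ε₁ (h ++ [x])).1.lower.lastSuccess := by
      have := h2.lastSuccess_le
      rcases lowerProgress_snoc M hε hx with ⟨-, h4, -⟩ | ⟨h4, -⟩ <;> omega
    have hmax : max (max (run M m ε₁ h).1.lower.lastSuccess
          (run M m ε₁ (h ++ [x])).1.upper.lastSuccess)
          (run M m ε₁ (h ++ [x])).1.lower.lastSuccess
        = max (run M m ε₁ (h ++ [x])).1.lower.lastSuccess
          (run M m ε₁ (h ++ [x])).1.upper.lastSuccess := by omega
    have hul : (run M m ε₁ (h ++ [x])).1.upper.lastSuccess ≤ h.length + 1 := by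
      have := (sound_run M hm hε (h ++ [x])).1.lastSuccess_le
      simpa using this
    -- A success of the upper bound can wake this pair once more; its progress pays the one
    -- additional attempt.
    have hcr : (run M m ε₁ h).1.lower.credit (max (run M m ε₁ h).1.lower.lastSuccess
          (run M m ε₁ (h ++ [x])).1.upper.lastSuccess) r
        ≤ (run M m ε₁ h).1.lower.credit (max (run M m ε₁ h).1.lower.lastSuccess
          (run M m ε₁ h).1.upper.lastSuccess) r
          + (upperProgress M m ε₁ (h ++ [x]) - upperProgress M m ε₁ h) := by
      rcases upperProgress_snoc M hε hx with ⟨-, h4, h5⟩ | ⟨-, h5⟩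
      · rw [h4, h5]
        linarith
      · have := Estimator.credit_le_add_one (run M m ε₁ h).1.lower
          (max (run M m ε₁ h).1.lower.lastSuccess (run M m ε₁ h).1.upper.lastSuccess)
          (max (run M m ε₁ h).1.lower.lastSuccess
            (run M m ε₁ (h ++ [x])).1.upper.lastSuccess) r
        linarith
    have h5 := Estimator.credit_signedStep (Or.inr rfl) hε h2
      (le_max_left _ (run M m ε₁ (h ++ [x])).1.upper.lastSuccess)
      (max_le (h2.lastSuccess_le.trans (Nat.le_succ _)) hul) M.enabledPairs
      (Tables.start M).lower.val
      (MDP.mem_enabledPairs (r := ((run M m ε₁ h).2, x.act)).mpr hx)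
      ((run M m ε₁ h).1.lower.stateVal M x.dest) r
    rw [run_snoc] at hmax
    rw [← h3, run_snoc,
      ← Tables.observe_lower M m ε₁ (run M m ε₁ h).1 (run M m ε₁ h).2 x.act x.dest, hmax] at h5
    rw [run_snoc] at hcr
    rw [monitor_snoc, Monitor.step_att, lowerProgress, run_snoc]
    unfold lowerProgress at ih
    push_cast
    linarith

theorem sum_upper_att_le (hm : 0 < m) (hε : 0 < ε₁) {σ : ℝ} {g : Tables S A → S → ℝ}
    {h : List (Move S A)} (hh : Reachable (next M m ε₁) h) :
    ∑ r ∈ M.enabledPairs, ((monitor M m ε₁ σ Tables.upper g h).att r : ℝ)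
      ≤ M.enabledPairs.card * (1 + 3 * (M.enabledPairs.card / ε₁)) := by
  refine (Finset.sum_le_card_nsmul _ _ _ fun r _ => ?_).trans_eq (nsmul_eq_mul _ _)
  have h1 := upper_att_le M hm hε (σ := σ) (g := g) hh r
  have h2 := Estimator.credit_nonneg (run M m ε₁ h).1.upper (run M m ε₁ h).1.upper.lastSuccess r
  have h3 := (progress_le M hm hε h).1
  have h4 : 0 ≤ M.enabledPairs.card / ε₁ := by positivity
  linarith

theorem sum_lower_att_le (hm : 0 < m) (hε : 0 < ε₁) {σ : ℝ} {g : Tables S A → S → ℝ}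
    {h : List (Move S A)} (hh : Reachable (next M m ε₁) h) :
    ∑ r ∈ M.enabledPairs, ((monitor M m ε₁ σ Tables.lower g h).att r : ℝ)
      ≤ M.enabledPairs.card * (1 + 3 * (M.enabledPairs.card / ε₁)) := by
  refine (Finset.sum_le_card_nsmul _ _ _ fun r _ => ?_).trans_eq (nsmul_eq_mul _ _)
  have h1 := lower_att_le M hm hε (σ := σ) (g := g) hh r
  have h2 := Estimator.credit_nonneg (run M m ε₁ h).1.lower
    (max (run M m ε₁ h).1.lower.lastSuccess (run M m ε₁ h).1.upper.lastSuccess) r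
  have h3 := progress_le M hm hε h
  linarith [h3.1, h3.2]

/-! ### The three monitors -/

variable (m ε₁)

/-- The monitor for the consistency of the upper bounds. -/
noncomputable def upperMonitor : List (Move S A) → Monitor S A :=
  monitor M m ε₁ 1 Tables.upper fun c => Monitor.signedVal M 1 c.upper

/-- The monitor for the consistency of the lower bounds. -/
noncomputable def lowerMonitor : List (Move S A) → Monitor S A :=
  monitor M m ε₁ (-1) Tables.lower fun c => Monitor.signedVal M (-1) c.lower

/-- The monitor for the correctness of the upper bounds. -/
noncomputable def valueMonitor : List (Move S A) → Monitor S A :=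
  monitor M m ε₁ 1 Tables.upper fun _ s => -M.optLim s

variable {m ε₁}

omit [Fintype A] in
theorem upper_gapInv (hm : 0 < m) (hε : 0 < ε₁) {h : List (Move S A)}
    (hb : (upperMonitor M m ε₁ h).bad = 0) (r : S × A) :
    Monitor.GapInv M m ε₁ 1 (Tables.start M).upper.val (run M m ε₁ h).1.upper
      (upperMonitor M m ε₁ h) r := by
  induction h using List.reverseRecOn with
  | nil => exact Monitor.GapInv.start _
  | append_singleton h x ih =>
    have hb' : (upperMonitor M m ε₁ h).bad = 0 :=
      Nat.le_zero.mp ((bad_le_snoc M h x).trans_eq hb)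
    obtain ⟨h1, -, h3⟩ := sound_run M hm hε h
    unfold upperMonitor at hb ih hb' ⊢
    rw [monitor_snoc] at hb ⊢
    rw [run_snoc, Tables.observe_upper, h3]
    exact (ih hb').step (Or.inl rfl) hm hε h1 le_rfl hb

omit [Fintype A] in
theorem lower_gapInv (hm : 0 < m) (hε : 0 < ε₁) {h : List (Move S A)}
    (hb : (lowerMonitor M m ε₁ h).bad = 0) (r : S × A) :
    Monitor.GapInv M m ε₁ (-1) (Tables.start M).lower.val (run M m ε₁ h).1.lower
      (lowerMonitor M m ε₁ h) r := by
  induction h using List.reverseRecOn with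
  | nil => exact Monitor.GapInv.start _
  | append_singleton h x ih =>
    have hb' : (lowerMonitor M m ε₁ h).bad = 0 :=
      Nat.le_zero.mp ((bad_le_snoc M h x).trans_eq hb)
    obtain ⟨-, h1, h3⟩ := sound_run M hm hε h
    unfold lowerMonitor at hb ih hb' ⊢
    rw [monitor_snoc] at hb ⊢
    rw [run_snoc, Tables.observe_lower, h3]
    exact (ih hb').step (Or.inr rfl) hm hε h1 (le_max_left _ _) hb

-- All enabled pairs are treated in one induction: correctness of one pair uses that the sampled
-- U(s') dominates `optLim s'`, hence the correctness of the pairs of s'. At the sink the initial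
-- value 0 is correct because `optLim` vanishes there.
omit [Fintype A] in
theorem correctInv (hm : 0 < m) (hε : 0 < ε₁) {h : List (Move S A)}
    (hb : (valueMonitor M m ε₁ h).bad = 0) {r : S × A} (hr : r.2 ∈ M.enabled r.1) :
    Monitor.CorrectInv M (run M m ε₁ h).1.upper (valueMonitor M m ε₁ h) r := by
  induction h using List.reverseRecOn generalizing r with
  | nil =>
    refine ⟨?_, fun hc => (hc rfl).elim, fun hc => (hc rfl).elim⟩
    by_cases hs : r.1 = M.sink
    · rw [hs] at hr ⊢
      rw [M.avg_trans_sink hr, M.optLim_sink]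
      exact (upperStart_mem M r).1
    · have : (run M m ε₁ ([] : List (Move S A))).1.upper.val r = 1 := by
        simp [run, Tables.start, Estimator.start, hs]
      rw [this]
      exact PMF.avg_le _ fun x _ => M.optLim_le_one x
  | append_singleton h x ih =>
    have hb' : (valueMonitor M m ε₁ h).bad = 0 :=
      Nat.le_zero.mp ((bad_le_snoc M h x).trans_eq hb)
    obtain ⟨h1, -, h3⟩ := sound_run M hm hε h
    have hu : Tables.UpperCorrect M (run M m ε₁ h).1 := fun s a ha => (ih hb' (r := (s, a)) ha).le_val
    have ih := ih hb' hr
    unfold valueMonitor at hb ih ⊢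
    rw [monitor_snoc] at hb ⊢
    rw [run_snoc, Tables.observe_upper, h3]
    exact ih.step hm h1 (hu.optLim_le x.dest) hb

omit [Fintype A] in
theorem upperCorrect_run (hm : 0 < m) (hε : 0 < ε₁) {h : List (Move S A)}
    (hb : (valueMonitor M m ε₁ h).bad = 0) : Tables.UpperCorrect M (run M m ε₁ h).1 :=
  fun s a ha => (correctInv M hm hε hb (r := (s, a)) ha).le_val

/-! ### The number of escapes -/

/-- The move `x` escapes after the history `h`. -/
def EscapesAt (m : ℕ) (ε₁ : ℝ) (h : List (Move S A)) (x : Move S A) : Prop :=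
  Tables.Escapes M m ε₁ (run M m ε₁ h).1 (run M m ε₁ h).2 x.act x.dest

open scoped Classical in
/-- The number of escapes in a history. -/
noncomputable def escapeCount (m : ℕ) (ε₁ : ℝ) : List (Move S A) → ℕ :=
  histFold (fun h n x => if EscapesAt M m ε₁ h x then n + 1 else n) 0

omit [Fintype A] in
theorem escapeCount_nil : escapeCount M m ε₁ [] = 0 := rfl

omit [Fintype A] in
open scoped Classical in
theorem escapeCount_snoc (h : List (Move S A)) (x : Move S A) :
    escapeCount M m ε₁ (h ++ [x])
      = if EscapesAt M m ε₁ h x then escapeCount M m ε₁ h + 1 else escapeCount M m ε₁ h :=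
  histFold_snoc _ _ _ _

omit [Fintype A] in
theorem sum_visits_step {E : Finset (S × A)} {p : S × A} (hp : p ∈ E) (σ : ℝ) (e : Estimator S A)
    (g : S → ℝ) (s' : S) (μ : Monitor S A) :
    (∑ r ∈ E, μ.visits r ≤ ∑ r ∈ E, (μ.step M m ε₁ σ e g p s').visits r) ∧
    (3 * ε₁ ≤ e.gap M σ p →
      ∑ r ∈ E, μ.visits r + 1 ≤ ∑ r ∈ E, (μ.step M m ε₁ σ e g p s').visits r) := by
  classical
  unfold Monitor.step
  dsimp only
  by_cases hg : 3 * ε₁ ≤ e.gap M σ p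
  · rw [if_pos hg, Finset.sum_update_of_mem hp, ← Finset.erase_eq,
      ← Finset.add_sum_erase E μ.visits hp]
    omega
  · rw [if_neg hg]
    exact ⟨le_rfl, fun h => (hg h).elim⟩

/-- Each escape is a visit of an inconsistent pair for one of the two bounds or a change of an
estimate, and so it raises one of the four summands, none of which ever decreases. -/
theorem escapeCount_le_sum (hε : 0 < ε₁) {h : List (Move S A)}
    (hh : Reachable (next M m ε₁) h) :
    (escapeCount M m ε₁ h : ℝ) ≤ ((∑ r ∈ M.enabledPairs, (upperMonitor M m ε₁ h).visits r : ℕ)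
      + (∑ r ∈ M.enabledPairs, (lowerMonitor M m ε₁ h).visits r : ℕ)
      + upperProgress M m ε₁ h + lowerProgress M m ε₁ h : ℝ) := by
  classical
  induction hh with
  | nil =>
    simp [escapeCount_nil, upperMonitor, lowerMonitor, monitor_nil, Monitor.start, upperProgress,
      lowerProgress, Estimator.progress, run, Tables.start, Estimator.start]
  | @snoc h x _ hx ih =>
    have hx := act_mem_enabled M m ε₁ hx
    have hp := MDP.mem_enabledPairs (r := ((run M m ε₁ h).2, x.act)).mpr hx
    have hu : (∑ r ∈ M.enabledPairs, (upperMonitor M m ε₁ h).visits r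
          ≤ ∑ r ∈ M.enabledPairs, (upperMonitor M m ε₁ (h ++ [x])).visits r) ∧
        (3 * ε₁ ≤ (run M m ε₁ h).1.upper.gap M 1 ((run M m ε₁ h).2, x.act) →
          ∑ r ∈ M.enabledPairs, (upperMonitor M m ε₁ h).visits r + 1
            ≤ ∑ r ∈ M.enabledPairs, (upperMonitor M m ε₁ (h ++ [x])).visits r) := by
      unfold upperMonitor
      rw [monitor_snoc]
      exact sum_visits_step M hp _ _ _ _ _
    have hl : (∑ r ∈ M.enabledPairs, (lowerMonitor M m ε₁ h).visits r
          ≤ ∑ r ∈ M.enabledPairs, (lowerMonitor M m ε₁ (h ++ [x])).visits r) ∧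
        (3 * ε₁ ≤ (run M m ε₁ h).1.lower.gap M (-1) ((run M m ε₁ h).2, x.act) →
          ∑ r ∈ M.enabledPairs, (lowerMonitor M m ε₁ h).visits r + 1
            ≤ ∑ r ∈ M.enabledPairs, (lowerMonitor M m ε₁ (h ++ [x])).visits r) := by
      unfold lowerMonitor
      rw [monitor_snoc]
      exact sum_visits_step M hp _ _ _ _ _
    have hup := upperProgress_snoc M hε hx
    have hlp := lowerProgress_snoc M hε hx
    have hup' : upperProgress M m ε₁ h ≤ upperProgress M m ε₁ (h ++ [x]) := by
      rcases hup with ⟨-, -, h⟩ | ⟨-, h⟩ <;> linarith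
    have hlp' : lowerProgress M m ε₁ h ≤ lowerProgress M m ε₁ (h ++ [x]) := by
      rcases hlp with ⟨-, -, h⟩ | ⟨-, h⟩ <;> linarith
    have hu1 : ((∑ r ∈ M.enabledPairs, (upperMonitor M m ε₁ h).visits r : ℕ) : ℝ)
        ≤ (∑ r ∈ M.enabledPairs, (upperMonitor M m ε₁ (h ++ [x])).visits r : ℕ) := by
      exact_mod_cast hu.1
    have hl1 : ((∑ r ∈ M.enabledPairs, (lowerMonitor M m ε₁ h).visits r : ℕ) : ℝ)
        ≤ (∑ r ∈ M.enabledPairs, (lowerMonitor M m ε₁ (h ++ [x])).visits r : ℕ) := by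
      exact_mod_cast hl.1
    rw [escapeCount_snoc]
    split_ifs with he
    · rw [Nat.cast_add, Nat.cast_one]
      rcases he with he | he | he | he
      · have : ((∑ r ∈ M.enabledPairs, (upperMonitor M m ε₁ h).visits r : ℕ) : ℝ) + 1
            ≤ (∑ r ∈ M.enabledPairs, (upperMonitor M m ε₁ (h ++ [x])).visits r : ℕ) := by
          exact_mod_cast hu.2 he
        linarith
      · have : ((∑ r ∈ M.enabledPairs, (lowerMonitor M m ε₁ h).visits r : ℕ) : ℝ) + 1
            ≤ (∑ r ∈ M.enabledPairs, (lowerMonitor M m ε₁ (h ++ [x])).visits r : ℕ) := by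
          exact_mod_cast hl.2 he
        linarith
      · rcases hup with ⟨h1, -⟩ | ⟨-, h1⟩
        · rw [run_snoc] at h1
          exact (he h1).elim
        · linarith
      · rcases hlp with ⟨h1, -⟩ | ⟨-, h1⟩
        · rw [run_snoc] at h1
          exact (he h1).elim
        · linarith
    · linarith

theorem sum_visits_le {σ : ℝ} {v₀ : S × A → ℝ} {e : Estimator S A} {μ : Monitor S A} {t : ℕ}
    (he : e.Sound m t) (h : ∀ r, Monitor.GapInv M m ε₁ σ v₀ e μ r) :
    ((∑ r ∈ M.enabledPairs, μ.visits r : ℕ) : ℝ)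
      ≤ (2 * m + 1) * e.progress σ ε₁ M.enabledPairs v₀ + M.enabledPairs.card * (2 * m) := by
  rw [Nat.cast_sum, Estimator.progress, Finset.mul_sum, ← nsmul_eq_mul, ← Finset.sum_const,
    ← Finset.sum_add_distrib]
  refine Finset.sum_le_sum fun r _ => (h r).visits_le.trans ?_
  linarith [Monitor.pending_le (M := M) (ε₁ := ε₁) (σ := σ) (μ := μ) (he.count_lt r)]

/-- The number of escapes is bounded, as long as there is no bad batch. -/
theorem escapeCount_le (hm : 0 < m) (hε : 0 < ε₁) (hε1 : ε₁ ≤ 1) {h : List (Move S A)}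
    (hh : Reachable (next M m ε₁) h) (hu : (upperMonitor M m ε₁ h).bad = 0)
    (hl : (lowerMonitor M m ε₁ h).bad = 0) :
    (escapeCount M m ε₁ h : ℝ) ≤ 6 * ((2 * m + 1) * (M.enabledPairs.card / ε₁)) := by
  obtain ⟨h1, h2, -⟩ := sound_run M hm hε h
  have h3 := escapeCount_le_sum M hε hh
  have h4 := sum_visits_le M h1 (upper_gapInv M hm hε hu)
  have h5 := sum_visits_le M h2 (lower_gapInv M hm hε hl)
  obtain ⟨h6, h7⟩ := progress_le M hm hε h
  have h8 : (M.enabledPairs.card : ℝ) ≤ M.enabledPairs.card / ε₁ :=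
    le_div_self (Nat.cast_nonneg _) hε hε1
  have h9 : (0 : ℝ) ≤ m := m.cast_nonneg
  unfold upperProgress at h3 h6
  unfold lowerProgress at h3 h7
  nlinarith

end DQL

/-! ### Discounted hitting probabilities -/

section History

variable {X : Type*} [Fintype X] (next : List X → PMF X) (E : List X → X → Prop) (γ : ℝ)

open scoped Classical in
/-- The probability that, after the history `h`, an event occurs within `k` steps, where the
process is killed with probability `1 - γ` after every step. -/
noncomputable def discountedHit : ℕ → List X → ℝ
  | 0, _ => 0
  | k + 1, h => (next h).avg fun x => if E h x then 1 else γ * discountedHit k (h ++ [x])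

/-- The probability that, after the history `h`, an event occurs before the process is killed. -/
noncomputable def discountedHitLim (h : List X) : ℝ :=
  ⨆ k, discountedHit next E γ k h

/-- The sum of a function over all nonempty prefixes of a history. -/
def prefixSum (f : List X → ℝ) : List X → ℝ :=
  histFold (fun h y x => y + f (h ++ [x])) 0

omit [Fintype X] in
theorem prefixSum_snoc (f : List X → ℝ) (h : List X) (x : X) :
    prefixSum f (h ++ [x]) = prefixSum f h + f (h ++ [x]) :=
  histFold_snoc _ _ _ _

omit [Fintype X] in
theorem prefixSum_firstMoves (f : List X → ℝ) (ω : ℕ → X) (n : ℕ) :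
    prefixSum f (firstMoves ω n) = ∑ t ∈ Finset.range n, f (firstMoves ω (t + 1)) := by
  induction n with
  | zero => rfl
  | succ n ih => rw [Finset.sum_range_succ, ← ih, firstMoves_succ, prefixSum_snoc]

variable {γ} (h0 : 0 ≤ γ) (h1 : γ ≤ 1)

include h0 h1

theorem discountedHit_mem (k : ℕ) (h : List X) :
    0 ≤ discountedHit next E γ k h ∧ discountedHit next E γ k h ≤ 1 := by
  induction k generalizing h with
  | zero => simp [discountedHit]
  | succ k ih =>
    unfold discountedHit
    refine ⟨PMF.avg_nonneg _ fun x _ => ?_, PMF.avg_le _ fun x _ => ?_⟩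
    all_goals split_ifs
    exacts [zero_le_one, mul_nonneg h0 (ih _).1, le_rfl, mul_le_one₀ h1 (ih _).1 (ih _).2]

theorem discountedHit_monotone (h : List X) : Monotone fun k => discountedHit next E γ k h := by
  refine monotone_nat_of_le_succ fun k => ?_
  induction k generalizing h with
  | zero => exact (discountedHit_mem next E h0 h1 1 h).1
  | succ k ih =>
    rw [discountedHit, discountedHit]
    refine PMF.avg_mono _ fun x _ => ?_
    split_ifs
    exacts [le_rfl, mul_le_mul_of_nonneg_left (ih _) h0]

theorem bddAbove_discountedHit (h : List X) :
    BddAbove (Set.range fun k => discountedHit next E γ k h) :=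
  ⟨1, by rintro _ ⟨k, rfl⟩; exact (discountedHit_mem next E h0 h1 k h).2⟩

theorem discountedHit_le_lim (k : ℕ) (h : List X) :
    discountedHit next E γ k h ≤ discountedHitLim next E γ h :=
  le_ciSup (bddAbove_discountedHit next E h0 h1 h) k

theorem discountedHitLim_mem (h : List X) :
    0 ≤ discountedHitLim next E γ h ∧ discountedHitLim next E γ h ≤ 1 :=
  ⟨(discountedHit_mem next E h0 h1 0 h).1.trans (discountedHit_le_lim next E h0 h1 0 h),
    ciSup_le fun k => (discountedHit_mem next E h0 h1 k h).2⟩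

-- The recursion becomes exact in the limit, with the same function on both sides; a finite horizon
-- would not provide this.
open scoped Classical in
theorem discountedHitLim_eq (h : List X) : discountedHitLim next E γ h
    = (next h).avg fun x => if E h x then 1 else γ * discountedHitLim next E γ (h ++ [x]) := by
  have ht : ∀ h, Filter.Tendsto (fun k => discountedHit next E γ k h) Filter.atTop
      (nhds (discountedHitLim next E γ h)) := fun h =>
    tendsto_atTop_ciSup (discountedHit_monotone next E h0 h1 h)
      (bddAbove_discountedHit next E h0 h1 h)
  refine tendsto_nhds_unique ((ht h).comp (Filter.tendsto_add_atTop_nat 1))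
    (PMF.tendsto_avg (f := fun k x => if E h x then 1 else γ * discountedHit next E γ k (h ++ [x]))
      _ fun x => ?_)
  split_ifs
  exacts [tendsto_const_nhds, (ht _).const_mul γ]

omit h0 h1 [Fintype X] in
theorem Real.exp_div_four_le {y : ℝ} (h0 : 0 ≤ y) (h1 : y ≤ 1) : Real.exp (y / 4) ≤ 1 + y / 2 := by
  have h2 := Real.abs_exp_sub_one_le (x := y / 4) (by rw [abs_of_nonneg] <;> linarith)
  rw [abs_of_nonneg (by positivity : 0 ≤ y / 4)] at h2
  linarith [le_abs_self (Real.exp (y / 4) - 1)]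

/-- A supermartingale that relates the discounted hitting probabilities with the number `N` of
events. -/
theorem avg_exp_prefixSum_le {N : List X → ℕ}
    (hE : ∀ h x, E h x → N (h ++ [x]) = N h + 1) (hE' : ∀ h x, ¬ E h x → N (h ++ [x]) = N h)
    (h : List X) :
    ((next h).avg fun x => Real.exp ((1 - γ) / 4 * prefixSum (discountedHitLim next E γ) (h ++ [x])
        - N (h ++ [x])) * (1 - discountedHitLim next E γ (h ++ [x]) / 2))
      ≤ Real.exp ((1 - γ) / 4 * prefixSum (discountedHitLim next E γ) h - N h)
        * (1 - discountedHitLim next E γ h / 2) := by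
  classical
  have hfix : 1 - discountedHitLim next E γ h / 2 = (next h).avg fun x =>
      1 - 1 / 2 * (if E h x then 1 else γ * discountedHitLim next E γ (h ++ [x])) := by
    rw [PMF.avg_sub, PMF.avg_const, PMF.avg_const_mul, ← discountedHitLim_eq next E h0 h1 h]
    ring
  rw [hfix, ← PMF.avg_const_mul]
  refine PMF.avg_mono _ fun x _ => ?_
  obtain ⟨hu0, hu1⟩ := discountedHitLim_mem next E h0 h1 (h ++ [x])
  rw [prefixSum_snoc]
  set u := discountedHitLim next E γ (h ++ [x])
  have hy0 : 0 ≤ (1 - γ) * u := mul_nonneg (by linarith) hu0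
  have hy1 : (1 - γ) * u ≤ 1 := by nlinarith
  have hexp : Real.exp ((1 - γ) * u / 4) ≤ 1 + (1 - γ) * u / 2 := Real.exp_div_four_le hy0 hy1
  -- An event lowers the exponent by 1, while the sum raises it by at most 1/4; the factor exp(-3/4)
  -- ≤ 1/2 matches the value 1 - 1/2 on the right.
  by_cases he : E h x
  · rw [if_pos he, hE h x he]
    have h3 : (1 - γ) / 4 * (prefixSum (discountedHitLim next E γ) h + u) - ((N h + 1 : ℕ) : ℝ)
        = ((1 - γ) / 4 * prefixSum (discountedHitLim next E γ) h - N h)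
          + ((1 - γ) * u / 4 - 1) := by
      push_cast
      ring
    rw [h3, Real.exp_add, mul_assoc]
    refine mul_le_mul_of_nonneg_left ?_ (Real.exp_pos _).le
    have h4 : Real.exp ((1 - γ) * u / 4 - 1) ≤ Real.exp (-(3 / 4)) :=
      Real.exp_le_exp.mpr (by linarith)
    have h5 : Real.exp (-(3 / 4)) ≤ 1 / 2 := by
      rw [Real.exp_neg, inv_le_comm₀ (Real.exp_pos _) (by norm_num)]
      have := Real.quadratic_le_exp_of_nonneg (x := 3 / 4) (by norm_num)
      norm_num at this ⊢
      linarith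
    have h6 := Real.exp_pos ((1 - γ) * u / 4 - 1)
    nlinarith
  · rw [if_neg he, hE' h x he]
    have h3 : (1 - γ) / 4 * (prefixSum (discountedHitLim next E γ) h + u) - (N h : ℝ)
        = ((1 - γ) / 4 * prefixSum (discountedHitLim next E γ) h - N h)
          + (1 - γ) * u / 4 := by ring
    rw [h3, Real.exp_add, mul_assoc]
    refine mul_le_mul_of_nonneg_left ?_ (Real.exp_pos _).le
    -- Without an event, (1 + (1 - γ)u/2)(1 - u/2) ≤ 1 - γu/2: the loss by killing pays for the
    -- growth of the sum.
    have h4 := mul_le_mul_of_nonneg_right hexp (by linarith : 0 ≤ 1 - u / 2)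
    nlinarith

omit h0 h1

/-- A nonnegative supermartingale that starts in `1` stays above `K` with probability at most
`1 / K`. -/
theorem real_eventually_ge_le [MeasurableSpace X] [DiscreteMeasurableSpace X] {F : List X → ℝ}
    (hpos : ∀ h, 0 ≤ F h) (hF : ∀ h, (next h).avg (fun x => F (h ++ [x])) ≤ F h) (hF1 : F [] ≤ 1)
    {K : ℝ} (hK : 0 < K) :
    (processLaw next).real {ω | ∃ n, ∀ k ≥ n, K ≤ F (firstMoves ω k)} ≤ 1 / K := by
  classical
  have hU : {ω | ∃ n, ∀ k ≥ n, K ≤ F (firstMoves ω k)}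
      = ⋃ n, {ω | ∀ k ≥ n, K ≤ F (firstMoves ω k)} := by
    ext ω
    simp
  have hmono : Monotone fun n => {ω : ℕ → X | ∀ k ≥ n, K ≤ F (firstMoves ω k)} :=
    fun n k hnk ω hω j hj => hω j (hnk.trans hj)
  rw [hU]
  refine le_of_tendsto' ((ENNReal.tendsto_toReal (measure_ne_top _ _)).comp
    (tendsto_measure_iUnion_atTop hmono)) fun n => ?_
  have h1 : (processLaw next).real {ω | ∀ k ≥ n, K ≤ F (firstMoves ω k)}
      ≤ (processLaw next).real {ω | K ≤ F (firstMoves ω n)} :=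
    measureReal_mono fun ω hω => hω n le_rfl
  refine h1.trans ?_
  rw [real_firstMoves next (fun h => K ≤ F h) n]
  refine (expect_mono next (g := fun h => 1 / K * F h) (fun h => ?_) n []).trans ?_
  · have := hpos h
    split_ifs with hk
    · rwa [one_div, inv_mul_eq_div, one_le_div hK]
    · positivity
  · rw [expect_const_mul]
    exact mul_le_of_le_one_right (by positivity) ((expect_le_of_supermartingale next hF n []).trans hF1)

end History

theorem finite_setOf_lt_of_sum_le {a : ℕ → ℝ} (ha : ∀ t, 0 ≤ a t) {K θ : ℝ} (hθ : 0 < θ)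
    (h : ∀ n, ∑ t ∈ Finset.range n, a t ≤ K) :
    {t | θ < a t}.Finite ∧ ({t | θ < a t}.ncard : ℝ) ≤ K / θ := by
  have hF : ∀ F : Finset ℕ, (F : Set ℕ) ⊆ {t | θ < a t} → (F.card : ℝ) ≤ K / θ := by
    intro F hF
    obtain ⟨n, hn⟩ := F.exists_nat_subset_range
    rw [le_div_iff₀ hθ, ← nsmul_eq_mul]
    exact (Finset.card_nsmul_le_sum F a θ fun t ht => (hF ht).le).trans
      ((Finset.sum_le_sum_of_subset_of_nonneg hn fun t _ _ => ha t).trans (h n))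
  have hfin : {t | θ < a t}.Finite := by
    by_contra hinf
    obtain ⟨F, hFs, hFc⟩ := Set.Infinite.exists_subset_card_eq hinf (⌊K / θ⌋₊ + 1)
    have := hF F hFs
    rw [hFc] at this
    exact (Nat.lt_floor_add_one (K / θ)).not_ge (by exact_mod_cast this)
  refine ⟨hfin, ?_⟩
  rw [Set.ncard_eq_toFinset_card _ hfin]
  exact hF _ (by simp)

/-! ### Discounted escape probabilities along a run -/

namespace DQL

variable {S A : Type*} [Fintype S] [Fintype A] (M : MDP S A) {m : ℕ} {ε₁ : ℝ}

/-- The process survives `k` rounds of killing with probability γ^k. The run and the executed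
strategy differ only after a terminal state, where the escape probability is 0 by definition and the
restarted run can only gain. -/
theorem mul_escape_le_discountedHit {γ : ℝ} (h0 : 0 ≤ γ) (h1 : γ ≤ 1) (k : ℕ)
    (h : List (Move S A)) :
    γ ^ k * Tables.escape M m ε₁ k (run M m ε₁ h).1 (run M m ε₁ h).2
      ≤ discountedHit (next M m ε₁) (EscapesAt M m ε₁) γ k h := by
  classical
  induction k generalizing h with
  | zero => simp [Tables.escape, discountedHit]
  | succ k ih =>
    by_cases hs : M.Terminal (run M m ε₁ h).2
    · rw [Tables.escape, if_pos hs, mul_zero]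
      exact (discountedHit_mem _ _ h0 h1 _ _).1
    · rw [Tables.escape_succ k _ hs, discountedHit, next, ← PMF.avg_const_mul]
      refine PMF.avg_mono _ fun x _ => ?_
      by_cases he : EscapesAt M m ε₁ h x
      · rw [if_pos he, if_pos (c := Tables.Escapes M m ε₁ _ _ _ _) he, mul_one]
        exact pow_le_one₀ h0 h1
      · rw [if_neg he, if_neg (c := Tables.Escapes M m ε₁ _ _ _ _) he, pow_succ', mul_assoc]
        refine mul_le_mul_of_nonneg_left ?_ h0
        by_cases hx : M.Terminal x.dest
        · have : Tables.escape M m ε₁ k ((run M m ε₁ h).1.observe M m ε₁ (run M m ε₁ h).2 x.act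
              x.dest) x.dest = 0 := by
            cases k with
            | zero => rfl
            | succ k => rw [Tables.escape, if_pos hx]
          rw [this, mul_zero]
          exact (discountedHit_mem _ _ h0 h1 _ _).1
        · have := ih (h ++ [x])
          rwa [run_snoc, if_neg (c := x.dest = M.sink ∨ x.dest = M.target) hx] at this

/-- The discount factor that corresponds to a horizon of `T` steps. -/
noncomputable def discount (T : ℕ) : ℝ := T / (T + 1)

theorem discount_mem (T : ℕ) : 0 ≤ discount T ∧ discount T ≤ 1 := by
  unfold discount
  exact ⟨by positivity, (div_le_one (by positivity)).mpr (by linarith)⟩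

theorem one_sub_discount (T : ℕ) : 1 - discount T = 1 / (T + 1) := by
  unfold discount
  field_simp
  ring

/-- The inverse of the discount factor is 1 + 1/T, whose T-th power is at most e. -/
theorem one_le_mul_discount_pow {T : ℕ} (hT : 0 < T) : 1 ≤ 3 * discount T ^ T := by
  have hT' : (0 : ℝ) < T := by exact_mod_cast hT
  have h1 : (1 / (T : ℝ) + 1) ^ T ≤ 3 := by
    refine (pow_le_pow_left₀ (by positivity) (Real.add_one_le_exp (1 / (T : ℝ))) T).trans ?_
    rw [← Real.exp_nat_mul, mul_one_div_cancel hT'.ne']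
    linarith [Real.exp_one_lt_d9]
  have h2 : (1 / (T : ℝ) + 1) * discount T = 1 := by
    unfold discount
    field_simp
    ring
  have h3 : (1 / (T : ℝ) + 1) ^ T * discount T ^ T = 1 := by rw [← mul_pow, h2, one_pow]
  have h4 := pow_nonneg (discount_mem T).1 T
  nlinarith

/-- The discounted probability of an escape after a history. -/
noncomputable def escapeRate (m : ℕ) (ε₁ : ℝ) (T : ℕ) : List (Move S A) → ℝ :=
  discountedHitLim (next M m ε₁) (EscapesAt M m ε₁) (discount T)

theorem escape_le_escapeRate {T : ℕ} (hT : 0 < T) (h : List (Move S A)) :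
    Tables.escape M m ε₁ T (run M m ε₁ h).1 (run M m ε₁ h).2 ≤ 3 * escapeRate M m ε₁ T h := by
  obtain ⟨h0, h1⟩ := discount_mem T
  have h2 := mul_escape_le_discountedHit M (m := m) (ε₁ := ε₁) h0 h1 T h
  have h3 := discountedHit_le_lim (next M m ε₁) (EscapesAt M m ε₁) h0 h1 T h
  have h4 := one_le_mul_discount_pow hT
  have h5 := (Tables.escape_mem (M := M) (m := m) (ε₁ := ε₁) T (run M m ε₁ h).1
    (run M m ε₁ h).2).1
  unfold escapeRate
  nlinarith

/-- The exponential supermartingale of the escapes. -/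
noncomputable def escapeWeight (m : ℕ) (ε₁ : ℝ) (T : ℕ) (h : List (Move S A)) : ℝ :=
  Real.exp ((1 - discount T) / 4 * prefixSum (escapeRate M m ε₁ T) h - escapeCount M m ε₁ h)
    * (1 - escapeRate M m ε₁ T h / 2)

theorem half_exp_le_escapeWeight (T : ℕ) (h : List (Move S A)) :
    Real.exp ((1 - discount T) / 4 * prefixSum (escapeRate M m ε₁ T) h
      - escapeCount M m ε₁ h) / 2 ≤ escapeWeight M m ε₁ T h := by
  have h1 := (discountedHitLim_mem (next M m ε₁) (EscapesAt M m ε₁) (discount_mem T).1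
    (discount_mem T).2 h).2
  rw [escapeWeight, div_eq_mul_one_div]
  refine mul_le_mul_of_nonneg_left ?_ (Real.exp_pos _).le
  unfold escapeRate
  linarith

theorem real_eventually_escapeWeight_ge_le (m : ℕ) (ε₁ : ℝ) (T : ℕ) {K : ℝ} (hK : 0 < K) :
    (law M m ε₁).real {ω | ∃ n, ∀ k ≥ n, K ≤ escapeWeight M m ε₁ T (firstMoves ω k)}
      ≤ 1 / K := by
  classical
  refine real_eventually_ge_le (next M m ε₁)
    (fun h => (half_pos (Real.exp_pos _)).le.trans (half_exp_le_escapeWeight M T h))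
    (fun h => ?_) ?_ hK
  · exact avg_exp_prefixSum_le (next M m ε₁) (EscapesAt M m ε₁) (discount_mem T).1
      (discount_mem T).2 (N := escapeCount M m ε₁)
      (fun h x he => by rw [escapeCount_snoc, if_pos he])
      (fun h x he => by rw [escapeCount_snoc, if_neg he]) h
  · have h1 := (discountedHitLim_mem (next M m ε₁) (EscapesAt M m ε₁) (discount_mem T).1
      (discount_mem T).2 []).1
    have h2 : prefixSum (escapeRate M m ε₁ T) [] = 0 := rfl
    rw [escapeWeight, escapeCount_nil, h2]
    simp only [mul_zero, Nat.cast_zero, sub_zero, Real.exp_zero, one_mul, escapeRate]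
    linarith

/-- Off the exceptional event, the discounted escape probabilities have a bounded sum. -/
theorem sum_escapeRate_le {T : ℕ} {K B : ℝ} (hK : 0 < K) {ω : ℕ → Move S A}
    (hω : ¬ ∃ n, ∀ k ≥ n, K ≤ escapeWeight M m ε₁ T (firstMoves ω k))
    (hB : ∀ n, (escapeCount M m ε₁ (firstMoves ω n) : ℝ) ≤ B) (n : ℕ) :
    ∑ t ∈ Finset.range n, escapeRate M m ε₁ T (firstMoves ω t)
      ≤ 1 + 4 * (T + 1) * (B + Real.log (2 * K)) := by
  have hmem := fun h => discountedHitLim_mem (next M m ε₁) (EscapesAt M m ε₁) (discount_mem T).1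
    (discount_mem T).2 h
  push Not at hω
  -- The supermartingale need not be small at `n` itself, but it is below `K` at some later time,
  -- and the sum to be bounded only grows until then.
  obtain ⟨k, hk, hlt⟩ := hω n
  have h1 := (half_exp_le_escapeWeight M T (firstMoves ω k)).trans_lt hlt
  have h2 : Real.exp ((1 - discount T) / 4 * prefixSum (escapeRate M m ε₁ T) (firstMoves ω k)
      - escapeCount M m ε₁ (firstMoves ω k)) < 2 * K := by linarith
  rw [← Real.lt_log_iff_exp_lt (by positivity), prefixSum_firstMoves, one_sub_discount] at h2
  have h3 : ∑ t ∈ Finset.range n, escapeRate M m ε₁ T (firstMoves ω t)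
      ≤ ∑ t ∈ Finset.range (k + 1), escapeRate M m ε₁ T (firstMoves ω t) :=
    Finset.sum_le_sum_of_subset_of_nonneg (Finset.range_mono (by omega)) fun t _ _ => (hmem _).1
  -- `prefixSum` omits the empty history; its term accounts for the summand 1 of the bound.
  rw [Finset.sum_range_succ'] at h3
  have h4 : escapeRate M m ε₁ T (firstMoves ω 0) ≤ 1 := (hmem _).2
  set Y := ∑ t ∈ Finset.range k, escapeRate M m ε₁ T (firstMoves ω (t + 1))
  have h5 := hB k
  have h6 : 1 / ((T : ℝ) + 1) / 4 * Y < B + Real.log (2 * K) := by linarith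
  have h7 : Y = 4 * (T + 1) * (1 / ((T : ℝ) + 1) / 4 * Y) := by field_simp
  have h8 := mul_le_mul_of_nonneg_left h6.le (by positivity : (0 : ℝ) ≤ 4 * (T + 1))
  linarith

end DQL

/-! ### Events that cannot persist -/

section History

variable {X : Type*} (next : List X → PMF X) (Q : List X → X → Prop)

/-- All the entries of a history from position `t` on satisfy `Q`. -/
def holdsFrom (t : ℕ) : List X → Prop :=
  histFold (fun h b x => b ∧ (t ≤ h.length → Q h x)) True

theorem holdsFrom_snoc (t : ℕ) (h : List X) (x : X) :
    holdsFrom Q t (h ++ [x]) ↔ holdsFrom Q t h ∧ (t ≤ h.length → Q h x) :=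
  iff_of_eq (histFold_snoc _ _ _ _)

theorem holdsFrom_firstMoves {t : ℕ} {ω : ℕ → X} (hω : ∀ j ≥ t, Q (firstMoves ω j) (ω j)) (n : ℕ) :
    holdsFrom Q t (firstMoves ω n) := by
  induction n with
  | zero => trivial
  | succ n ih =>
    rw [firstMoves_succ, holdsFrom_snoc]
    exact ⟨ih, fun h => hω n (by simpa [firstMoves] using h)⟩

variable [Fintype X]

open scoped Classical in
/-- The probability that the next `k` entries satisfy `Q`. -/
noncomputable def persist : ℕ → List X → ℝ
  | 0, _ => 1
  | k + 1, h => (next h).avg fun x => if Q h x then persist k (h ++ [x]) else 0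

open scoped Classical in
theorem expect_eq_zero_of_not_holdsFrom (t k : ℕ) {h : List X} (hh : ¬ holdsFrom Q t h) :
    expect next k (fun h => if holdsFrom Q t h then (1 : ℝ) else 0) h = 0 := by
  induction k generalizing h with
  | zero => exact if_neg hh
  | succ k ih =>
    exact (PMF.avg_congr _ (g := fun _ => 0) fun x _ =>
      ih fun hx => hh ((holdsFrom_snoc Q t h x).mp hx).1).trans (PMF.avg_const _ 0)

open scoped Classical in
theorem expect_holdsFrom_le {t : ℕ} (k : ℕ) {h : List X} (ht : t ≤ h.length) :
    expect next k (fun h => if holdsFrom Q t h then (1 : ℝ) else 0) h ≤ persist next Q k h := by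
  induction k generalizing h with
  | zero =>
    unfold expect persist
    dsimp only
    split_ifs <;> norm_num
  | succ k ih =>
    rw [expect, persist]
    refine PMF.avg_mono _ fun x _ => ?_
    split_ifs with hQ
    · exact ih (by simp; omega)
    · exact (expect_eq_zero_of_not_holdsFrom next Q t k fun hx =>
        hQ (((holdsFrom_snoc Q t h x).mp hx).2 ht)).le

/-- If `Q` held from `t` on, it would hold at the `k` moves after `t`, whatever the history at `t`;
by uniformity this has arbitrarily small probability. -/
theorem ae_frequently_not [MeasurableSpace X] [DiscreteMeasurableSpace X]
    (hQ : ∀ η > 0, ∃ k, ∀ h, persist next Q k h ≤ η) :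
    ∀ᵐ ω ∂processLaw next, ∀ t, ∃ j ≥ t, ¬ Q (firstMoves ω j) (ω j) := by
  classical
  rw [ae_all_iff]
  intro t
  have h0 : (processLaw next).real {ω | ¬ ∃ j ≥ t, ¬ Q (firstMoves ω j) (ω j)} = 0 := by
    refine le_antisymm (le_of_forall_pos_le_add fun η hη => ?_) measureReal_nonneg
    rw [zero_add]
    obtain ⟨k, hk⟩ := hQ η hη
    have h1 : ∀ n (h : List X), t ≤ h.length + n →
        expect next (n + k) (fun h => if holdsFrom Q t h then (1 : ℝ) else 0) h ≤ η := by
      intro n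
      induction n with
      | zero =>
        intro h ht
        rw [zero_add]
        exact (expect_holdsFrom_le next Q k ht).trans (hk h)
      | succ n ih =>
        intro h ht
        rw [Nat.add_right_comm, expect]
        exact PMF.avg_le _ fun x _ => ih _ (by simp; omega)
    refine le_trans (measureReal_mono fun ω hω => ?_)
      ((real_firstMoves next (holdsFrom Q t) (t + k)).trans_le (h1 t [] (by simp)))
    simp only [Set.mem_ofPred_eq, not_exists, not_and, not_not] at hω
    exact holdsFrom_firstMoves Q hω _
  rwa [measureReal_eq_zero_iff] at h0

end History

/-! ### Simulations end infinitely often -/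

namespace DQL

variable {S A : Type*} [Fintype S] [Fintype A] (M : MDP S A) {m : ℕ} {ε₁ : ℝ}

/-- The move `x` neither ends the simulation nor changes the upper bounds, which are correct. -/
def Idle (m : ℕ) (ε₁ : ℝ) (h : List (Move S A)) (x : Move S A) : Prop :=
  Tables.UpperCorrect M (run M m ε₁ h).1 ∧ ¬ M.Terminal x.dest ∧
    (run M m ε₁ (h ++ [x])).1.upper.val = (run M m ε₁ h).1.upper.val

/-- Idle moves leave the upper bounds unchanged, so the actions are drawn as in the frozen greedy
chain. -/
theorem persist_idle_le_survive (k : ℕ) {h : List (Move S A)}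
    (hs : ¬ M.Terminal (run M m ε₁ h).2) :
    persist (next M m ε₁) (Idle M m ε₁) k h
      ≤ Tables.survive M (run M m ε₁ h).1 k (run M m ε₁ h).2 := by
  classical
  induction k generalizing h with
  | zero => rw [persist, Tables.survive, if_neg hs]
  | succ k ih =>
    rw [persist, Tables.survive, if_neg hs, Tables.frozenStep_eq, next]
    refine PMF.avg_mono _ fun x _ => ?_
    split_ifs with hx
    · obtain ⟨-, h2, h3⟩ := hx
      have h4 : (run M m ε₁ (h ++ [x])).2 = x.dest := by rw [run_snoc]; exact if_neg h2
      have h5 := ih (h := h ++ [x]) (by rwa [h4])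
      rwa [h4, Tables.survive_congr h3] at h5
    · exact (Tables.survive_mem _ _ _).1

omit [Fintype S] [Fintype A] in
theorem terminal_dest {h : List (Move S A)} (hs : M.Terminal (run M m ε₁ h).2)
    {x : Move S A} (hx : x ∈ (next M m ε₁ h).support) : M.Terminal x.dest := by
  rw [next, MDP.stepLaw, PMF.mem_support_bind_iff] at hx
  obtain ⟨a, ha, hx⟩ := hx
  rw [PMF.mem_support_map_iff] at hx
  obtain ⟨s', hs', rfl⟩ := hx
  have ha := Tables.mem_enabled_of_mem_support_greedy M _ _ a ha
  generalize (run M m ε₁ h).2 = s at hs ha hs'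
  rcases hs with rfl | rfl
  · left
    have h1 := M.sink_terminal a ha
    rw [PMF.apply_eq_one_iff] at h1
    rw [h1] at hs'
    exact hs'
  · right
    have h1 := M.target_terminal a ha
    rw [PMF.apply_eq_one_iff] at h1
    rw [h1] at hs'
    exact hs'

/-- Correctness of the upper bounds is part of being idle, so incorrect histories need no estimate.
From a correct non-terminal one, survival decays geometrically at a rate independent of the history;
from a terminal state, possible if the initial state is terminal, no move is idle. -/
theorem ae_frequently_not_idle (hM : M.EndComponentsHaveValueOne) {p : ℝ} (hp : M.IsMinProb p)
    (hm : 0 < m) (hε : 0 < ε₁) :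
    ∀ᵐ ω ∂law M m ε₁, ∀ t, ∃ j ≥ t, ¬ Idle M m ε₁ (firstMoves ω j) (ω j) := by
  classical
  rw [law_eq]
  refine ae_frequently_not (next M m ε₁) (Idle M m ε₁) fun η hη => ?_
  have : Nonempty S := ⟨M.init⟩
  obtain ⟨h0, h1⟩ := hp.div_maxEnabled_mem
  have hq0 := pow_pos h0 (Fintype.card S)
  have hq1 := pow_le_one₀ (n := Fintype.card S) h0.le h1
  set q := (p / M.maxEnabled) ^ Fintype.card S with hq
  obtain ⟨j, hj⟩ := exists_pow_lt_of_lt_one hη (by linarith : 1 - q < 1)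
  obtain ⟨k, hk⟩ := Nat.exists_eq_succ_of_ne_zero
    (Nat.mul_pos (Nat.succ_pos j) Fintype.card_pos : 0 < (j + 1) * Fintype.card S).ne'
  refine ⟨(j + 1) * Fintype.card S, fun h => ?_⟩
  have hc := valBounds_run M hm hε h
  by_cases hv : Tables.UpperCorrect M (run M m ε₁ h).1
  · by_cases hs : M.Terminal (run M m ε₁ h).2
    · rw [hk, persist]
      refine PMF.avg_le _ fun x hx => ?_
      rw [if_neg fun hi => hi.2.1 (terminal_dest M hs hx)]
      exact hη.le
    · refine (persist_idle_le_survive M _ hs).trans ((Tables.survive_mul_le _ (sub_nonneg.mpr hq1)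
        (Tables.survive_card_le hM hp _ (fun r => (hc.upper_mem r).2) hv) _ _).trans ?_)
      rw [pow_succ]
      have := pow_nonneg (sub_nonneg.mpr hq1) j
      nlinarith
  · rw [hk, persist]
    refine PMF.avg_le _ fun x hx => ?_
    rw [if_neg fun hi => hv hi.1]
    exact hη.le

/-- If the upper bounds are correct and there are finitely many escapes, then the simulation is in
the initial state infinitely often. -/
theorem exists_state_eq_init {ω : ℕ → Move S A}
    (hω : ∀ t, ∃ j ≥ t, ¬ Idle M m ε₁ (firstMoves ω j) (ω j))
    (hv : ∀ n, Tables.UpperCorrect M (run M m ε₁ (firstMoves ω n)).1) {B : ℝ}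
    (hB : ∀ n, (escapeCount M m ε₁ (firstMoves ω n) : ℝ) ≤ B) (t : ℕ) :
    ∃ j ≥ t, state M m ε₁ ω j = M.init := by
  classical
  have hmono : Monotone fun n => escapeCount M m ε₁ (firstMoves ω n) :=
    monotone_nat_of_le_succ fun n => by
      rw [firstMoves_succ, escapeCount_snoc]
      split_ifs <;> omega
  obtain ⟨N, hN⟩ : ∃ N, ∀ n ≥ N, escapeCount M m ε₁ (firstMoves ω n)
      = escapeCount M m ε₁ (firstMoves ω N) := by
    have hb : BddAbove (Set.range fun n => escapeCount M m ε₁ (firstMoves ω n)) :=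
      ⟨⌊B⌋₊, by rintro _ ⟨n, rfl⟩; exact Nat.le_floor (hB n)⟩
    obtain ⟨N, hN⟩ := Nat.sSup_mem (Set.range_nonempty _) hb
    exact ⟨N, fun n hn => le_antisymm ((le_csSup hb ⟨n, rfl⟩).trans_eq hN.symm) (hmono hn)⟩
  -- After the last escape the upper bounds are constant; as they are correct, a move that is not
  -- idle must end the simulation.
  obtain ⟨j, hj, hi⟩ := hω (max t N)
  refine ⟨j + 1, by omega, ?_⟩
  have h1 : ¬ EscapesAt M m ε₁ (firstMoves ω j) (ω j) := by
    intro he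
    have h2 := hN (j + 1) (by omega)
    rw [firstMoves_succ, escapeCount_snoc, if_pos he, hN j (by omega)] at h2
    omega
  have h3 : (run M m ε₁ (firstMoves ω j ++ [ω j])).1.upper.val
      = (run M m ε₁ (firstMoves ω j)).1.upper.val := by
    by_contra hne
    rw [run_snoc] at hne
    exact h1 (Or.inr (Or.inr (Or.inl hne)))
  have h4 : M.Terminal (ω j).dest := by
    by_contra hT
    exact hi ⟨hv j, hT, h3⟩
  rw [state, firstMoves_succ, run_snoc]
  exact if_pos h4

end DQL

/-! ### The probability of the exceptional events -/

namespace DQL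

variable {S A : Type*} [Fintype S] [Fintype A] (M : MDP S A)

section monitors

variable {m : ℕ} {ε₁ : ℝ} (hm : 0 < m) (hε : 0 < ε₁)

include hm hε

theorem real_upperMonitor_bad_le :
    (law M m ε₁).real {ω | ∃ n, (upperMonitor M m ε₁ (firstMoves ω n)).bad ≠ 0}
      ≤ Real.exp (-(2 * m * ε₁ ^ 2)) * (M.enabledPairs.card
        + M.enabledPairs.card * (1 + 3 * (M.enabledPairs.card / ε₁))) :=
  real_exists_bad_le M fun n => expect_bad_le M hε rfl
    (fun c s a s' => ⟨_, _, _, _, Tables.observe_upper M m ε₁ c s a s'⟩) (b := 0)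
    (fun h s => by simpa [Monitor.signedVal] using (sound_run M hm hε h).1.stateVal_mem s)
    (fun _ hh => sum_upper_att_le M hm hε hh) n

theorem real_lowerMonitor_bad_le :
    (law M m ε₁).real {ω | ∃ n, (lowerMonitor M m ε₁ (firstMoves ω n)).bad ≠ 0}
      ≤ Real.exp (-(2 * m * ε₁ ^ 2)) * (M.enabledPairs.card
        + M.enabledPairs.card * (1 + 3 * (M.enabledPairs.card / ε₁))) :=
  real_exists_bad_le M fun n => expect_bad_le M hε rfl
    (fun c s a s' => ⟨_, _, _, _, Tables.observe_lower M m ε₁ c s a s'⟩) (b := -1)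
    (fun h s => by
      have := (sound_run M hm hε h).2.1.stateVal_mem (M := M) s
      rw [Monitor.signedVal]
      constructor <;> linarith [this.1, this.2])
    (fun _ hh => sum_lower_att_le M hm hε hh) n

theorem real_valueMonitor_bad_le :
    (law M m ε₁).real {ω | ∃ n, (valueMonitor M m ε₁ (firstMoves ω n)).bad ≠ 0}
      ≤ Real.exp (-(2 * m * ε₁ ^ 2)) * (M.enabledPairs.card
        + M.enabledPairs.card * (1 + 3 * (M.enabledPairs.card / ε₁))) :=
  real_exists_bad_le M fun n => expect_bad_le M hε rfl
    (fun c s a s' => ⟨_, _, _, _, Tables.observe_upper M m ε₁ c s a s'⟩) (b := -1)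
    (fun h s => by constructor <;> linarith [M.optLim_nonneg s, M.optLim_le_one s])
    (fun _ hh => sum_upper_att_le M hm hε hh) n

end monitors

/-! ### Numerical estimates for the parameters -/

include M in
theorem card_pos_and_two_le : 0 < Fintype.card A ∧ 2 ≤ Fintype.card S := by
  obtain ⟨a, -⟩ := M.enabled_nonempty M.init
  have : Nonempty A := ⟨a⟩
  have : Nontrivial S := ⟨⟨_, _, M.sink_ne_target⟩⟩
  exact ⟨Fintype.card_pos, Fintype.one_lt_card⟩

include M in
theorem one_le_card_mul_card : (1 : ℝ) ≤ Fintype.card S * Fintype.card A := by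
  obtain ⟨h1, h2⟩ := card_pos_and_two_le M
  exact_mod_cast Nat.mul_pos (by omega) h1

theorem two_mul_card_enabledPairs_le :
    2 * (M.enabledPairs.card : ℝ) ≤ Fintype.card S * Fintype.card A := by
  obtain ⟨-, h2⟩ := card_pos_and_two_le M
  exact_mod_cast Nat.mul_le_mul h2 M.card_enabledPairs_le

variable {M} {p ε δ : ℝ}

theorem one_lt_samples_arg (hp : M.IsMinProb p) (hε : 0 < ε) (hδ : 0 < δ) (hδ1 : δ < 1) :
    1 < 6 * (Fintype.card S * Fintype.card A) *
      (1 + Fintype.card S * Fintype.card A / eps₁ M p ε) / δ := by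
  have h1 := one_le_card_mul_card M
  have h2 := div_pos (zero_lt_one.trans_le h1) (eps₁_pos hp hε)
  rw [one_lt_div hδ]
  nlinarith

theorem samples_pos (hp : M.IsMinProb p) (hε : 0 < ε) (hδ : 0 < δ) (hδ1 : δ < 1) :
    0 < samples M p ε δ := by
  have := eps₁_pos hp hε
  exact Nat.ceil_pos.mpr (div_pos (Real.log_pos (one_lt_samples_arg hp hε hδ hδ1))
    (by positivity))

/-- The number of samples is chosen so that exp(-2mε₁²) is at most the inverse of the argument of
the logarithm. For the n enabled pairs and N = |S||A|, the number of batches is at most 2n + 3n²/ε₁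
≤ N + N²/ε₁, since 2n ≤ N. -/
theorem exp_samples_mul_le (hp : M.IsMinProb p) (hε : 0 < ε) (hδ : 0 < δ) (hδ1 : δ < 1) :
    Real.exp (-(2 * samples M p ε δ * eps₁ M p ε ^ 2)) * (M.enabledPairs.card
      + M.enabledPairs.card * (1 + 3 * (M.enabledPairs.card / eps₁ M p ε))) ≤ δ / 6 := by
  have h1 := one_le_card_mul_card M
  have h2 := two_mul_card_enabledPairs_le M
  have h3 := eps₁_pos hp hε
  have h4 := one_lt_samples_arg hp hε hδ hδ1
  have h5 : Real.log (6 * (Fintype.card S * Fintype.card A) *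
      (1 + Fintype.card S * Fintype.card A / eps₁ M p ε) / δ)
      ≤ 2 * samples M p ε δ * eps₁ M p ε ^ 2 := by
    have := Nat.le_ceil (Real.log (6 * (Fintype.card S * Fintype.card A) *
      (1 + Fintype.card S * Fintype.card A / eps₁ M p ε) / δ) / (2 * eps₁ M p ε ^ 2))
    rw [div_le_iff₀ (by positivity)] at this
    exact this.trans_eq (by unfold samples; ring)
  have h6 := Real.exp_le_exp.mpr (neg_le_neg h5)
  rw [Real.exp_neg (Real.log _), Real.exp_log (by linarith)] at h6
  set e := eps₁ M p ε
  set n : ℝ := (M.enabledPairs.card : ℝ)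
  set N : ℝ := (Fintype.card S : ℝ) * Fintype.card A
  have hn0 : 0 ≤ n := Nat.cast_nonneg _
  have h7 : n + n * (1 + 3 * (n / e)) ≤ N * (1 + N / e) := by
    have h8 : 3 * n * n ≤ N * N := by nlinarith
    have h9 := div_le_div_of_nonneg_right h8 h3.le
    have h10 : n + n * (1 + 3 * (n / e)) = 2 * n + 3 * n * n / e := by ring
    have h11 : N * (1 + N / e) = N + N * N / e := by ring
    linarith
  refine (mul_le_mul h6 h7 (by positivity) (by positivity)).trans (le_of_eq ?_)
  have : 0 < N := by linarith
  field_simp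

theorem eps₁_le_one (hp : M.IsMinProb p) (hε : 0 < ε) (hε2 : ε ≤ 2) : eps₁ M p ε ≤ 1 := by
  obtain ⟨-, h2⟩ := card_pos_and_two_le M
  have h2 : (2 : ℝ) ≤ Fintype.card S := by exact_mod_cast h2
  obtain ⟨h3, h4⟩ := hp.div_maxEnabled_mem
  have h5 := pow_le_one₀ (n := Fintype.card S) h3.le h4
  have h6 := pow_pos h3 (Fintype.card S)
  unfold eps₁
  rw [div_le_one (by positivity)]
  nlinarith

/-- The bound for the number of bad steps. -/
theorem count_bound (hp : M.IsMinProb p) (hε : 0 < ε) (hε2 : ε ≤ 2) (hδ : 0 < δ) (hδ1 : δ < 1)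
    {T : ℕ} (hT : 0 < T) :
    (1 + 4 * ((T : ℝ) + 1) * (6 * ((2 * samples M p ε δ + 1) *
        (M.enabledPairs.card / eps₁ M p ε)) + Real.log (2 * (3 / δ)))) / (eps₂ ε / 6)
      ≤ 438 * (zeta M p ε δ * T / eps₂ ε * max 1 (Real.log (1 / δ))) := by
  have h1 := one_le_card_mul_card M
  have h2 := two_mul_card_enabledPairs_le M
  have h3 := eps₁_pos hp hε
  have h4 := eps₁_le_one hp hε hε2
  have hT' : (1 : ℝ) ≤ T := by exact_mod_cast hT
  have he : 0 < eps₂ ε := by unfold eps₂; linarith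
  have hlog : Real.log (2 * (3 / δ)) ≤ 3 * max 1 (Real.log (1 / δ)) := by
    rw [show 2 * (3 / δ) = 6 * (1 / δ) by ring, Real.log_mul (by norm_num) (by positivity)]
    have h5 : Real.log 6 ≤ 2 := by
      rw [Real.log_le_iff_le_exp (by norm_num), show (2 : ℝ) = 1 + 1 by norm_num, Real.exp_add]
      nlinarith [Real.exp_one_gt_d9]
    linarith [le_max_left 1 (Real.log (1 / δ)), le_max_right 1 (Real.log (1 / δ))]
  have hm : (0 : ℝ) ≤ samples M p ε δ := Nat.cast_nonneg _
  have hz : (2 * samples M p ε δ + 1) * (M.enabledPairs.card / eps₁ M p ε) ≤ zeta M p ε δ := by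
    have hn : (0 : ℝ) ≤ M.enabledPairs.card := Nat.cast_nonneg _
    unfold zeta
    exact mul_le_mul_of_nonneg_left (div_le_div_of_nonneg_right (by linarith) h3.le) (by positivity)
  have hz1 : 1 ≤ zeta M p ε δ := by
    have h6 : 1 ≤ Fintype.card S * Fintype.card A / eps₁ M p ε := by
      rw [one_le_div h3]
      linarith
    unfold zeta
    nlinarith
  set L := max 1 (Real.log (1 / δ)) with hL
  have hL1 : 1 ≤ L := le_max_left _ _
  set z := zeta M p ε δ
  -- The constant is 438 = 6 · 73 with 73 = 1 + 4 · 2 · 9: the 6 is from the threshold ε₂/6, the 2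
  -- from T + 1 ≤ 2T, and the 9 from 6 times the escape bound plus ln(6/δ) ≤ 3L.
  rw [show 438 * (z * T / eps₂ ε * L) = 73 * (z * T * L) / (eps₂ ε / 6) by field_simp; norm_num]
  refine div_le_div_of_nonneg_right ?_ (by positivity)
  have h7 : 6 * ((2 * samples M p ε δ + 1) * (M.enabledPairs.card / eps₁ M p ε))
      + Real.log (2 * (3 / δ)) ≤ 9 * (z * L) := by
    have h8 : z ≤ z * L := le_mul_of_one_le_right (by linarith) hL1
    have h9 : L ≤ z * L := le_mul_of_one_le_left (by linarith) hz1
    linarith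
  have h10 : 1 ≤ z * L := one_le_mul_of_one_le_of_one_le hz1 hL1
  calc 1 + 4 * ((T : ℝ) + 1) * (6 * ((2 * samples M p ε δ + 1) *
        (M.enabledPairs.card / eps₁ M p ε)) + Real.log (2 * (3 / δ)))
      ≤ T * (z * L) + 4 * (T + T) * (9 * (z * L)) := by
        refine add_le_add (one_le_mul_of_one_le_of_one_le hT' h10) ?_
        refine (mul_le_mul_of_nonneg_left h7 (by positivity)).trans
          (mul_le_mul_of_nonneg_right (by linarith) (by positivity))
    _ = 73 * (z * T * L) := by ring

/-! ### The good runs and their probability -/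

/-- A run with at most `b` bad steps along which the bounds of the initial state eventually differ by
at most `ε`. -/
def Good (M : MDP S A) (m : ℕ) (ε₁ ε b : ℝ) (ω : ℕ → Move S A) : Prop :=
  (badSteps M m ε₁ (ε / 2) ω).Finite ∧ ((badSteps M m ε₁ (ε / 2) ω).ncard : ℝ) ≤ b ∧
    ∃ t₀ : ℕ, ∀ t ≥ t₀, (tables M m ε₁ ω t).upper.stateVal M M.init -
      (tables M m ε₁ ω t).lower.stateVal M M.init ≤ ε

/-- An error of ε/2 ≥ 1 is no restriction on probabilities. Separating this case gives ε₁ ≤ 1 in the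
other one. -/
theorem good_of_two_le {m : ℕ} {ε₁ b : ℝ} (hm : 0 < m) (hε : 0 < ε₁) (hε2 : 2 ≤ ε) (hb : 0 ≤ b)
    (ω : ℕ → Move S A) : Good M m ε₁ ε b ω := by
  have h1 : badSteps M m ε₁ (ε / 2) ω = ∅ := by
    refine Set.eq_empty_of_forall_notMem fun t ht => ht ?_
    unfold MDP.Strategy.IsOptimalUpTo
    have h2 := (M.value_le_optLim (state M m ε₁ ω t)).trans (M.optLim_le_one _)
    have h3 := ((tables M m ε₁ ω t).executed M m ε₁).reachProb_nonneg (state M m ε₁ ω t)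
    linarith
  refine ⟨by simp [h1], by simpa [h1] using hb, 0, fun t _ => ?_⟩
  have h2 := valBounds_run M hm hε (firstMoves ω t)
  have h3 := h2.upper_stateVal_le M.init
  have h4 := h2.lower_stateVal_nonneg M.init
  unfold tables
  linarith

omit [Fintype S] [Fintype A] in
theorem antitone_upper_sub_lower (m : ℕ) {ε₁ : ℝ} (hε : 0 < ε₁) (ω : ℕ → Move S A) (s : S) :
    Antitone fun t => (tables M m ε₁ ω t).upper.stateVal M s
      - (tables M m ε₁ ω t).lower.stateVal M s := by
  refine antitone_nat_of_succ_le fun t => ?_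
  unfold tables
  rw [firstMoves_succ]
  exact sub_le_sub (Finset.sup'_mono_fun fun a _ => upper_val_snoc_le M hε _ _ _)
    (Finset.sup'_mono_fun fun a _ => le_lower_val_snoc M hε _ _ _)

theorem good_of_not_exceptional (hM : M.EndComponentsHaveValueOne) (hp : M.IsMinProb p)
    (hε : 0 < ε) {T : ℕ} (hT : 0 < T)
    (hTle : Fintype.card S * Real.log (2 / eps₂ ε) / (p / M.maxEnabled) ^ Fintype.card S ≤ T)
    {m : ℕ} (hm : 0 < m) (hε1 : eps₁ M p ε ≤ 1) {K : ℝ} (hK : 0 < K) {ω : ℕ → Move S A}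
    (hr : ∀ n, Reachable (next M m (eps₁ M p ε)) (firstMoves ω n))
    (hi : ∀ t, ∃ j ≥ t, ¬ Idle M m (eps₁ M p ε) (firstMoves ω j) (ω j))
    (hu : ¬ ∃ n, (upperMonitor M m (eps₁ M p ε) (firstMoves ω n)).bad ≠ 0)
    (hl : ¬ ∃ n, (lowerMonitor M m (eps₁ M p ε) (firstMoves ω n)).bad ≠ 0)
    (hv : ¬ ∃ n, (valueMonitor M m (eps₁ M p ε) (firstMoves ω n)).bad ≠ 0)
    (hz : ¬ ∃ n, ∀ k ≥ n, K ≤ escapeWeight M m (eps₁ M p ε) T (firstMoves ω k)) :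
    Good M m (eps₁ M p ε) ε ((1 + 4 * ((T : ℝ) + 1) * (6 * ((2 * m + 1) *
      (M.enabledPairs.card / eps₁ M p ε)) + Real.log (2 * K))) / (eps₂ ε / 6)) ω := by
  have h1 := eps₁_pos hp hε
  set ε₁ := eps₁ M p ε with hε₁
  push Not at hu hl hv
  have he : 0 < eps₂ ε := by unfold eps₂; linarith
  have hB := fun n => escapeCount_le M hm h1 hε1 (hr n) (hu n) (hl n)
  have hcorrect := fun n => upperCorrect_run M hm h1 (hv n)
  obtain ⟨hfin, hcard⟩ := finite_setOf_lt_of_sum_le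
    (a := fun t => escapeRate M m ε₁ T (firstMoves ω t))
    (fun t => (discountedHitLim_mem _ _ (discount_mem T).1 (discount_mem T).2 _).1)
    (by positivity : 0 < eps₂ ε / 6) (sum_escapeRate_le M hK hz hB)
  have hsmall : ∀ t, t ∉ {t | eps₂ ε / 6 < escapeRate M m ε₁ T (firstMoves ω t)} →
      Tables.escape M m ε₁ T (tables M m ε₁ ω t) (state M m ε₁ ω t) ≤ eps₂ ε / 2 := by
    intro t ht
    rw [Set.mem_ofPred_eq, not_lt] at ht
    have := escape_le_escapeRate M (m := m) (ε₁ := ε₁) hT (firstMoves ω t)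
    unfold tables state
    linarith
  have hsub : badSteps M m ε₁ (ε / 2) ω
      ⊆ {t | eps₂ ε / 6 < escapeRate M m ε₁ T (firstMoves ω t)} := by
    intro t ht
    by_contra hlt
    exact ht (Tables.isOptimalUpTo_executed hM hp hε hTle (valBounds_run M hm h1 _)
      (hcorrect t) (hsmall t hlt))
  refine ⟨hfin.subset hsub, le_trans ?_ hcard, ?_⟩
  · exact_mod_cast Set.ncard_le_ncard hsub hfin
  -- Some step after the last one with a large escape rate is spent in the initial state; there the
  -- bounds are close, and they never move apart again.
  · obtain ⟨b, hb⟩ := hfin.bddAbove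
    obtain ⟨t, ht, hinit⟩ := exists_state_eq_init M hi hcorrect hB (b + 1)
    have h2 := Tables.upper_sub_lower_le hM hp hε hTle (valBounds_run M hm h1 _)
      (hcorrect t) (hsmall t fun hlt => by have := hb hlt; omega)
    rw [hinit] at h2
    exact ⟨t, fun t' ht' => (antitone_upper_sub_lower m h1 ω M.init ht').trans h2⟩

theorem one_sub_le_real_good (hM : M.EndComponentsHaveValueOne) (hp : M.IsMinProb p)
    (hε : 0 < ε) (hδ : 0 < δ) {T : ℕ} (hT : 0 < T)
    (hTle : Fintype.card S * Real.log (2 / eps₂ ε) / (p / M.maxEnabled) ^ Fintype.card S ≤ T) :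
    1 - δ ≤ (law M (samples M p ε δ) (eps₁ M p ε)).real {ω | Good M (samples M p ε δ)
      (eps₁ M p ε) ε (438 * (zeta M p ε δ * T / eps₂ ε * max 1 (Real.log (1 / δ)))) ω} := by
  rcases le_or_gt 1 δ with hδ1 | hδ1
  -- For δ ≥ 1 nothing is to be shown; δ < 1 ensures a positive number of samples.
  · exact (sub_nonpos.mpr hδ1).trans measureReal_nonneg
  have hm := samples_pos hp hε hδ hδ1
  have h1 := eps₁_pos hp hε
  have hprob : IsProbabilityMeasure (law M (samples M p ε δ) (eps₁ M p ε)) := by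
    rw [law_eq]
    infer_instance
  rcases le_or_gt 2 ε with hε2 | hε2
  · have hb : 0 ≤ 438 * (zeta M p ε δ * T / eps₂ ε * max 1 (Real.log (1 / δ))) := by
      have he : 0 < eps₂ ε := by unfold eps₂; linarith
      have hL : 0 < max 1 (Real.log (1 / δ)) := zero_lt_one.trans_le (le_max_left _ _)
      unfold zeta
      positivity
    have hG : {ω | Good M (samples M p ε δ) (eps₁ M p ε) ε
        (438 * (zeta M p ε δ * T / eps₂ ε * max 1 (Real.log (1 / δ)))) ω} = Set.univ :=
      Set.eq_univ_of_forall fun ω => good_of_two_le hm h1 hε2 hb ω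
    rw [hG, probReal_univ]
    linarith
  set m := samples M p ε δ with hm_def
  set ε₁ := eps₁ M p ε with hε₁
  set G := {ω | Good M m ε₁ ε (438 * (zeta M p ε δ * T / eps₂ ε * max 1 (Real.log (1 / δ)))) ω}
  set μ := law M m ε₁
  let Z : Set (ℕ → Move S A) := {ω | ¬ ((∀ n, Reachable (next M m ε₁) (firstMoves ω n)) ∧
    ∀ t, ∃ j ≥ t, ¬ Idle M m ε₁ (firstMoves ω j) (ω j))}
  let Bu := {ω | ∃ n, (upperMonitor M m ε₁ (firstMoves ω n)).bad ≠ 0}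
  let Bl := {ω | ∃ n, (lowerMonitor M m ε₁ (firstMoves ω n)).bad ≠ 0}
  let Bv := {ω | ∃ n, (valueMonitor M m ε₁ (firstMoves ω n)).bad ≠ 0}
  let Be := {ω | ∃ n, ∀ k ≥ n, 3 / δ ≤ escapeWeight M m ε₁ T (firstMoves ω k)}
  have hK : 0 < 3 / δ := by positivity
  have hcover : Set.univ ⊆ G ∪ (Z ∪ (Bu ∪ (Bl ∪ (Bv ∪ Be)))) := by
    intro ω _
    by_contra hω
    simp only [Set.mem_union, not_or] at hω
    obtain ⟨hG, hZ, hu, hl, hv, he⟩ := hω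
    obtain ⟨hr, hi⟩ := not_not.mp hZ
    obtain ⟨h2, h3, h4⟩ := good_of_not_exceptional hM hp hε hT hTle hm
      (eps₁_le_one hp hε hε2.le) hK hr hi hu hl hv he
    exact hG ⟨h2, h3.trans (count_bound hp hε hε2.le hδ hδ1 hT), h4⟩
  have hZ : μ.real Z = 0 := by
    rw [measureReal_eq_zero_iff]
    have h2 : ∀ᵐ ω ∂μ, ∀ n, Reachable (next M m ε₁) (firstMoves ω n) := by
      change ∀ᵐ ω ∂law M m ε₁, _
      rw [law_eq]
      exact ae_reachable _
    exact h2.and (ae_frequently_not_idle M hM hp hm h1)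
  -- The three monitors cost δ/6 each and the escape supermartingale at level 3/δ costs δ/3,
  -- altogether 5δ/6.
  have hq := exp_samples_mul_le hp hε hδ hδ1
  have hu : μ.real Bu ≤ δ / 6 := (real_upperMonitor_bad_le M hm h1).trans hq
  have hl : μ.real Bl ≤ δ / 6 := (real_lowerMonitor_bad_le M hm h1).trans hq
  have hv : μ.real Bv ≤ δ / 6 := (real_valueMonitor_bad_le M hm h1).trans hq
  have he : μ.real Be ≤ δ / 3 :=
    (real_eventually_escapeWeight_ge_le M m ε₁ T hK).trans_eq (one_div_div 3 δ)
  have h2 := measureReal_mono (μ := μ) hcover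
  rw [probReal_univ] at h2
  have h3 := measureReal_union_le (μ := μ) G (Z ∪ (Bu ∪ (Bl ∪ (Bv ∪ Be))))
  have h4 := measureReal_union_le (μ := μ) Z (Bu ∪ (Bl ∪ (Bv ∪ Be)))
  have h5 := measureReal_union_le (μ := μ) Bu (Bl ∪ (Bv ∪ Be))
  have h6 := measureReal_union_le (μ := μ) Bl (Bv ∪ Be)
  have h7 := measureReal_union_le (μ := μ) Bv Be
  linarith

end DQL

theorem mainTheorem4 :
    ∃ C : ℝ, 0 < C ∧
      ∀ (S A : Type*) [Fintype S] [Fintype A] (M : MDP S A),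
        M.EndComponentsHaveValueOne →
        ∀ p : ℝ, M.IsMinProb p →
        ∀ ε δ : ℝ, 0 < ε → 0 < δ →
        ∀ T : ℕ, 0 < T →
          Fintype.card S * Real.log (2 / DQL.eps₂ ε) / (p / M.maxEnabled) ^ Fintype.card S ≤ T →
          1 - δ ≤ (DQL.law M (DQL.samples M p ε δ) (DQL.eps₁ M p ε)).real
            {ω | (DQL.badSteps M (DQL.samples M p ε δ) (DQL.eps₁ M p ε) (ε / 2) ω).Finite ∧
              ((DQL.badSteps M (DQL.samples M p ε δ) (DQL.eps₁ M p ε) (ε / 2) ω).ncard : ℝ) ≤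
                C * (DQL.zeta M p ε δ * T / DQL.eps₂ ε * max 1 (Real.log (1 / δ))) ∧
              ∃ t₀ : ℕ, ∀ t ≥ t₀,
                (DQL.tables M (DQL.samples M p ε δ) (DQL.eps₁ M p ε) ω t).upper.stateVal M M.init -
                  (DQL.tables M (DQL.samples M p ε δ) (DQL.eps₁ M p ε) ω t).lower.stateVal M M.init
                    ≤ ε} := by
  refine ⟨438, by norm_num, ?_⟩
  intro S A _ _ M hM p hp ε δ hε hδ T hT hTle
  exact DQL.one_sub_le_real_good hM hp hε hδ hT hTle
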